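/- Let $K$ be the equilateral triangle with vertices $(-1,-1/\sqrt3),(1,-1/\sqrt3),(0,2/\sqrt3)$, let $P_k$ be the polynomials of total degree at most $k$ on $K$, represented in the orthonormal Dubiner basis $(\phi_m)$, and let $M$, $D_x$, $D_y$ be the mass and differentiation matrices in this basis. Call a matrix $Q$ *admissible* if $Q=Q^T$, $QD_{x}+D_{x}^TQ^T=0$ and $QD_{y}+D_{y}^TQ^T=0$, $M+Q$ is positive definite, and $Q$ commutes with the matrix of the rotation by $2\pi/3$ and with that of the reflection in the axis $x=0$; it then defines the linearly stable flux reconstruction scheme with correction matrix $C=(M+Q)^{-1}L_\partial^TW_\partial$. Here $k+1$ distinct boundary flux points are placed on each edge (at the same parameters on every edge), $L_\partial$ evaluates modes at these points, and $W_\partial$ is the exact surface mass matrix for edgewise polynomials of degree $k$. Put $C_{DG}=M^{-1}L_\partial^TW_\partial$. Let $RT_k=P_k^2+(x,y)^TP_k$. A spectral difference (SD) scheme is given by the boundary flux points with outward normals together with $k(k+1)$ interior degrees of freedom (points with normals) such that the Lagrange basis of $RT_k$ for these normal point values exists; column $j$ of $C_{SD}$ consists of the modal coefficients of the divergence of the Lagrange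 basis function of boundary flux point $j$. "Collocated" means that each interior point is used twice, with normals $e_x$ and $e_y$. Put $A(Q)=QC_{SD}+M(C_{SD}-C_{DG})$. The $(z)$-orbit consists of the three points with barycentric coordinates a permutation of $(1-2z,z,z)$, $0\le z\le 1/2$; the $(z_1,z_2)$-orbit consists of the six points with barycentric coordinates a permutation of $(z_1,z_2,1-z_1-z_2)$, $z_1,z_2\ge0$, $z_1+z_2\le1$ (points counted with multiplicity). Then, for every choice of the boundary flux points: 1. ($k=1$) The admissible matrices are exactly $Q=\mathrm{diag}(0,q_0,q_0)$ with $q_0>-1$. The SD scheme with its interior point, collocated, at the centroid exists; $A(\mathrm{diag}(0,q_0,q_0))=0$ if and only if $q_0=1/3$, and $C_{SD}=(M+Q)^{-1}L_\partial^TW_\partial$ for $Q=\mathrm{diag}(0,1/3,1/3)$. 2. ($k=2$) No SD scheme has $A(Q)=0$, or $C_{SD}=(M+Q)^{-1}L_\partial^TW_\partial$, for an admissible $Q$, if its interior flux points are (a) a $(z_1)$-orbit, collocated; or (b) six points, each with one normal (arbitrary vectors), forming either the union of a $(z_1)$-orbit and a $(z_2)$-orbit or a $(z_1,z_2)$-orbit.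 3. ($k=3$) The same holds if the interior flux points are, collocated, the union of a $(z_1)$-orbit and a $(z_2)$-orbit (type $(0,2,0)$), or a $(z_1,z_2)$-orbit (type $(0,0,1)$). Hence no SD scheme in these sets belongs to the extended range of linearly stable flux reconstruction schemes. Moreover, in all cases of 2 and 3, whether or not the Lagrange basis exists, for every admissible $Q$ there is a field $F\in RT_k$ whose interior degrees of freedom all vanish such that $Qd+M(d-C_{DG}\,g)\ne0$, where $d$ holds the modal coefficients of $\nabla\cdot F$ and $g$ the outward normal components of $F$ at the boundary flux points. -/

import Mathlib

noncomputable section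

open MeasureTheory
open scoped Matrix

namespace TriFR

/-! ## Polynomials in two variables and the reference triangle -/

/-- Points (and vectors) of the plane. -/
abbrev Pt := Fin 2 → ℝ

/-- Real polynomials in the two variables `x = X 0`, `y = X 1`. -/
abbrev BiPoly := MvPolynomial (Fin 2) ℝ

/-- Polynomials of total degree at most `k`. -/
abbrev PolySpace (k : ℕ) : Submodule ℝ BiPoly := MvPolynomial.restrictTotalDegree (Fin 2) ℝ k

/-- Vertices of the reference equilateral triangle, counterclockwise. -/
def vertex : Fin 3 → Pt := ![![-1, -1 / √3], ![1, -1 / √3], ![0, 2 / √3]]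

/-- The (closed) reference triangle. -/
def triangle : Set Pt := convexHull ℝ (Set.range vertex)

/-- The point with barycentric coordinates `c`. -/
def baryPoint (c : Fin 3 → ℝ) : Pt := ∑ i, c i • vertex i

/-- Edge `e` runs from `vertex e` to `vertex (e + 1)`. All edges have length `2`, so
`t ∈ [-1, 1]` is an arc-length parameter. -/
def edgePoint (e : Fin 3) (t : ℝ) : Pt :=
  ((1 - t) / 2) • vertex e + ((1 + t) / 2) • vertex (e + 1)

/-- Outward unit normal of edge `e`. -/
def edgeNormal (e : Fin 3) : Pt :=
  ![(vertex (e + 1) 1 - vertex e 1) / 2, -((vertex (e + 1) 0 - vertex e 0) / 2)]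

/-! ## The Dubiner basis -/

/-- The Jacobi polynomial `P_n^{(α,0)}`. -/
def jacobi (α n : ℕ) : Polynomial ℝ :=
  ∑ s ∈ Finset.range (n + 1),
    Polynomial.C (((n + α).choose (n - s) * n.choose s : ℕ) : ℝ) *
      ((Polynomial.C (1 / 2) * (Polynomial.X - 1)) ^ s *
        (Polynomial.C (1 / 2) * (Polynomial.X + 1)) ^ (n - s))

/-- Normalising factor: `jacobiNorm α n * P_n^{(α,0)}` has unit norm in `L²(-1,1)` with weight
`(1 - x)^α`. -/
def jacobiNorm (α n : ℕ) : ℝ := √((2 * n + α + 1) / 2 ^ (α + 1))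

/-- The collapsed coordinate `b = (2√3 y - 1) / 3`. -/
def collapsedB : BiPoly :=
  MvPolynomial.C (2 * √3 / 3) * MvPolynomial.X 1 - MvPolynomial.C (1 / 3)

/-- `u = (1 - b) / 2`. -/
def collapsedU : BiPoly := MvPolynomial.C (1 / 2) * (1 - collapsedB)

/-- `(1 - b)^v P_v(a)` with `P_v` the Legendre polynomial and `a = 3x / (2 - √3 y)`, written as
a polynomial by means of `a (1 - b) = 2 x`. -/
def legendreHom (v : ℕ) : BiPoly :=
  ∑ s ∈ Finset.range (v + 1),
    MvPolynomial.C (((v + 0).choose (v - s) * v.choose s : ℕ) : ℝ) *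
      ((MvPolynomial.X 0 - collapsedU) ^ s * (MvPolynomial.X 0 + collapsedU) ^ (v - s))

/-- The Dubiner polynomial
`2 / 3^{1/4} (1 - b)^v ψ_v(a) ψ_w^{(2v+1,0)}(b)` (see `eval_dubiner`). -/
def dubiner (v w : ℕ) : BiPoly :=
  MvPolynomial.C (2 / (3 : ℝ) ^ (1 / 4 : ℝ) * jacobiNorm 0 v * jacobiNorm (2 * v + 1) w) *
    (legendreHom v * Polynomial.aeval collapsedB (jacobi (2 * v + 1) w))

/-- The textbook formula for the Dubiner basis, off the line on which `a` is singular. -/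
theorem eval_dubiner (v w : ℕ) (p : Pt) (hp : 2 - √3 * p 1 ≠ 0) :
    MvPolynomial.eval p (dubiner v w) =
      2 / (3 : ℝ) ^ (1 / 4 : ℝ) * (1 - (2 * √3 * p 1 - 1) / 3) ^ v *
        (jacobiNorm 0 v * (jacobi 0 v).eval (3 * p 0 / (2 - √3 * p 1))) *
        (jacobiNorm (2 * v + 1) w *
          (jacobi (2 * v + 1) w).eval ((2 * √3 * p 1 - 1) / 3)) := by
  have hb : MvPolynomial.eval p collapsedB = (2 * √3 * p 1 - 1) / 3 := by
    simp [collapsedB]; ring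
  have hJ : MvPolynomial.eval p (Polynomial.aeval collapsedB (jacobi (2 * v + 1) w)) =
      (jacobi (2 * v + 1) w).eval ((2 * √3 * p 1 - 1) / 3) := by
    rw [← hb, ← Polynomial.coe_aeval_eq_eval, ← MvPolynomial.coe_aeval_eq_eval]
    exact (Polynomial.aeval_algHom_apply (MvPolynomial.aeval p) collapsedB _).symm
  have hL : MvPolynomial.eval p (legendreHom v) =
      (1 - (2 * √3 * p 1 - 1) / 3) ^ v *
        (jacobi 0 v).eval (3 * p 0 / (2 - √3 * p 1)) := by
    simp only [legendreHom, jacobi, map_sum, Polynomial.eval_finsetSum, Finset.mul_sum]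
    refine Finset.sum_congr rfl fun s hs => ?_
    have hs' : s ≤ v := Nat.lt_succ_iff.mp (Finset.mem_range.mp hs)
    have hU : MvPolynomial.eval p collapsedU = (1 - (2 * √3 * p 1 - 1) / 3) / 2 := by
      simp only [collapsedU, map_mul, map_sub, hb, MvPolynomial.eval_C, map_one]; ring
    set c : ℝ := 1 - (2 * √3 * p 1 - 1) / 3 with hc
    have hac : c * (3 * p 0 / (2 - √3 * p 1)) = 2 * p 0 := by
      rw [hc]; field_simp; ring
    set a : ℝ := 3 * p 0 / (2 - √3 * p 1) with ha
    simp only [map_mul, map_pow, map_sub, map_add, hU, MvPolynomial.eval_C, MvPolynomial.eval_X,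
      Polynomial.eval_mul, Polynomial.eval_pow, Polynomial.eval_C, Polynomial.eval_sub,
      Polynomial.eval_add, Polynomial.eval_X, Polynomial.eval_one]
    have h1 : p 0 - c / 2 = c * (1 / 2 * (a - 1)) := by linarith
    have h2 : p 0 + c / 2 = c * (1 / 2 * (a + 1)) := by linarith
    rw [h1, h2, mul_pow c, mul_pow c]
    have h3 : c ^ v = c ^ s * c ^ (v - s) := by rw [← pow_add, Nat.add_sub_cancel' hs']
    rw [h3]; ring
  simp only [dubiner, map_mul, MvPolynomial.eval_C, hJ, hL]
  ring

/-- Index set of the modes: pairs `(v, w)` with `v + w ≤ k`. -/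
abbrev Mode (k : ℕ) := {m : Fin (k + 1) × Fin (k + 1) // (m.1 : ℕ) + (m.2 : ℕ) ≤ k}

theorem jacobi_natDegree_le (α n : ℕ) : (jacobi α n).natDegree ≤ n := by
  refine Polynomial.natDegree_sum_le_of_forall_le _ _ fun s hs => ?_
  have hs' : s ≤ n := Nat.lt_succ_iff.mp (Finset.mem_range.mp hs)
  have h1 : (Polynomial.C (1 / 2 : ℝ) * (Polynomial.X - 1)).natDegree ≤ 1 := by compute_degree
  have h2 : (Polynomial.C (1 / 2 : ℝ) * (Polynomial.X + 1)).natDegree ≤ 1 := by compute_degree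
  refine (Polynomial.natDegree_C_mul_le _ _).trans ?_
  refine Polynomial.natDegree_mul_le.trans ?_
  have h3 := Polynomial.natDegree_pow_le_of_le s h1
  have h4 := Polynomial.natDegree_pow_le_of_le (n - s) h2
  omega

theorem jacobi_coeff_pos (α n : ℕ) : 0 < (jacobi α n).coeff n := by
  have key : ∀ s ∈ Finset.range (n + 1), (Polynomial.C (((n + α).choose (n - s) * n.choose s : ℕ) : ℝ) *
      ((Polynomial.C (1 / 2) * (Polynomial.X - 1)) ^ s *
        (Polynomial.C (1 / 2) * (Polynomial.X + 1)) ^ (n - s))).coeff n =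
      (((n + α).choose (n - s) * n.choose s : ℕ) : ℝ) * (1 / 2) ^ n := by
    intro s hs
    have hs' : s ≤ n := Nat.lt_succ_iff.mp (Finset.mem_range.mp hs)
    have h1 : (Polynomial.C (1 / 2 : ℝ) * (Polynomial.X - 1)).natDegree ≤ 1 := by compute_degree
    have h2 : (Polynomial.C (1 / 2 : ℝ) * (Polynomial.X + 1)).natDegree ≤ 1 := by compute_degree
    have h3 := Polynomial.natDegree_pow_le_of_le s h1
    have h4 := Polynomial.natDegree_pow_le_of_le (n - s) h2
    have h5 := Polynomial.coeff_pow_of_natDegree_le (m := s) h1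
    have h6 := Polynomial.coeff_pow_of_natDegree_le (m := n - s) h2
    have c1 : (Polynomial.C (1 / 2 : ℝ) * (Polynomial.X - 1)).coeff 1 = 1 / 2 := by
      simp [Polynomial.coeff_one]
    have c2 : (Polynomial.C (1 / 2 : ℝ) * (Polynomial.X + 1)).coeff 1 = 1 / 2 := by
      simp [Polynomial.coeff_one]
    rw [mul_one] at h3 h4
    rw [mul_one, c1] at h5
    rw [mul_one, c2] at h6
    rw [Polynomial.coeff_C_mul]
    have h7 := Polynomial.coeff_mul_add_eq_of_natDegree_le h3 h4
    rw [Nat.add_sub_cancel' hs'] at h7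
    rw [h7, h5, h6, ← pow_add, Nat.add_sub_cancel' hs']
  rw [jacobi, Polynomial.finsetSum_coeff, Finset.sum_congr rfl key]
  refine Finset.sum_pos (fun s hs => ?_) ⟨0, by simp⟩
  have hs' : s ≤ n := Nat.lt_succ_iff.mp (Finset.mem_range.mp hs)
  have : 0 < (n + α).choose (n - s) * n.choose s :=
    Nat.mul_pos (Nat.choose_pos (by omega)) (Nat.choose_pos hs')
  have h8 : (0 : ℝ) < (((n + α).choose (n - s) * n.choose s : ℕ) : ℝ) := by exact_mod_cast this
  positivity

theorem mem_span_jacobi (α d : ℕ) (f : Polynomial ℝ) (hf : f.natDegree ≤ d) :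
    f ∈ Submodule.span ℝ (jacobi α '' Set.Iic d) := by
  induction d generalizing f with
  | zero =>
    have hf' : f = Polynomial.C (f.coeff 0) := Polynomial.eq_C_of_natDegree_le_zero hf
    have hj : jacobi α 0 = Polynomial.C ((jacobi α 0).coeff 0) :=
      Polynomial.eq_C_of_natDegree_le_zero (jacobi_natDegree_le α 0)
    have hp := (jacobi_coeff_pos α 0).ne'
    have : f = (f.coeff 0 / (jacobi α 0).coeff 0) • jacobi α 0 := by
      conv_lhs => rw [hf']
      conv_rhs => rw [hj]
      rw [Polynomial.smul_C, smul_eq_mul, Polynomial.coeff_C_zero]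
      congr 1
      field_simp
    rw [this]
    exact Submodule.smul_mem _ _ (Submodule.subset_span ⟨0, by simp, rfl⟩)
  | succ d ih =>
    have hp := (jacobi_coeff_pos α (d + 1)).ne'
    set c := f.coeff (d + 1) / (jacobi α (d + 1)).coeff (d + 1) with hc
    have hg : (f - c • jacobi α (d + 1)).natDegree ≤ d := by
      rw [Polynomial.natDegree_le_iff_coeff_eq_zero]
      intro N hN
      rcases Nat.lt_or_ge (d + 1) N with h | h
      · rw [Polynomial.coeff_sub, Polynomial.coeff_smul,
          Polynomial.coeff_eq_zero_of_natDegree_lt (lt_of_le_of_lt hf h),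
          Polynomial.coeff_eq_zero_of_natDegree_lt
            (lt_of_le_of_lt (jacobi_natDegree_le α (d + 1)) h)]
        simp
      · obtain rfl : N = d + 1 := by omega
        rw [Polynomial.coeff_sub, Polynomial.coeff_smul, smul_eq_mul, hc]
        field_simp
        simp
    have h1 := ih _ hg
    have h2 : Submodule.span ℝ (jacobi α '' Set.Iic d) ≤
        Submodule.span ℝ (jacobi α '' Set.Iic (d + 1)) :=
      Submodule.span_mono (Set.image_mono (Set.Iic_subset_Iic.mpr (Nat.le_succ d)))
    have h3 : f = (f - c • jacobi α (d + 1)) + c • jacobi α (d + 1) := by simp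
    rw [h3]
    exact Submodule.add_mem _ (h2 h1)
      (Submodule.smul_mem _ _ (Submodule.subset_span ⟨d + 1, by simp, rfl⟩))

/-- Lower-order part in `x`: the span of `x^l f(b)` with `l < i` and `l + deg f ≤ i`. -/
def lowerPart (i : ℕ) : Submodule ℝ BiPoly :=
  Submodule.span ℝ {q | ∃ (l : ℕ) (f : Polynomial ℝ), l < i ∧ f.natDegree + l ≤ i ∧
    q = MvPolynomial.X 0 ^ l * Polynomial.aeval collapsedB f}

theorem collapsedU_eq :
    collapsedU = Polynomial.aeval collapsedB (Polynomial.C (1 / 2 : ℝ) * (1 - Polynomial.X)) := by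
  simp [collapsedU, MvPolynomial.algebraMap_eq]

theorem lowerPart_step (i : ℕ) (c ε : ℝ) (P : BiPoly)
    (hP : P - MvPolynomial.C c * MvPolynomial.X 0 ^ i ∈ lowerPart i) :
    P * (MvPolynomial.X 0 + MvPolynomial.C ε * collapsedU) -
      MvPolynomial.C c * MvPolynomial.X 0 ^ (i + 1) ∈ lowerPart (i + 1) := by
  have hu : (Polynomial.C (1 / 2 : ℝ) * (1 - Polynomial.X)).natDegree ≤ 1 := by compute_degree
  have h1 : ∀ q ∈ lowerPart i, q * (MvPolynomial.X 0 + MvPolynomial.C ε * collapsedU) ∈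
      lowerPart (i + 1) := by
    intro q hq
    induction hq using Submodule.span_induction with
    | mem q hq =>
      obtain ⟨l, f, hl, hf, rfl⟩ := hq
      have e : MvPolynomial.X 0 ^ l * Polynomial.aeval collapsedB f *
          (MvPolynomial.X 0 + MvPolynomial.C ε * collapsedU) =
          MvPolynomial.X 0 ^ (l + 1) * Polynomial.aeval collapsedB f +
          ε • (MvPolynomial.X 0 ^ l * Polynomial.aeval collapsedB
            (f * (Polynomial.C (1 / 2 : ℝ) * (1 - Polynomial.X)))) := by
        rw [map_mul, ← collapsedU_eq, MvPolynomial.smul_eq_C_mul]; ring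
      rw [e]
      refine Submodule.add_mem _ (Submodule.subset_span ⟨l + 1, f, by omega, by omega, rfl⟩)
        (Submodule.smul_mem _ _ (Submodule.subset_span ⟨l, _, by omega, ?_, rfl⟩))
      have := (Polynomial.natDegree_mul_le (p := f)
        (q := Polynomial.C (1 / 2 : ℝ) * (1 - Polynomial.X)))
      omega
    | zero => simp
    | add x y _ _ hx hy => rw [add_mul]; exact Submodule.add_mem _ hx hy
    | smul a x _ hx => rw [smul_mul_assoc]; exact Submodule.smul_mem _ _ hx
  have e : P * (MvPolynomial.X 0 + MvPolynomial.C ε * collapsedU) -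
      MvPolynomial.C c * MvPolynomial.X 0 ^ (i + 1) =
      (P - MvPolynomial.C c * MvPolynomial.X 0 ^ i) *
        (MvPolynomial.X 0 + MvPolynomial.C ε * collapsedU) +
      (c * ε) • (MvPolynomial.X 0 ^ i * Polynomial.aeval collapsedB
        (Polynomial.C (1 / 2 : ℝ) * (1 - Polynomial.X))) := by
    rw [← collapsedU_eq, MvPolynomial.smul_eq_C_mul, map_mul]; ring
  rw [e]
  exact Submodule.add_mem _ (h1 _ hP)
    (Submodule.smul_mem _ _ (Submodule.subset_span ⟨i, _, by omega, by omega, rfl⟩))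

theorem legendreHom_lead (v : ℕ) : ∃ c : ℝ, 0 < c ∧
    legendreHom v - MvPolynomial.C c * MvPolynomial.X 0 ^ v ∈ lowerPart v := by
  have h1 : ∀ s : ℕ, (MvPolynomial.X 0 - collapsedU) ^ s - MvPolynomial.C 1 * MvPolynomial.X 0 ^ s ∈
      lowerPart s := by
    intro s
    induction s with
    | zero => simp
    | succ s ih =>
      have := lowerPart_step s 1 (-1) _ ih
      rw [pow_succ]
      convert this using 3
      simp [sub_eq_add_neg]
  have h2 : ∀ s n : ℕ, (MvPolynomial.X 0 - collapsedU) ^ s * (MvPolynomial.X 0 + collapsedU) ^ n -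
      MvPolynomial.C 1 * MvPolynomial.X 0 ^ (s + n) ∈ lowerPart (s + n) := by
    intro s n
    induction n with
    | zero => simpa using h1 s
    | succ n ih =>
      have := lowerPart_step (s + n) 1 1 _ ih
      rw [pow_succ, ← mul_assoc, ← add_assoc]
      convert this using 3
      simp
  refine ⟨∑ s ∈ Finset.range (v + 1), (((v + 0).choose (v - s) * v.choose s : ℕ) : ℝ), ?_, ?_⟩
  · refine Finset.sum_pos (fun s hs => ?_) ⟨0, by simp⟩
    have hs' : s ≤ v := Nat.lt_succ_iff.mp (Finset.mem_range.mp hs)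
    have : 0 < (v + 0).choose (v - s) * v.choose s :=
      Nat.mul_pos (Nat.choose_pos (by omega)) (Nat.choose_pos hs')
    exact_mod_cast this
  · rw [legendreHom, map_sum, Finset.sum_mul, ← Finset.sum_sub_distrib]
    refine Submodule.sum_mem _ fun s hs => ?_
    have hs' : s ≤ v := Nat.lt_succ_iff.mp (Finset.mem_range.mp hs)
    have := h2 s (v - s)
    rw [Nat.add_sub_cancel' hs', map_one, one_mul] at this
    rw [← mul_sub, ← MvPolynomial.smul_eq_C_mul]
    exact Submodule.smul_mem _ _ this

theorem dubiner_const_ne (v w : ℕ) :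
    2 / (3 : ℝ) ^ (1 / 4 : ℝ) * jacobiNorm 0 v * jacobiNorm (2 * v + 1) w ≠ 0 := by
  have h1 : 0 < jacobiNorm 0 v := by unfold jacobiNorm; positivity
  have h2 : 0 < jacobiNorm (2 * v + 1) w := by unfold jacobiNorm; positivity
  positivity

theorem mem_span_dubiner (k i : ℕ) (f : Polynomial ℝ) (hf : f.natDegree + i ≤ k) :
    MvPolynomial.X 0 ^ i * Polynomial.aeval collapsedB f ∈
      Submodule.span ℝ (Set.range fun m : Mode k => dubiner m.1.1 m.1.2) := by
  induction i using Nat.strong_induction_on generalizing f with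
  | _ i ih =>
    set S := Submodule.span ℝ (Set.range fun m : Mode k => dubiner m.1.1 m.1.2) with hS
    have hL : ∀ g ∈ Submodule.span ℝ (jacobi (2 * i + 1) '' Set.Iic (k - i)),
        legendreHom i * Polynomial.aeval collapsedB g ∈ S := by
      intro g hg
      induction hg using Submodule.span_induction with
      | mem g hg =>
        obtain ⟨w, hw, rfl⟩ := hg
        have hw' : w ≤ k - i := hw
        have hc := dubiner_const_ne i w
        have e : legendreHom i * Polynomial.aeval collapsedB (jacobi (2 * i + 1) w) =
            (2 / (3 : ℝ) ^ (1 / 4 : ℝ) * jacobiNorm 0 i * jacobiNorm (2 * i + 1) w)⁻¹ •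
              dubiner i w := by
          rw [dubiner, ← MvPolynomial.smul_eq_C_mul, smul_smul, inv_mul_cancel₀ hc, one_smul]
        rw [e]
        refine Submodule.smul_mem _ _ (Submodule.subset_span
          ⟨⟨(⟨i, by omega⟩, ⟨w, by omega⟩), by simp; omega⟩, rfl⟩)
      | zero => simp
      | add x y _ _ hx hy => rw [map_add, mul_add]; exact Submodule.add_mem _ hx hy
      | smul a x _ hx => rw [map_smul, mul_smul_comm]; exact Submodule.smul_mem _ _ hx
    have hW : ∀ q ∈ lowerPart i, q * Polynomial.aeval collapsedB f ∈ S := by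
      intro q hq
      induction hq using Submodule.span_induction with
      | mem q hq =>
        obtain ⟨l, g, hl, hg, rfl⟩ := hq
        rw [mul_assoc, ← map_mul]
        refine ih l hl _ ?_
        have := Polynomial.natDegree_mul_le (p := g) (q := f)
        omega
      | zero => simp
      | add x y _ _ hx hy => rw [add_mul]; exact Submodule.add_mem _ hx hy
      | smul a x _ hx => rw [smul_mul_assoc]; exact Submodule.smul_mem _ _ hx
    obtain ⟨c, hc, hlead⟩ := legendreHom_lead i
    have h1 := hL f (mem_span_jacobi _ _ f (by omega))
    have h2 := hW _ hlead
    have e : MvPolynomial.X 0 ^ i * Polynomial.aeval collapsedB f =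
        c⁻¹ • (legendreHom i * Polynomial.aeval collapsedB f -
          (legendreHom i - MvPolynomial.C c * MvPolynomial.X 0 ^ i) *
            Polynomial.aeval collapsedB f) := by
      have : legendreHom i * Polynomial.aeval collapsedB f -
          (legendreHom i - MvPolynomial.C c * MvPolynomial.X 0 ^ i) *
            Polynomial.aeval collapsedB f =
          c • (MvPolynomial.X 0 ^ i * Polynomial.aeval collapsedB f) := by
        rw [MvPolynomial.smul_eq_C_mul]; ring
      rw [this, smul_smul, inv_mul_cancel₀ hc.ne', one_smul]
    rw [e]
    exact Submodule.smul_mem _ _ (Submodule.sub_mem _ h1 h2)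

theorem totalDegree_aeval_le (q : BiPoly) (d : ℕ) (hq : q.totalDegree ≤ 1) (f : Polynomial ℝ)
    (hf : f.natDegree ≤ d) : (Polynomial.aeval q f).totalDegree ≤ d := by
  rw [Polynomial.aeval_eq_sum_range]
  refine MvPolynomial.totalDegree_finsetSum_le fun i hi => ?_
  refine (MvPolynomial.totalDegree_smul_le _ _).trans ((MvPolynomial.totalDegree_pow _ _).trans ?_)
  have : i ≤ f.natDegree := Nat.lt_succ_iff.mp (Finset.mem_range.mp hi)
  nlinarith

theorem totalDegree_collapsedB : collapsedB.totalDegree ≤ 1 := by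
  refine (MvPolynomial.totalDegree_sub _ _).trans (max_le ?_ (by simp))
  refine (MvPolynomial.totalDegree_mul _ _).trans (by simp)

theorem totalDegree_collapsedU : collapsedU.totalDegree ≤ 1 := by
  rw [collapsedU_eq]
  exact totalDegree_aeval_le _ _ totalDegree_collapsedB _ (by compute_degree)

theorem dubiner_mem (v w k : ℕ) (h : v + w ≤ k) : dubiner v w ∈ PolySpace k := by
  rw [MvPolynomial.mem_restrictTotalDegree]
  have h1 := totalDegree_aeval_le collapsedB w totalDegree_collapsedB (jacobi (2 * v + 1) w)
    (jacobi_natDegree_le _ _)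
  have h2 : (legendreHom v).totalDegree ≤ v := by
    refine MvPolynomial.totalDegree_finsetSum_le fun s hs => ?_
    have hs' : s ≤ v := Nat.lt_succ_iff.mp (Finset.mem_range.mp hs)
    have a1 : (MvPolynomial.X 0 - collapsedU).totalDegree ≤ 1 :=
      (MvPolynomial.totalDegree_sub _ _).trans (max_le (by simp) totalDegree_collapsedU)
    have a2 : (MvPolynomial.X 0 + collapsedU).totalDegree ≤ 1 :=
      (MvPolynomial.totalDegree_add _ _).trans (max_le (by simp) totalDegree_collapsedU)
    rw [← MvPolynomial.smul_eq_C_mul]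
    refine (MvPolynomial.totalDegree_smul_le _ _).trans ((MvPolynomial.totalDegree_mul _ _).trans ?_)
    have a3 := (MvPolynomial.totalDegree_pow (MvPolynomial.X 0 - collapsedU) s)
    have a4 := (MvPolynomial.totalDegree_pow (MvPolynomial.X 0 + collapsedU) (v - s))
    have a5 := Nat.mul_le_mul_left s a1
    have a6 := Nat.mul_le_mul_left (v - s) a2
    omega
  rw [dubiner, ← MvPolynomial.smul_eq_C_mul]
  refine (MvPolynomial.totalDegree_smul_le _ _).trans ((MvPolynomial.totalDegree_mul _ _).trans ?_)
  omega

/-- The Dubiner polynomial of mode `m` as an element of `PolySpace k`. -/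
def dubinerVec (k : ℕ) (m : Mode k) : PolySpace k :=
  ⟨dubiner m.1.1 m.1.2, dubiner_mem _ _ k m.2⟩

theorem span_dubiner (k : ℕ) : ⊤ ≤ Submodule.span ℝ (Set.range (dubinerVec k)) := by
  rintro ⟨p, hp⟩ -
  have key : p ∈ Submodule.span ℝ (Set.range fun m : Mode k => dubiner m.1.1 m.1.2) := by
    rw [MvPolynomial.as_sum p]
    refine Submodule.sum_mem _ fun s hs => ?_
    have hd : s 0 + s 1 ≤ k := by
      have h1 := MvPolynomial.le_totalDegree hs
      have h2 := (MvPolynomial.mem_restrictTotalDegree _ _ _).mp hp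
      rw [Finsupp.sum_fintype _ _ (by simp), Fin.sum_univ_two] at h1
      omega
    have hY : (MvPolynomial.X 1 : BiPoly) = Polynomial.aeval collapsedB
        (Polynomial.C (√3 / 2) * Polynomial.X + Polynomial.C (√3 / 6)) := by
      have e1 : √3 / 2 * (2 * √3 / 3) = (1 : ℝ) := by
        have : √3 * √3 = (3 : ℝ) := Real.mul_self_sqrt (by norm_num)
        linear_combination this / 3
      have e2 : √3 / 2 * (1 / 3) = √3 / 6 := by ring
      simp only [map_add, Polynomial.aeval_C, MvPolynomial.algebraMap_eq]
      rw [map_mul, Polynomial.aeval_X, Polynomial.aeval_C, MvPolynomial.algebraMap_eq, collapsedB,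
        mul_sub, ← mul_assoc, ← map_mul, ← map_mul, e1, e2]
      simp
    rw [MvPolynomial.monomial_eq, Finsupp.prod_fintype _ _ (by simp), Fin.prod_univ_two,
      ← MvPolynomial.smul_eq_C_mul]
    refine Submodule.smul_mem _ _ ?_
    conv in MvPolynomial.X 1 ^ _ => rw [hY, ← map_pow]
    refine mem_span_dubiner k (s 0) _ ?_
    have h3 : (Polynomial.C (√3 / 2) * Polynomial.X + Polynomial.C (√3 / 6)).natDegree ≤ 1 := by
      compute_degree
    have h4 := Polynomial.natDegree_pow_le_of_le (s 1) h3
    omega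
  have hr : (Set.range fun m : Mode k => dubiner m.1.1 m.1.2) =
      (PolySpace k).subtype '' Set.range (dubinerVec k) := by
    rw [← Set.range_comp]; rfl
  rw [hr, Submodule.span_image] at key
  obtain ⟨q, hq, hqp⟩ := key
  have : q = ⟨p, hp⟩ := Subtype.ext hqp
  exact this ▸ hq

theorem card_mode (k : ℕ) : Fintype.card (Mode k) = Module.finrank ℝ (PolySpace k) := by
  have b : Module.Basis {n : Fin 2 →₀ ℕ | (n.sum fun _ e => e) ≤ k} ℝ (PolySpace k) :=
    MvPolynomial.basisRestrictSupport ℝ _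
  rw [Module.finrank_eq_nat_card_basis b, ← Nat.card_eq_fintype_card]
  refine Nat.card_congr ?_
  refine
    { toFun := fun m => ⟨Finsupp.equivFunOnFinite.symm ![m.1.1, m.1.2], ?_⟩
      invFun := fun n => ⟨(⟨n.1 0, ?_⟩, ⟨n.1 1, ?_⟩), ?_⟩
      left_inv := ?_
      right_inv := ?_ }
  · have := m.2
    simp only [Set.mem_ofPred_eq]
    rw [Finsupp.sum_fintype _ _ (by simp), Fin.sum_univ_two]
    simpa using this
  any_goals
    have h := n.2
    simp only [Set.mem_ofPred_eq] at h
    rw [Finsupp.sum_fintype _ _ (by simp), Fin.sum_univ_two] at h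
    omega
  · intro m
    rfl
  · intro n
    apply Subtype.ext
    ext i
    fin_cases i <;> rfl

/-- The Dubiner basis of the polynomials of degree at most `k`. -/
def dubinerBasis (k : ℕ) : Module.Basis (Mode k) ℝ (PolySpace k) :=
  basisOfTopLeSpanOfCardEqFinrank (dubinerVec k) (span_dubiner k) (card_mode k)

theorem dubinerBasis_apply (k : ℕ) (m : Mode k) :
    (dubinerBasis k m : BiPoly) = dubiner m.1.1 m.1.2 := by
  rw [dubinerBasis, coe_basisOfTopLeSpanOfCardEqFinrank]; rfl

/-! ## Modal operators

All matrices below act on coefficient vectors with respect to the Dubiner basis. -/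

/-- Mass matrix `M_{mn} = ∫_K φ_m φ_n`. -/
def massMatrix (k : ℕ) : Matrix (Mode k) (Mode k) ℝ :=
  Matrix.of fun m n => ∫ p in triangle,
    MvPolynomial.eval p (dubinerBasis k m : BiPoly) * MvPolynomial.eval p (dubinerBasis k n : BiPoly)

theorem totalDegree_monomial_map_le (k : ℕ) (u : BiPoly) (hu : u.totalDegree ≤ k)
    (f : BiPoly →ₗ[ℝ] BiPoly) (r : ℕ)
    (hf : ∀ s : Fin 2 →₀ ℕ, s 0 + s 1 ≤ k → (f (MvPolynomial.monomial s 1)).totalDegree ≤ r) :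
    (f u).totalDegree ≤ r := by
  rw [MvPolynomial.as_sum u, map_sum]
  refine MvPolynomial.totalDegree_finsetSum_le fun s hs => ?_
  have h1 := MvPolynomial.le_totalDegree hs
  rw [Finsupp.sum_fintype _ _ (by simp), Fin.sum_univ_two] at h1
  have : MvPolynomial.monomial s (MvPolynomial.coeff s u) =
      MvPolynomial.coeff s u • (MvPolynomial.monomial s 1 : BiPoly) := by
    rw [MvPolynomial.smul_monomial, smul_eq_mul, mul_one]
  rw [this, map_smul]
  exact (MvPolynomial.totalDegree_smul_le _ _).trans (hf s (by omega))

theorem totalDegree_pderiv_monomial (s : Fin 2 →₀ ℕ) (i : Fin 2) :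
    (MvPolynomial.pderiv i (MvPolynomial.monomial s (1 : ℝ))).totalDegree ≤ s 0 + s 1 - 1 := by
  rw [MvPolynomial.pderiv_monomial]
  by_cases h : s i = 0
  · simp [h]
  refine (MvPolynomial.totalDegree_monomial_le _ _).trans ?_
  rw [Finsupp.sum_fintype _ _ (by simp), Fin.sum_univ_two]
  fin_cases i <;> simp at h ⊢ <;> omega

theorem totalDegree_pderiv_le (k : ℕ) (u : BiPoly) (hu : u.totalDegree ≤ k) (i : Fin 2) :
    (MvPolynomial.pderiv i u).totalDegree ≤ k - 1 :=
  totalDegree_monomial_map_le k u hu (MvPolynomial.pderiv i).toLinearMap _ fun s hs =>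
    (totalDegree_pderiv_monomial s i).trans (by omega)

/-- The partial derivative `∂/∂x_i` on polynomials of degree at most `k`. -/
def derivMap (k : ℕ) (i : Fin 2) : PolySpace k →ₗ[ℝ] PolySpace k :=
  (MvPolynomial.pderiv i).toLinearMap.restrict fun u hu => by
    rw [MvPolynomial.mem_restrictTotalDegree] at hu ⊢
    exact (totalDegree_pderiv_le k u hu i).trans (by omega)

/-- The differentiation matrix `D_{x_i}`. -/
def diffMatrix (k : ℕ) (i : Fin 2) : Matrix (Mode k) (Mode k) ℝ :=
  LinearMap.toMatrix (dubinerBasis k) (dubinerBasis k) (derivMap k i)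

/-- The linear substitution `u ↦ u ∘ R`, where `(R x)_i = ∑ j, R i j x_j`. -/
def substHom (R : Matrix (Fin 2) (Fin 2) ℝ) : BiPoly →ₐ[ℝ] BiPoly :=
  MvPolynomial.aeval fun i => ∑ j, MvPolynomial.C (R i j) * MvPolynomial.X j

theorem eval_substHom (R : Matrix (Fin 2) (Fin 2) ℝ) (u : BiPoly) (p : Pt) :
    MvPolynomial.eval p (substHom R u) = MvPolynomial.eval (R.mulVec p) u := by
  have : (MvPolynomial.aeval p).comp (substHom R) =
      (MvPolynomial.aeval (R.mulVec p) : BiPoly →ₐ[ℝ] ℝ) := by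
    apply MvPolynomial.algHom_ext
    intro i
    fin_cases i <;> simp [substHom]
  simpa [MvPolynomial.coe_aeval_eq_eval] using congrArg (fun f => f u) this

/-- The substitution `u ↦ u ∘ R` on polynomials of degree at most `k`. -/
def substMap (k : ℕ) (R : Matrix (Fin 2) (Fin 2) ℝ) : PolySpace k →ₗ[ℝ] PolySpace k :=
  (substHom R).toLinearMap.restrict fun u hu => by
    rw [MvPolynomial.mem_restrictTotalDegree] at hu ⊢
    refine totalDegree_monomial_map_le k u hu _ k fun s hs => ?_
    have h1 : ∀ i, (∑ j, MvPolynomial.C (R i j) * MvPolynomial.X j : BiPoly).totalDegree ≤ 1 :=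
      fun i => MvPolynomial.totalDegree_finsetSum_le fun j _ =>
        (MvPolynomial.totalDegree_mul _ _).trans (by simp)
    have h2 : ∀ i, ((∑ j, MvPolynomial.C (R i j) * MvPolynomial.X j : BiPoly) ^ s i).totalDegree ≤
        s i := fun i => (MvPolynomial.totalDegree_pow _ _).trans
      ((Nat.mul_le_mul_left (s i) (h1 i)).trans (by simp))
    simp only [AlgHom.toLinearMap_apply, substHom, MvPolynomial.aeval_monomial, map_one, one_mul]
    rw [Finsupp.prod_fintype _ _ (by simp), Fin.prod_univ_two]
    exact (MvPolynomial.totalDegree_mul _ _).trans ((add_le_add (h2 0) (h2 1)).trans hs)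

/-- The matrix of the substitution `u ↦ u ∘ R` in the Dubiner basis. -/
def substMatrix (k : ℕ) (R : Matrix (Fin 2) (Fin 2) ℝ) : Matrix (Mode k) (Mode k) ℝ :=
  LinearMap.toMatrix (dubinerBasis k) (dubinerBasis k) (substMap k R)

/-- Change to the reference frame of the next face: `x' = x cos θ + y sin θ`,
`y' = -x sin θ + y cos θ` with `θ = 2π/3`. -/
def faceRotation : Matrix (Fin 2) (Fin 2) ℝ := !![-1 / 2, √3 / 2; -√3 / 2, -1 / 2]

/-- Reflection in the symmetry axis `x = 0` of the triangle. -/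
def axisReflection : Matrix (Fin 2) (Fin 2) ℝ := !![-1, 0; 0, 1]

/-! ## The extended range of stable flux reconstruction schemes -/

/-- `Q` defines an extended-range linearly stable FR scheme of degree `k` on the triangle:
`Q` is symmetric, `Q D_{x_i}` is skew-symmetric for both coordinates, `M + Q` is positive
definite, and `Q` commutes with the rotations and reflections of the triangle. -/
structure ExtendedRange (k : ℕ) (Q : Matrix (Mode k) (Mode k) ℝ) : Prop where
  symm : Q - Qᵀ = 0
  skew : ∀ i : Fin 2, Q * diffMatrix k i + (diffMatrix k i)ᵀ * Qᵀ = 0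
  pos : ∀ c : Mode k → ℝ, c ≠ 0 → 0 < c ⬝ᵥ (massMatrix k + Q).mulVec c
  rotation : substMatrix k faceRotation * Q = Q * substMatrix k faceRotation
  reflection : substMatrix k axisReflection * Q = Q * substMatrix k axisReflection

/-- Index set of the boundary flux points: `(e, i)` is the `i`-th point of edge `e`. -/
abbrev BdryIdx (k : ℕ) := Fin 3 × Fin (k + 1)

/-- `k + 1` distinct points on the parameter interval `[-1, 1]` of an edge. -/
def IsEdgeNodes (k : ℕ) (t : Fin (k + 1) → ℝ) : Prop :=
  Function.Injective t ∧ ∀ i, t i ∈ Set.Icc (-1 : ℝ) 1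

/-- The matrix `L_∂` (in modal form): modal coefficients to values at the boundary flux points. -/
def bdryInterp (k : ℕ) (t : Fin (k + 1) → ℝ) : Matrix (BdryIdx k) (Mode k) ℝ :=
  Matrix.of fun j m => MvPolynomial.eval (edgePoint j.1 (t j.2)) (dubinerBasis k m : BiPoly)

/-- The surface mass matrix `W_∂`: the Gram matrix of the edgewise Lagrange polynomials at the
boundary flux points, so that `fᵀ W_∂ g = ∫_{∂K} f g ds` for edgewise polynomials of degree `k`
with point values `f`, `g`. At Gauss–Legendre points it is the diagonal matrix of the quadrature
weights. -/
def surfaceMass (k : ℕ) (t : Fin (k + 1) → ℝ) : Matrix (BdryIdx k) (BdryIdx k) ℝ :=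
  Matrix.of fun i j => if i.1 = j.1 then
    ∫ s in (-1 : ℝ)..1, (Lagrange.basis Finset.univ t i.2).eval s *
      (Lagrange.basis Finset.univ t j.2).eval s
    else 0

/-- The correction matrix `C = (M + Q)⁻¹ L_∂ᵀ W_∂` of the FR scheme belonging to `Q`. -/
def frCorrection (k : ℕ) (t : Fin (k + 1) → ℝ) (Q : Matrix (Mode k) (Mode k) ℝ) :
    Matrix (Mode k) (BdryIdx k) ℝ :=
  (massMatrix k + Q)⁻¹ * (bdryInterp k t)ᵀ * surfaceMass k t

/-- The DG correction matrix `C_DG = M⁻¹ L_∂ᵀ W_∂`. -/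
def dgCorrection (k : ℕ) (t : Fin (k + 1) → ℝ) : Matrix (Mode k) (BdryIdx k) ℝ :=
  (massMatrix k)⁻¹ * (bdryInterp k t)ᵀ * surfaceMass k t

/-! ## Spectral difference schemes -/

/-- The Raviart–Thomas space `RT_k = (P_k)² + (x, y) P_k`. -/
def RT (k : ℕ) : Submodule ℝ (Fin 2 → BiPoly) where
  carrier := {F | ∃ (q : Fin 2 → PolySpace k) (r : PolySpace k),
    F = fun i => (q i : BiPoly) + MvPolynomial.X i * (r : BiPoly)}
  add_mem' := by
    rintro _ _ ⟨q, r, rfl⟩ ⟨q', r', rfl⟩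
    refine ⟨q + q', r + r', ?_⟩
    funext i
    simp only [Pi.add_apply, Submodule.coe_add]
    ring
  zero_mem' := ⟨0, 0, by funext i; simp⟩
  smul_mem' := by
    rintro c _ ⟨q, r, rfl⟩
    refine ⟨c • q, c • r, ?_⟩
    funext i
    simp [smul_add]

/-- Divergence of a polynomial vector field. -/
def divMap : (Fin 2 → BiPoly) →ₗ[ℝ] BiPoly :=
  ∑ i, (MvPolynomial.pderiv i).toLinearMap ∘ₗ LinearMap.proj i

theorem div_mem (k : ℕ) (F : Fin 2 → BiPoly) (hF : F ∈ RT k) : divMap F ∈ PolySpace k := by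
  obtain ⟨q, r, rfl⟩ := hF
  simp only [divMap, LinearMap.sum_apply, LinearMap.comp_apply, LinearMap.proj_apply]
  refine Submodule.sum_mem _ fun i _ => ?_
  have e : (MvPolynomial.pderiv i).toLinearMap ((q i : BiPoly) + MvPolynomial.X i * (r : BiPoly)) =
      MvPolynomial.pderiv i (q i : BiPoly) +
        (MvPolynomial.X i * MvPolynomial.pderiv i (r : BiPoly) + (r : BiPoly)) := by
    simp [Derivation.leibniz]
  rw [e]
  refine Submodule.add_mem _ (derivMap k i (q i)).2 (Submodule.add_mem _ ?_ r.2)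
  have hr := (MvPolynomial.mem_restrictTotalDegree _ _ _).mp r.2
  rcases Nat.eq_zero_or_pos k with rfl | hk
  · rw [MvPolynomial.totalDegree_eq_zero_iff_eq_C.mp (Nat.le_zero.mp hr)]
    simp
  · rw [MvPolynomial.mem_restrictTotalDegree]
    have h1 := totalDegree_pderiv_le k _ hr i
    refine (MvPolynomial.totalDegree_mul _ _).trans ?_
    rw [MvPolynomial.totalDegree_X]
    omega

/-- The divergence `RT_k → P_k`. -/
def divRT (k : ℕ) : RT k →ₗ[ℝ] PolySpace k := divMap.restrict (div_mem k)

/-- A family of flux points: locations, each with an associated normal. -/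
structure FluxPoints (ι : Type) where
  pt : ι → Pt
  normal : ι → Pt

/-- The boundary flux points, with the outward normals. -/
def bdryFluxPoints (k : ℕ) (t : Fin (k + 1) → ℝ) : FluxPoints (BdryIdx k) :=
  ⟨fun j => edgePoint j.1 (t j.2), fun j => edgeNormal j.1⟩

/-- Collocated interior flux points: each location is repeated with the normals `e_x`, `e_y`. -/
def collocated {ι : Type} (x : ι → Pt) : FluxPoints (ι × Fin 2) :=
  ⟨fun s => x s.1, fun s => Pi.single s.2 1⟩

/-- The degree of freedom of flux point `s`: the normal component of `F` at the point. -/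
def fluxDof {ι : Type} (S : FluxPoints ι) (F : Fin 2 → BiPoly) (s : ι) : ℝ :=
  ∑ i, S.normal s i * MvPolynomial.eval (S.pt s) (F i)

/-- `h` is the Lagrange (nodal) basis of `RT_k` for the spectral difference scheme with boundary
flux points `t` and interior flux points `S`. -/
def IsSDBasis {ι : Type} [DecidableEq ι] (k : ℕ) (t : Fin (k + 1) → ℝ) (S : FluxPoints ι)
    (h : BdryIdx k ⊕ ι → RT k) : Prop :=
  (∀ s s', fluxDof (bdryFluxPoints k t) (h s) s' = if s = Sum.inl s' then 1 else 0) ∧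
  (∀ s s', fluxDof S (h s) s' = if s = Sum.inr s' then 1 else 0)

/-- The SD correction matrix: column `j` holds the modal coefficients of the divergence of the
Lagrange basis function of boundary flux point `j`. -/
def sdCorrection {ι : Type} (k : ℕ) (h : BdryIdx k ⊕ ι → RT k) : Matrix (Mode k) (BdryIdx k) ℝ :=
  Matrix.of fun m j => (dubinerBasis k).repr (divRT k (h (Sum.inl j))) m

/-- `A = Q C_SD + M (C_SD - C_DG)`. -/
def residual {ι : Type} (k : ℕ) (t : Fin (k + 1) → ℝ) (h : BdryIdx k ⊕ ι → RT k)
    (Q : Matrix (Mode k) (Mode k) ℝ) : Matrix (Mode k) (BdryIdx k) ℝ :=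
  Q * sdCorrection k h + massMatrix k * (sdCorrection k h - dgCorrection k t)

/-- The residual for a single field `F ∈ RT_k`: with `d` the modal coefficients of `div F` and `g`
the normal components of `F` at the boundary flux points, `Q d + M (d - C_DG g)`. For the Lagrange
basis function of boundary flux point `j` this is column `j` of `A`. -/
def fieldResidual (k : ℕ) (t : Fin (k + 1) → ℝ) (F : RT k) (Q : Matrix (Mode k) (Mode k) ℝ) :
    Mode k → ℝ :=
  Q *ᵥ ⇑((dubinerBasis k).repr (divRT k F)) +
    massMatrix k *ᵥ (⇑((dubinerBasis k).repr (divRT k F)) -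
      dgCorrection k t *ᵥ fluxDof (bdryFluxPoints k t) F)

/-- No SD scheme of degree `k` with interior flux points `S` lies in the extended range. For every
choice of the boundary flux points and every admissible `Q`: the SD matrices satisfy `A ≠ 0`, and
the SD correction is not the FR correction of `Q`. The last clause is the same obstruction without
reference to a Lagrange basis, so that it also has content where the Raviart–Thomas Vandermonde
matrix of the flux points is singular: some field of `RT_k` that vanishes at the interior flux
points (in the direction of the normals) has nonzero residual. -/
def NoStableSD {ι : Type} [DecidableEq ι] (k : ℕ) (S : FluxPoints ι) : Prop :=
  ∀ t, IsEdgeNodes k t → ∀ Q, ExtendedRange k Q →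
    (∀ h, IsSDBasis k t S h → residual k t h Q ≠ 0 ∧ sdCorrection k h ≠ frCorrection k t Q) ∧
    ∃ F : RT k, fluxDof S F = 0 ∧ fieldResidual k t F Q ≠ 0

/-! ## Placements of the interior flux points -/

/-- The three-point symmetric orbit: barycentric coordinates `(1 - 2z, z, z)` up to order. -/
def orbit3 (z : ℝ) (i : Fin 3) : Pt := baryPoint fun j => if j = i then 1 - 2 * z else z

/-- The six-point symmetric orbit: barycentric coordinates `(z₁, z₂, 1 - z₁ - z₂)` up to order. -/
def orbit6 (z₁ z₂ : ℝ) (σ : Equiv.Perm (Fin 3)) : Pt :=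
  baryPoint fun j => (![z₁, z₂, 1 - z₁ - z₂] : Fin 3 → ℝ) (σ j)

/-- The one interior location for `k = 1`: the centroid. -/
def centroid (_ : Unit) : Pt := baryPoint fun _ => 1 / 3

/-- The family `diag(0, q₀, q₀)` for `k = 1`. -/
def linearQ (q₀ : ℝ) : Matrix (Mode 1) (Mode 1) ℝ :=
  Matrix.diagonal fun m => if (m.1.1 : ℕ) + (m.1.2 : ℕ) = 0 then 0 else q₀

end TriFR

end

open MeasureTheory
open scoped Matrix

namespace TriFR

/-! ## Integration over the triangle -/

/-! An admissible `Q` is regarded as a symmetric bilinear form on `P_k` for which both partial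
derivatives are skew. Derivatives can therefore be moved from one argument to the other until one
argument is exhausted, so the form vanishes as soon as one argument has degree less than `k`
(`ExtendedRange.form_eq_zero`).

The surface mass matrix is exact and normal traces of `RT_k` on edges have degree at most `k`, so
the divergence theorem gives the residual of a field `F` tested against `u` as `Q(u, div F) - ∫ ∇u ·
F` (`dotProduct_fieldResidual`). For `deg u < k` the `Q` term drops out. A stable scheme thus forces
every field with vanishing interior degrees of freedom to be orthogonal to the gradients of
polynomials of degree less than `k`. This condition (`OrthogonalToGradients`) involves neither the
boundary points nor `Q`, and each negative claim is a refutation of it. If a Lagrange basis exists,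
the offending field is a combination of boundary basis functions, so a column of `A` is nonzero
(`noStableSD_of_not_orthogonal`).

For `k = 3`, collocated, explicit fields vanishing at the points have their means and `x`-moments
computed. On one six-point orbit the circle through the points gives two incompatible conditions on
its radius; on two three-point orbits three fields give three incompatible equations in the sum and
product of the orbit parameters.

For `k = 2` the condition says that fields vanishing at the degrees of freedom have mean zero. Three
collocated points are excluded by one explicit field. With one normal per point, duality makes
integration a quadrature rule with 2×2 matrix weights of determinant zero
(`OrthogonalToGradients.exists_quadrature`). Exactness on `P_2`, together with the radial cubic
fields of `RT_2` where needed, determines so much of these weights that some weight would need a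
nonzero determinant, or all weights would vanish.

For `k = 1` the form lives on linear polynomials, where the symmetries leave only multiples of the
identity. For `F` in `RT_1` vanishing at the centroid, `∫ x_i div F = 3 ∫ F_i`, so the residual in
the linear modes is proportional to `(3 q₀ - 1) ∫ F_i`, whence `q₀ = 1/3`. -/

theorem setIntegral_between {lo hi : ℝ} (h : lo ≤ hi) {φ ψ : ℝ → ℝ}
    (hφψ : ∀ a ∈ Set.Icc lo hi, φ a ≤ ψ a) {S : Set (ℝ × ℝ)}
    (hS : ∀ z, z ∈ S ↔ z.1 ∈ Set.Icc lo hi ∧ z.2 ∈ Set.Icc (φ z.1) (ψ z.1))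
    (hSm : MeasurableSet S) {g : ℝ × ℝ → ℝ} (hg : IntegrableOn g S) :
    ∫ z in S, g z = ∫ a in lo..hi, ∫ b in φ a..ψ a, g (a, b) := by
  rw [← integral_indicator hSm, Measure.volume_eq_prod,
    integral_prod _ ((integrable_indicator_iff hSm).mpr hg),
    intervalIntegral.integral_of_le h, ← integral_Icc_eq_integral_Ioc,
    ← integral_indicator measurableSet_Icc]
  congr 1
  ext a
  by_cases ha : a ∈ Set.Icc lo hi
  · rw [Set.indicator_of_mem ha, intervalIntegral.integral_of_le (hφψ a ha),
      ← integral_Icc_eq_integral_Ioc, ← integral_indicator measurableSet_Icc]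
    congr 1
    ext b
    have := hS (a, b)
    by_cases hb : b ∈ Set.Icc (φ a) (ψ a)
    · rw [Set.indicator_of_mem hb, Set.indicator_of_mem (this.mpr ⟨ha, hb⟩)]
    · rw [Set.indicator_of_notMem hb, Set.indicator_of_notMem fun hh => hb (this.mp hh).2]
  · rw [Set.indicator_of_notMem ha]
    have : (fun b => S.indicator g (a, b)) = fun _ => 0 := by
      ext b
      exact Set.indicator_of_notMem (fun hh => ha ((hS (a, b)).mp hh).1) g
    rw [this, integral_zero]

theorem sqrt_three_mul_self : √3 * √3 = 3 := Real.mul_self_sqrt (by norm_num)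

theorem sqrt_three_pos : 0 < √3 := by positivity

theorem sqrt_three_inv : (√3)⁻¹ = √3 / 3 := by
  have := sqrt_three_mul_self
  have h := sqrt_three_pos
  field_simp
  linarith

theorem mem_triangle (p : Pt) :
    p ∈ triangle ↔ -1 ≤ √3 * p 1 ∧ 3 * p 0 ≤ 2 - √3 * p 1 ∧ -(3 * p 0) ≤ 2 - √3 * p 1 := by
  have h3 := sqrt_three_mul_self
  constructor
  · intro hp
    have hc : Convex ℝ {q : Pt | -1 ≤ √3 * q 1 ∧ 3 * q 0 ≤ 2 - √3 * q 1 ∧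
        -(3 * q 0) ≤ 2 - √3 * q 1} := by
      rintro x ⟨h1, h2, h3⟩ y ⟨h4, h5, h6⟩ a b ha hb hab
      obtain rfl : b = 1 - a := by linarith
      refine ⟨?_, ?_, ?_⟩ <;>
      · simp only [Pi.add_apply, Pi.smul_apply, smul_eq_mul]
        nlinarith
    refine convexHull_min ?_ hc hp
    rintro _ ⟨i, rfl⟩
    fin_cases i <;> simp [vertex, div_eq_mul_inv, sqrt_three_inv] <;>
      (repeat' apply And.intro) <;> nlinarith
  · rintro ⟨h1, h2, h4⟩
    -- These weights are the barycentric coordinates of `p`; each inequality is the nonnegativity of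
    -- one of them.
    have e : p = ∑ i, (![(2 - √3 * p 1 - 3 * p 0) / 6, (2 - √3 * p 1 + 3 * p 0) / 6,
        (√3 * p 1 + 1) / 3] : Fin 3 → ℝ) i • vertex i := by
      ext i
      fin_cases i
      · simp [Fin.sum_univ_three, vertex]
        ring
      · simp [Fin.sum_univ_three, vertex, div_eq_mul_inv, sqrt_three_inv]
        linear_combination (-(p 1) / 3) * h3
    rw [e]
    refine (convex_convexHull ℝ _).sum_mem (fun i _ => ?_) ?_ fun i _ =>
      subset_convexHull ℝ _ (Set.mem_range_self i)
    · fin_cases i <;> simp <;> linarith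
    · simp [Fin.sum_univ_three]; ring

theorem isCompact_triangle : IsCompact triangle :=
  (Set.finite_range vertex).isCompact_convexHull ℝ

theorem integrableOn_eval (q : BiPoly) :
    IntegrableOn (fun p : Pt => MvPolynomial.eval p q) triangle :=
  (MvPolynomial.continuous_eval q).continuousOn.integrableOn_compact isCompact_triangle

/-- The integral of a polynomial over the triangle. -/
noncomputable def triInt : BiPoly →ₗ[ℝ] ℝ where
  toFun q := ∫ p in triangle, MvPolynomial.eval p q
  map_add' q r := by
    simp only [map_add]
    exact integral_add (integrableOn_eval q) (integrableOn_eval r)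
  map_smul' c q := by
    simp only [MvPolynomial.smul_eval, RingHom.id_apply, smul_eq_mul]
    exact integral_const_mul c _

theorem triInt_apply (q : BiPoly) : triInt q = ∫ p in triangle, MvPolynomial.eval p q := rfl

theorem hasDerivAt_eval_update (v : Pt) (i : Fin 2) (q : BiPoly) (s : ℝ) :
    HasDerivAt (fun s => MvPolynomial.eval (Function.update v i s) q)
      (MvPolynomial.eval (Function.update v i s) (MvPolynomial.pderiv i q)) s := by
  induction q using MvPolynomial.induction_on with
  | C a => simpa using hasDerivAt_const s a
  | add p q hp hq =>
    simp only [map_add]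
    exact hp.add hq
  | mul_X p j hp =>
    have hX : HasDerivAt (fun s => MvPolynomial.eval (Function.update v i s) (MvPolynomial.X j))
        (MvPolynomial.eval (Function.update v i s) (MvPolynomial.pderiv i (MvPolynomial.X j))) s := by
      rcases eq_or_ne j i with rfl | hij
      · simp only [MvPolynomial.eval_X, Function.update_self, MvPolynomial.pderiv_X_self, map_one]
        exact hasDerivAt_id s
      · simpa [hij, MvPolynomial.pderiv_X_of_ne hij] using hasDerivAt_const s (v j)
    have h := hp.mul hX
    simp only [map_mul, Derivation.leibniz, map_add, smul_eq_mul]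
    rw [add_comm, mul_comm (MvPolynomial.eval _ (MvPolynomial.X j))]
    exact h

theorem integral_eval_pderiv (v : Pt) (i : Fin 2) (q : BiPoly) (a b : ℝ) :
    ∫ s in a..b, MvPolynomial.eval (Function.update v i s) (MvPolynomial.pderiv i q) =
      MvPolynomial.eval (Function.update v i b) q - MvPolynomial.eval (Function.update v i a) q := by
  refine intervalIntegral.integral_eq_sub_of_hasDerivAt
    (fun s _ => hasDerivAt_eval_update v i q s) (Continuous.intervalIntegrable ?_ _ _)
  exact (MvPolynomial.continuous_eval _).comp (continuous_const.update i continuous_id)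

theorem triInt_eq_setIntegral_prod (q : BiPoly) :
    triInt q = ∫ z in {z : ℝ × ℝ | ![z.1, z.2] ∈ triangle}, MvPolynomial.eval ![z.1, z.2] q := by
  have h := (volume_preserving_finTwoArrow ℝ).symm.setIntegral_preimage_emb
    (MeasurableEquiv.measurableEmbedding _) (fun p => MvPolynomial.eval p q) triangle
  exact h.symm

theorem triInt_eq_setIntegral_prod_swap (q : BiPoly) :
    triInt q = ∫ z in {z : ℝ × ℝ | ![z.2, z.1] ∈ triangle}, MvPolynomial.eval ![z.2, z.1] q := by
  have h := (Measure.measurePreserving_swap (μ := (volume : Measure ℝ))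
    (ν := (volume : Measure ℝ))).setIntegral_preimage_emb
    (MeasurableEquiv.prodComm.measurableEmbedding)
    (fun z : ℝ × ℝ => MvPolynomial.eval ![z.1, z.2] q) {z | ![z.1, z.2] ∈ triangle}
  rw [triInt_eq_setIntegral_prod]
  exact h.symm

theorem continuous_vec2 {X : Type*} [TopologicalSpace X] {f g : X → ℝ} (hf : Continuous f)
    (hg : Continuous g) : Continuous fun x => (![f x, g x] : Pt) := by
  refine continuous_pi fun i => ?_
  fin_cases i
  · exact hf
  · exact hg

theorem triInt_eq_iterated_x (q : BiPoly) :
    triInt q = ∫ y in (-(√3 / 3))..(2 * √3 / 3),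
      ∫ x in (-((2 - √3 * y) / 3))..((2 - √3 * y) / 3), MvPolynomial.eval ![x, y] q := by
  have h3 := sqrt_three_mul_self
  have hp := sqrt_three_pos
  have hc : Continuous fun z : ℝ × ℝ => (![z.2, z.1] : Pt) :=
    continuous_vec2 continuous_snd continuous_fst
  have hK : IsCompact {z : ℝ × ℝ | ![z.2, z.1] ∈ triangle} := by
    have : {z : ℝ × ℝ | ![z.2, z.1] ∈ triangle} = (fun p : Pt => (p 1, p 0)) '' triangle := by
      ext z
      constructor
      · intro hz; exact ⟨_, hz, rfl⟩
      · rintro ⟨p, hp, rfl⟩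
        have : (![p 0, p 1] : Pt) = p := by ext i; fin_cases i <;> rfl
        simpa [this] using hp
    rw [this]
    exact isCompact_triangle.image (by fun_prop)
  rw [triInt_eq_setIntegral_prod_swap]
  refine setIntegral_between (by linarith) (fun a ha => ?_) (fun z => ?_) hK.measurableSet
    (((MvPolynomial.continuous_eval q).comp hc).continuousOn.integrableOn_compact hK)
  · have := ha.2
    nlinarith
  · simp only [Set.mem_ofPred_eq, mem_triangle, Set.mem_Icc]
    simp only [Matrix.cons_val_zero, Matrix.cons_val_one]
    constructor
    · rintro ⟨h1, h2, h4⟩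
      exact ⟨⟨by nlinarith, by nlinarith⟩, by linarith, by linarith⟩
    · rintro ⟨⟨h1, h2⟩, h4, h5⟩
      exact ⟨by nlinarith, by linarith, by linarith⟩

theorem triInt_eq_iterated_y (q : BiPoly) :
    triInt q = ∫ x in (-1 : ℝ)..1,
      ∫ y in (-(√3 / 3))..((2 - 3 * |x|) * (√3 / 3)), MvPolynomial.eval ![x, y] q := by
  have h3 := sqrt_three_mul_self
  have hp := sqrt_three_pos
  have hc : Continuous fun z : ℝ × ℝ => (![z.1, z.2] : Pt) :=
    continuous_vec2 continuous_fst continuous_snd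
  have hK : IsCompact {z : ℝ × ℝ | ![z.1, z.2] ∈ triangle} := by
    have : {z : ℝ × ℝ | ![z.1, z.2] ∈ triangle} = (fun p : Pt => (p 0, p 1)) '' triangle := by
      ext z
      constructor
      · intro hz; exact ⟨_, hz, rfl⟩
      · rintro ⟨p, hp, rfl⟩
        have : (![p 0, p 1] : Pt) = p := by ext i; fin_cases i <;> rfl
        simpa [this] using hp
    rw [this]
    exact isCompact_triangle.image (by fun_prop)
  rw [triInt_eq_setIntegral_prod]
  refine setIntegral_between (by norm_num) (fun a ha => ?_) (fun z => ?_) hK.measurableSet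
    (((MvPolynomial.continuous_eval q).comp hc).continuousOn.integrableOn_compact hK)
  · have := abs_le.mpr ha
    nlinarith
  · simp only [Set.mem_ofPred_eq, mem_triangle, Set.mem_Icc]
    simp only [Matrix.cons_val_zero, Matrix.cons_val_one]
    constructor
    · rintro ⟨h1, h2, h4⟩
      have : 3 * |z.1| ≤ 2 - √3 * z.2 := by
        rcases abs_cases z.1 with ⟨h, _⟩ | ⟨h, _⟩ <;> rw [h] <;> linarith
      exact ⟨⟨by linarith, by linarith⟩, by nlinarith, by nlinarith⟩
    · rintro ⟨⟨h1, h2⟩, h4, h5⟩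
      have : 3 * |z.1| ≤ 2 - √3 * z.2 := by nlinarith
      rcases abs_cases z.1 with ⟨h, _⟩ | ⟨h, _⟩ <;> rw [h] at this <;>
        exact ⟨by nlinarith, by linarith, by linarith⟩

/-! ## The divergence theorem for polynomials, and moments -/

theorem edgePoint_zero (t : ℝ) : edgePoint 0 t = ![t, -(√3 / 3)] := by
  ext i
  fin_cases i <;> simp [edgePoint, vertex, div_eq_mul_inv, sqrt_three_inv]
  · ring
  · ring

theorem edgePoint_one (t : ℝ) : edgePoint 1 t = ![(1 - t) / 2, √3 / 6 + √3 / 2 * t] := by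
  ext i
  fin_cases i <;> simp [edgePoint, vertex, div_eq_mul_inv, sqrt_three_inv]
  ring

theorem edgePoint_two (t : ℝ) : edgePoint 2 t = ![-(1 + t) / 2, √3 / 6 - √3 / 2 * t] := by
  ext i
  fin_cases i <;> simp [edgePoint, vertex, div_eq_mul_inv, sqrt_three_inv] <;> ring

theorem edgeNormal_zero : edgeNormal 0 = ![0, -1] := by
  ext i
  fin_cases i <;> simp [edgeNormal, vertex]

theorem edgeNormal_one : edgeNormal 1 = ![√3 / 2, 1 / 2] := by
  ext i
  fin_cases i <;> simp [edgeNormal, vertex, div_eq_mul_inv, sqrt_three_inv]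
  ring

theorem edgeNormal_two : edgeNormal 2 = ![-(√3 / 2), 1 / 2] := by
  ext i
  fin_cases i <;> simp [edgeNormal, vertex, div_eq_mul_inv, sqrt_three_inv]
  ring

theorem continuous_edgePoint (e : Fin 3) : Continuous (edgePoint e) := by
  unfold edgePoint
  fun_prop

theorem continuous_eval_edgePoint (e : Fin 3) (p : BiPoly) :
    Continuous fun t => MvPolynomial.eval (edgePoint e t) p :=
  (MvPolynomial.continuous_eval p).comp (continuous_edgePoint e)

/-- The integral of a polynomial along an edge. -/
noncomputable def edgeInt (e : Fin 3) : BiPoly →ₗ[ℝ] ℝ where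
  toFun q := ∫ t in (-1 : ℝ)..1, MvPolynomial.eval (edgePoint e t) q
  map_add' q r := by
    simp only [map_add]
    exact intervalIntegral.integral_add ((continuous_eval_edgePoint e q).intervalIntegrable _ _)
      ((continuous_eval_edgePoint e r).intervalIntegrable _ _)
  map_smul' c q := by
    simp only [MvPolynomial.smul_eval, RingHom.id_apply, smul_eq_mul]
    exact intervalIntegral.integral_const_mul c _

theorem edgeInt_apply (e : Fin 3) (q : BiPoly) :
    edgeInt e q = ∫ t in (-1 : ℝ)..1, MvPolynomial.eval (edgePoint e t) q := rfl

/-- Integrating in `x` first leaves the values at the right and left ends of each horizontal slice,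
which lie on edges 1 and 2. Substituting arc length for `y` produces the factor `√3 / 2`; edge 2 is
traversed downwards. Edge 0 is horizontal and does not contribute. -/
theorem triInt_pderiv_zero (p : BiPoly) :
    triInt (MvPolynomial.pderiv 0 p) = √3 / 2 * edgeInt 1 p - √3 / 2 * edgeInt 2 p := by
  have hin : ∀ y a b : ℝ, ∫ x in a..b, MvPolynomial.eval ![x, y] (MvPolynomial.pderiv 0 p) =
      MvPolynomial.eval ![b, y] p - MvPolynomial.eval ![a, y] p := by
    intro y a b
    have h := integral_eval_pderiv ![0, y] 0 p a b
    have e : ∀ s : ℝ, Function.update (![0, y] : Pt) 0 s = ![s, y] := by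
      intro s
      ext i
      fin_cases i <;> simp
    simpa only [e] using h
  have c1 : Continuous fun y : ℝ => MvPolynomial.eval ![(2 - √3 * y) / 3, y] p :=
    (MvPolynomial.continuous_eval p).comp (continuous_vec2 (by fun_prop) continuous_id)
  have c2 : Continuous fun y : ℝ => MvPolynomial.eval ![-((2 - √3 * y) / 3), y] p :=
    (MvPolynomial.continuous_eval p).comp (continuous_vec2 (by fun_prop) continuous_id)
  rw [triInt_eq_iterated_x]
  simp only [hin]
  have h3 := sqrt_three_mul_self
  rw [intervalIntegral.integral_sub (c1.intervalIntegrable _ _) (c2.intervalIntegrable _ _)]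
  have e1 := intervalIntegral.mul_integral_comp_mul_add (a := -1) (b := 1)
    (f := fun y : ℝ => MvPolynomial.eval ![(2 - √3 * y) / 3, y] p) (√3 / 2) (√3 / 6)
  have e2 := intervalIntegral.mul_integral_comp_mul_add (a := -1) (b := 1)
    (f := fun y : ℝ => MvPolynomial.eval ![-((2 - √3 * y) / 3), y] p) (-(√3 / 2)) (√3 / 6)
  rw [show √3 / 2 * -1 + √3 / 6 = -(√3 / 3) by ring,
    show √3 / 2 * 1 + √3 / 6 = 2 * √3 / 3 by ring] at e1
  rw [show -(√3 / 2) * -1 + √3 / 6 = 2 * √3 / 3 by ring,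
    show -(√3 / 2) * 1 + √3 / 6 = -(√3 / 3) by ring,
    intervalIntegral.integral_symm (-(√3 / 3))] at e2
  have p1 : ∀ t : ℝ, (![(2 - √3 * (√3 / 2 * t + √3 / 6)) / 3, √3 / 2 * t + √3 / 6] : Pt) =
      edgePoint 1 t := by
    intro t
    rw [edgePoint_one]
    congr 1
    · linear_combination (-(t / 6) - 1 / 18) * h3
    · rw [add_comm]
  have p2 : ∀ t : ℝ, (![-((2 - √3 * (-(√3 / 2) * t + √3 / 6)) / 3),
      -(√3 / 2) * t + √3 / 6] : Pt) = edgePoint 2 t := by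
    intro t
    rw [edgePoint_two]
    congr 1
    · linear_combination (-(t / 6) + 1 / 18) * h3
    · congr 1
      ring
  simp only [p1] at e1
  simp only [p2] at e2
  rw [edgeInt_apply, edgeInt_apply]
  linarith

/-- Here `y` is integrated first. The top of a vertical slice lies on edge 2 for `x ≤ 0` and on edge
1 for `x ≥ 0`, so the outer integral is split at `0`; the bottom always lies on edge 0. -/
theorem triInt_pderiv_one (p : BiPoly) :
    triInt (MvPolynomial.pderiv 1 p) = 1 / 2 * edgeInt 1 p + 1 / 2 * edgeInt 2 p - edgeInt 0 p := by
  have hin : ∀ x a b : ℝ, ∫ y in a..b, MvPolynomial.eval ![x, y] (MvPolynomial.pderiv 1 p) =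
      MvPolynomial.eval ![x, b] p - MvPolynomial.eval ![x, a] p := by
    intro y a b
    have h := integral_eval_pderiv ![y, 0] 1 p a b
    have e : ∀ s : ℝ, Function.update (![y, 0] : Pt) 1 s = ![y, s] := by
      intro s
      ext i
      fin_cases i <;> simp
    simpa only [e] using h
  have c1 : Continuous fun x : ℝ => MvPolynomial.eval ![x, (2 - 3 * |x|) * (√3 / 3)] p :=
    (MvPolynomial.continuous_eval p).comp (continuous_vec2 continuous_id (by fun_prop))
  have c2 : Continuous fun x : ℝ => MvPolynomial.eval ![x, -(√3 / 3)] p :=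
    (MvPolynomial.continuous_eval p).comp (continuous_vec2 continuous_id (by fun_prop))
  rw [triInt_eq_iterated_y]
  simp only [hin]
  rw [intervalIntegral.integral_sub (c1.intervalIntegrable _ _) (c2.intervalIntegrable _ _),
    ← intervalIntegral.integral_add_adjacent_intervals (b := 0) (c1.intervalIntegrable _ _)
      (c1.intervalIntegrable _ _)]
  have l1 : ∫ x in (-1 : ℝ)..0, MvPolynomial.eval ![x, (2 - 3 * |x|) * (√3 / 3)] p =
      ∫ x in (-1 : ℝ)..0, MvPolynomial.eval ![x, (2 + 3 * x) * (√3 / 3)] p := by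
    refine intervalIntegral.integral_congr fun x hx => ?_
    rw [Set.uIcc_of_le (by norm_num)] at hx
    simp only [abs_of_nonpos hx.2]
    congr 2
    ring_nf
  have l2 : ∫ x in (0 : ℝ)..1, MvPolynomial.eval ![x, (2 - 3 * |x|) * (√3 / 3)] p =
      ∫ x in (0 : ℝ)..1, MvPolynomial.eval ![x, (2 - 3 * x) * (√3 / 3)] p := by
    refine intervalIntegral.integral_congr fun x hx => ?_
    rw [Set.uIcc_of_le (by norm_num)] at hx
    simp only [abs_of_nonneg hx.1]
  rw [l1, l2]
  have e1 := intervalIntegral.mul_integral_comp_mul_add (a := -1) (b := 1)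
    (f := fun x : ℝ => MvPolynomial.eval ![x, (2 - 3 * x) * (√3 / 3)] p) (-(1 / 2)) (1 / 2)
  have e2 := intervalIntegral.mul_integral_comp_mul_add (a := -1) (b := 1)
    (f := fun x : ℝ => MvPolynomial.eval ![x, (2 + 3 * x) * (√3 / 3)] p) (-(1 / 2)) (-(1 / 2))
  rw [show -(1 / 2 : ℝ) * -1 + 1 / 2 = 1 by ring,
    show -(1 / 2 : ℝ) * 1 + 1 / 2 = 0 by ring, intervalIntegral.integral_symm 0] at e1
  rw [show -(1 / 2 : ℝ) * -1 + -(1 / 2) = 0 by ring,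
    show -(1 / 2 : ℝ) * 1 + -(1 / 2) = -1 by ring, intervalIntegral.integral_symm (-1)] at e2
  have p1 : ∀ t : ℝ, (![-(1 / 2) * t + 1 / 2,
      (2 - 3 * (-(1 / 2) * t + 1 / 2)) * (√3 / 3)] : Pt) = edgePoint 1 t := by
    intro t
    rw [edgePoint_one]
    congr 1
    · ring
    · congr 1
      ring
  have p2 : ∀ t : ℝ, (![-(1 / 2) * t + -(1 / 2),
      (2 + 3 * (-(1 / 2) * t + -(1 / 2))) * (√3 / 3)] : Pt) = edgePoint 2 t := by
    intro t
    rw [edgePoint_two]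
    congr 1
    · ring
    · congr 1
      ring
  simp only [p1] at e1
  simp only [p2] at e2
  simp only [edgeInt_apply, edgePoint_zero] at *
  linarith

theorem triInt_pderiv (i : Fin 2) (p : BiPoly) :
    triInt (MvPolynomial.pderiv i p) = ∑ e, edgeNormal e i * edgeInt e p := by
  rw [Fin.sum_univ_three, edgeNormal_zero, edgeNormal_one, edgeNormal_two]
  fin_cases i
  · simp [triInt_pderiv_zero, sub_eq_add_neg]
  · simp [triInt_pderiv_one]; ring

/-! ### Moments of monomials over the triangle -/

/-- The monomial `x^a (√3 y)^b`. -/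
noncomputable def scaledMonomial (a b : ℕ) : BiPoly :=
  MvPolynomial.X 0 ^ a * (MvPolynomial.C √3 * MvPolynomial.X 1) ^ b

theorem eval_scaledMonomial (a b : ℕ) (p : Pt) :
    MvPolynomial.eval p (scaledMonomial a b) = p 0 ^ a * (√3 * p 1) ^ b := by
  simp [scaledMonomial]

/-- Boole's rule on an interval of length 2, which is exact up to degree five. -/
theorem integral_quintic (P : Polynomial ℝ) (hP : P.natDegree ≤ 5) :
    ∫ t in (-1 : ℝ)..1, P.eval t =
      (7 * P.eval (-1) + 32 * P.eval (-(1 / 2)) + 12 * P.eval 0 + 32 * P.eval (1 / 2) +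
        7 * P.eval 1) / 45 := by
  have h : ∀ t, P.eval t = ∑ i ∈ Finset.range 6, P.coeff i * t ^ i :=
    fun t => Polynomial.eval_eq_sum_range' (Nat.lt_succ_of_le hP) t
  simp only [h]
  rw [intervalIntegral.integral_finsetSum fun i _ =>
    Continuous.intervalIntegrable (by fun_prop) _ _]
  simp only [intervalIntegral.integral_const_mul, integral_pow, Finset.sum_range_succ,
    Finset.sum_range_zero]
  norm_num
  ring

/-- Euler's identity: the position vector times a monomial of degree `a + b` has divergence `a + b +
2` times that monomial. On every edge the position vector has normal component `√3 / 3`, the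
inradius, so the divergence theorem reduces the area moment to edge integrals. -/
theorem triInt_scaledMonomial_eq_edges (a b : ℕ) :
    (a + b + 2) * triInt (scaledMonomial a b) =
      √3 / 3 * ∑ e, edgeInt e (scaledMonomial a b) := by
  have h3 := sqrt_three_mul_self
  have d0 : MvPolynomial.pderiv 0 (MvPolynomial.X 0 * scaledMonomial a b) =
      ((a : ℝ) + 1) • scaledMonomial a b := by
    rcases a with _ | a
    · simp [scaledMonomial, Derivation.leibniz, Derivation.leibniz_pow, MvPolynomial.pderiv_X]
    · simp [scaledMonomial, Derivation.leibniz, Derivation.leibniz_pow, MvPolynomial.pderiv_X,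
        MvPolynomial.smul_eq_C_mul]
      ring
  have d1 : MvPolynomial.pderiv 1 (MvPolynomial.X 1 * scaledMonomial a b) =
      ((b : ℝ) + 1) • scaledMonomial a b := by
    rcases b with _ | b
    · simp [scaledMonomial, Derivation.leibniz, Derivation.leibniz_pow, MvPolynomial.pderiv_X]
    · simp [scaledMonomial, Derivation.leibniz, Derivation.leibniz_pow, MvPolynomial.pderiv_X,
        MvPolynomial.smul_eq_C_mul]
      ring
  have i0 := triInt_pderiv 0 (MvPolynomial.X 0 * scaledMonomial a b)
  have i1 := triInt_pderiv 1 (MvPolynomial.X 1 * scaledMonomial a b)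
  rw [d0, map_smul, smul_eq_mul] at i0
  rw [d1, map_smul, smul_eq_mul] at i1
  have key : ∀ e : Fin 3, edgeNormal e 0 * edgeInt e (MvPolynomial.X 0 * scaledMonomial a b) +
      edgeNormal e 1 * edgeInt e (MvPolynomial.X 1 * scaledMonomial a b) =
      √3 / 3 * edgeInt e (scaledMonomial a b) := by
    intro e
    have hs : ∀ (c : ℝ) (q : BiPoly), c * edgeInt e q = edgeInt e (c • q) :=
      fun c q => ((edgeInt e).map_smul c q).symm
    rw [hs, hs, hs, ← map_add, edgeInt_apply, edgeInt_apply]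
    refine intervalIntegral.integral_congr fun t _ => ?_
    simp only [map_add, MvPolynomial.smul_eval, map_mul, MvPolynomial.eval_X]
    rw [← mul_assoc, ← mul_assoc, ← add_mul]
    congr 1
    fin_cases e
    · simp [edgeNormal_zero, edgePoint_zero]
    · simp [edgeNormal_one, edgePoint_one]; ring
    · simp [edgeNormal_two, edgePoint_two]; ring
  rw [Finset.mul_sum, ← Finset.sum_congr rfl fun e _ => key e, Finset.sum_add_distrib, ← i0, ← i1]
  ring

/-- The function `f` is the sum of the three edge traces. With the scaling by `√3` the coordinates
along the edges have rational coefficients, so five evaluations of `f` yield each moment up to one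
factor `√3`. -/
theorem triInt_scaledMonomial (a b : ℕ) (h : a + b ≤ 5) (f : ℝ → ℝ)
    (hf : f = fun t => t ^ a * (-1) ^ b + ((1 - t) / 2) ^ a * ((1 + 3 * t) / 2) ^ b +
      (-(1 + t) / 2) ^ a * ((1 - 3 * t) / 2) ^ b) :
    (a + b + 2) * triInt (scaledMonomial a b) =
      √3 * ((7 * f (-1) + 32 * f (-(1 / 2)) + 12 * f 0 + 32 * f (1 / 2) + 7 * f 1) / 135) := by
  have h3 := sqrt_three_mul_self
  let P : Polynomial ℝ := Polynomial.X ^ a * (-1) ^ b +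
    (Polynomial.C (-1 / 2) * Polynomial.X + Polynomial.C (1 / 2)) ^ a *
      (Polynomial.C (3 / 2) * Polynomial.X + Polynomial.C (1 / 2)) ^ b +
    (Polynomial.C (-1 / 2) * Polynomial.X + Polynomial.C (-1 / 2)) ^ a *
      (Polynomial.C (-3 / 2) * Polynomial.X + Polynomial.C (1 / 2)) ^ b
  have hlin : ∀ c d : ℝ, (Polynomial.C c * Polynomial.X + Polynomial.C d).natDegree ≤ 1 :=
    fun c d => Polynomial.natDegree_linear_le
  have hmul : ∀ A B : Polynomial ℝ, A.natDegree ≤ 1 → B.natDegree ≤ 1 →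
      (A ^ a * B ^ b).natDegree ≤ 5 := by
    intro A B hA hB
    refine Polynomial.natDegree_mul_le.trans ?_
    have := Polynomial.natDegree_pow_le_of_le a hA
    have := Polynomial.natDegree_pow_le_of_le b hB
    omega
  have hP : P.natDegree ≤ 5 := by
    refine Polynomial.natDegree_add_le_of_degree_le (Polynomial.natDegree_add_le_of_degree_le ?_
      (hmul _ _ (hlin _ _) (hlin _ _))) (hmul _ _ (hlin _ _) (hlin _ _))
    exact hmul _ _ Polynomial.natDegree_X_le (by simp)
  have hfP : ∀ t, P.eval t = f t := by
    intro t
    simp only [P, hf, Polynomial.eval_add, Polynomial.eval_mul, Polynomial.eval_pow,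
      Polynomial.eval_X, Polynomial.eval_C, Polynomial.eval_neg, Polynomial.eval_one]
    rw [show -1 / 2 * t + 1 / 2 = (1 - t) / 2 by ring,
      show 3 / 2 * t + 1 / 2 = (1 + 3 * t) / 2 by ring,
      show -1 / 2 * t + -1 / 2 = -(1 + t) / 2 by ring,
      show -3 / 2 * t + 1 / 2 = (1 - 3 * t) / 2 by ring]
  have hI := integral_quintic P hP
  simp only [hfP] at hI
  have hE : ∑ e, edgeInt e (scaledMonomial a b) = ∫ t in (-1 : ℝ)..1, f t := by
    rw [Fin.sum_univ_three]
    simp only [edgeInt_apply]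
    have hi : ∀ e, IntervalIntegrable
        (fun t => MvPolynomial.eval (edgePoint e t) (scaledMonomial a b)) volume (-1) 1 :=
      fun e => (continuous_eval_edgePoint e _).intervalIntegrable _ _
    rw [← intervalIntegral.integral_add (hi 0) (hi 1),
      ← intervalIntegral.integral_add ((hi 0).add (hi 1)) (hi 2)]
    refine intervalIntegral.integral_congr fun t _ => ?_
    have s1 : √3 * -(√3 / 3) = -1 := by linear_combination -h3 / 3
    have s2 : √3 * (√3 / 6 + √3 / 2 * t) = (1 + 3 * t) / 2 := by
      linear_combination (1 / 6 + t / 2) * h3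
    have s3 : √3 * (√3 / 6 - √3 / 2 * t) = (1 - 3 * t) / 2 := by
      linear_combination (1 / 6 - t / 2) * h3
    simp only [eval_scaledMonomial, edgePoint_zero, edgePoint_one, edgePoint_two, hf,
      Matrix.cons_val_zero, Matrix.cons_val_one, s1, s2, s3]
  rw [triInt_scaledMonomial_eq_edges, hE, hI]
  ring

/-! ## Forms that are skew with respect to differentiation -/

/-- The bilinear form on `P_k` whose matrix in the Dubiner basis is `Q`. -/
noncomputable abbrev modalForm (k : ℕ) (Q : Matrix (Mode k) (Mode k) ℝ) :
    LinearMap.BilinForm ℝ (PolySpace k) :=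
  Matrix.toBilin (dubinerBasis k) Q

theorem modalForm_apply {k : ℕ} (Q : Matrix (Mode k) (Mode k) ℝ) (u v : PolySpace k) :
    modalForm k Q u v = (dubinerBasis k).repr u ⬝ᵥ Q *ᵥ (dubinerBasis k).repr v := by
  rw [modalForm, Matrix.toBilin_apply]
  simp only [dotProduct, Matrix.mulVec, Finset.mul_sum, mul_assoc]

theorem ExtendedRange.form_symm {k : ℕ} {Q : Matrix (Mode k) (Mode k) ℝ} (hQ : ExtendedRange k Q)
    (u v : PolySpace k) : modalForm k Q u v = modalForm k Q v u := by
  have h : Qᵀ = Q := (sub_eq_zero.mp hQ.symm).symm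
  rw [modalForm_apply, modalForm_apply, Matrix.dotProduct_mulVec, ← Matrix.mulVec_transpose, h,
    dotProduct_comm]

theorem ExtendedRange.form_skew {k : ℕ} {Q : Matrix (Mode k) (Mode k) ℝ} (hQ : ExtendedRange k Q)
    (i : Fin 2) (u v : PolySpace k) :
    modalForm k Q u (derivMap k i v) = -modalForm k Q (derivMap k i u) v := by
  have h : Qᵀ = Q := (sub_eq_zero.mp hQ.symm).symm
  have hs := hQ.skew i
  rw [h] at hs
  have hD : ∀ w, ⇑((dubinerBasis k).repr (derivMap k i w)) =
      diffMatrix k i *ᵥ (dubinerBasis k).repr w := fun w =>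
    (LinearMap.toMatrix_mulVec_repr _ _ (derivMap k i) w).symm
  rw [modalForm_apply, modalForm_apply, hD, hD, Matrix.mulVec_mulVec,
    eq_neg_of_add_eq_zero_left hs, Matrix.neg_mulVec, dotProduct_neg, ← Matrix.mulVec_mulVec,
    Matrix.dotProduct_mulVec, Matrix.vecMul_transpose]

/-- The monomial `x^a y^b / (a! b!)`. -/
noncomputable def dividedMonomial (a b : ℕ) : BiPoly :=
  ((a.factorial : ℝ)⁻¹ * (b.factorial : ℝ)⁻¹) • (MvPolynomial.X 0 ^ a * MvPolynomial.X 1 ^ b)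

theorem X_pow_mul_mem (k a b : ℕ) (h : a + b ≤ k) :
    (MvPolynomial.X 0 ^ a * MvPolynomial.X 1 ^ b : BiPoly) ∈ PolySpace k := by
  rw [MvPolynomial.mem_restrictTotalDegree]
  refine (MvPolynomial.totalDegree_mul _ _).trans ?_
  rw [MvPolynomial.totalDegree_X_pow, MvPolynomial.totalDegree_X_pow]
  exact h

theorem dividedMonomial_mem (k a b : ℕ) (h : a + b ≤ k) : dividedMonomial a b ∈ PolySpace k :=
  Submodule.smul_mem _ _ (X_pow_mul_mem k a b h)

theorem pderiv_dividedMonomial_zero_left (b : ℕ) :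
    MvPolynomial.pderiv 0 (dividedMonomial 0 b) = 0 := by
  simp [dividedMonomial, Derivation.leibniz_pow, MvPolynomial.pderiv_X]

theorem pderiv_dividedMonomial_zero_right (a : ℕ) :
    MvPolynomial.pderiv 1 (dividedMonomial a 0) = 0 := by
  simp [dividedMonomial, Derivation.leibniz_pow, MvPolynomial.pderiv_X]

theorem pderiv_dividedMonomial_left (a b : ℕ) :
    MvPolynomial.pderiv 0 (dividedMonomial (a + 1) b) = dividedMonomial a b := by
  have h : MvPolynomial.pderiv 0 (MvPolynomial.X 0 ^ (a + 1) * MvPolynomial.X 1 ^ b : BiPoly) =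
      ((a : ℝ) + 1) • (MvPolynomial.X 0 ^ a * MvPolynomial.X 1 ^ b) := by
    simp [Derivation.leibniz, Derivation.leibniz_pow, MvPolynomial.pderiv_X,
      MvPolynomial.smul_eq_C_mul]
    ring
  rw [dividedMonomial, Derivation.map_smul, h, smul_smul, dividedMonomial, Nat.factorial_succ]
  congr 1
  push_cast
  field_simp

theorem pderiv_dividedMonomial_right (a b : ℕ) :
    MvPolynomial.pderiv 1 (dividedMonomial a (b + 1)) = dividedMonomial a b := by
  have h : MvPolynomial.pderiv 1 (MvPolynomial.X 0 ^ a * MvPolynomial.X 1 ^ (b + 1) : BiPoly) =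
      ((b : ℝ) + 1) • (MvPolynomial.X 0 ^ a * MvPolynomial.X 1 ^ b) := by
    simp [Derivation.leibniz, Derivation.leibniz_pow, MvPolynomial.pderiv_X,
      MvPolynomial.smul_eq_C_mul]
    ring
  rw [dividedMonomial, Derivation.map_smul, h, smul_smul, dividedMonomial, Nat.factorial_succ b]
  congr 1
  push_cast
  field_simp

theorem coe_derivMap {k : ℕ} (i : Fin 2) (u : PolySpace k) :
    (derivMap k i u : BiPoly) = MvPolynomial.pderiv i (u : BiPoly) := rfl

/-- Since `a + b < k`, the first monomial is an `x`-derivative inside `P_k`. Skewness moves that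
derivative to the other argument, and the induction lowers the `x`-degree of the second argument
until it is annihilated. Factorials in the denominators make differentiation a pure index shift. -/
theorem ExtendedRange.form_dividedMonomial {k : ℕ} {Q : Matrix (Mode k) (Mode k) ℝ}
    (hQ : ExtendedRange k Q) {a b c d : ℕ} (hab : a + b < k) (hcd : c + d ≤ k) {u v : PolySpace k}
    (hu : (u : BiPoly) = dividedMonomial a b) (hv : (v : BiPoly) = dividedMonomial c d) :
    modalForm k Q u v = 0 := by
  induction c generalizing a b d u v with
  | zero =>
    have hU : u = derivMap k 0 ⟨_, dividedMonomial_mem k (a + 1) b (by omega)⟩ :=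
      Subtype.ext (by rw [coe_derivMap, pderiv_dividedMonomial_left, hu])
    have hV : derivMap k 0 v = 0 :=
      Subtype.ext (by rw [coe_derivMap, hv, pderiv_dividedMonomial_zero_left]; rfl)
    rw [hU, ← neg_neg (modalForm k Q _ _), ← hQ.form_skew, hV, map_zero, neg_zero]
  | succ c ih =>
    set U : PolySpace k := ⟨_, dividedMonomial_mem k (a + 1) b (by omega)⟩ with hUdef
    set V : PolySpace k := ⟨_, dividedMonomial_mem k c (d + 1) (by omega)⟩ with hVdef
    have hU : u = derivMap k 0 U :=
      Subtype.ext (by rw [coe_derivMap, hUdef, pderiv_dividedMonomial_left, hu])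
    have hV : derivMap k 0 v = derivMap k 1 V :=
      Subtype.ext (by rw [coe_derivMap, coe_derivMap, hv, hVdef, pderiv_dividedMonomial_left,
        pderiv_dividedMonomial_right])
    -- Removing one `x` from `v` gives the same polynomial as removing one `y` from `V`. Passing
    -- through it trades an `x` for a `y` in the second argument and a `y` for an `x` in the first,
    -- keeping the first degree at `a + b`; if the first has no `y` left, the form is zero.
    rw [hU, ← neg_neg (modalForm k Q _ _), ← hQ.form_skew, hV, hQ.form_skew, neg_neg]
    rcases b with _ | b
    · have h0 : derivMap k 1 U = 0 :=
        Subtype.ext (by rw [coe_derivMap, hUdef, pderiv_dividedMonomial_zero_right]; rfl)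
      rw [h0, map_zero, LinearMap.zero_apply]
    · refine ih (a := a + 1) (b := b) (d := d + 1) (by omega) (by omega) ?_ rfl
      rw [coe_derivMap, hUdef, pderiv_dividedMonomial_right]

theorem mem_of_dividedMonomial_mem {k n : ℕ} {S : Submodule ℝ (PolySpace k)} (hn : n ≤ k)
    (hS : ∀ (a b : ℕ) (w : PolySpace k), a + b ≤ n → (w : BiPoly) = dividedMonomial a b → w ∈ S)
    (u : PolySpace k) (hu : (u : BiPoly).totalDegree ≤ n) : u ∈ S := by
  have key : (u : BiPoly) ∈ S.map (PolySpace k).subtype := by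
    rw [MvPolynomial.as_sum (u : BiPoly)]
    refine Submodule.sum_mem _ fun s hs => ?_
    have h1 := MvPolynomial.le_totalDegree hs
    rw [Finsupp.sum_fintype _ _ (by simp), Fin.sum_univ_two] at h1
    have e : MvPolynomial.monomial s (MvPolynomial.coeff s (u : BiPoly)) =
        (MvPolynomial.coeff s (u : BiPoly) * ((s 0).factorial * (s 1).factorial)) •
          dividedMonomial (s 0) (s 1) := by
      rw [MvPolynomial.monomial_eq, Finsupp.prod_fintype _ _ (by simp), Fin.prod_univ_two,
        ← MvPolynomial.smul_eq_C_mul, dividedMonomial, smul_smul]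
      congr 1
      field_simp
    rw [e]
    refine Submodule.smul_mem _ _ ⟨⟨_, dividedMonomial_mem k (s 0) (s 1) (by omega)⟩, ?_, rfl⟩
    exact hS _ _ _ (by omega) rfl
  obtain ⟨w, hw, hwu⟩ := key
  exact (Subtype.ext hwu : w = u) ▸ hw

/-- An admissible form only sees the terms of top degree. -/
theorem ExtendedRange.form_eq_zero {k : ℕ} {Q : Matrix (Mode k) (Mode k) ℝ}
    (hQ : ExtendedRange k Q) {u : PolySpace k} (hu : (u : BiPoly).totalDegree < k)
    (v : PolySpace k) : modalForm k Q u v = 0 := by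
  have h1 : ∀ (a b : ℕ) (w : PolySpace k), a + b ≤ k - 1 → (w : BiPoly) = dividedMonomial a b →
      w ∈ LinearMap.ker ((modalForm k Q).flip v) := by
    intro a b w hab hw
    have h2 : v ∈ LinearMap.ker (modalForm k Q w) :=
      mem_of_dividedMonomial_mem le_rfl (fun c d z hcd hz =>
        LinearMap.mem_ker.mpr (hQ.form_dividedMonomial (by omega) hcd hw hz)) v
        ((MvPolynomial.mem_restrictTotalDegree _ _ _).mp v.2)
    exact LinearMap.mem_ker.mp h2
  have := mem_of_dividedMonomial_mem (Nat.sub_le k 1) h1 u (by omega)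
  exact LinearMap.mem_ker.mp this

/-! ## The mass matrix -/

theorem coe_eq_sum_repr {k : ℕ} (u : PolySpace k) :
    (u : BiPoly) = ∑ m, (dubinerBasis k).repr u m • (dubinerBasis k m : BiPoly) := by
  conv_lhs => rw [← (dubinerBasis k).sum_repr u]
  simp only [Submodule.coe_sum, Submodule.coe_smul]

theorem massMatrix_apply (k : ℕ) (m n : Mode k) :
    massMatrix k m n = triInt ((dubinerBasis k m : BiPoly) * (dubinerBasis k n : BiPoly)) := by
  simp only [massMatrix, Matrix.of_apply, triInt_apply, map_mul]

theorem dotProduct_massMatrix_mulVec {k : ℕ} (u v : PolySpace k) :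
    (dubinerBasis k).repr u ⬝ᵥ massMatrix k *ᵥ (dubinerBasis k).repr v =
      triInt ((u : BiPoly) * (v : BiPoly)) := by
  rw [coe_eq_sum_repr u, coe_eq_sum_repr v, Finset.sum_mul_sum, map_sum]
  refine Finset.sum_congr rfl fun m _ => ?_
  rw [Matrix.mulVec, dotProduct, map_sum, Finset.mul_sum]
  refine Finset.sum_congr rfl fun n _ => ?_
  rw [smul_mul_smul_comm, map_smul, smul_eq_mul, massMatrix_apply]
  ring

/-- A continuous nonnegative function with zero integral vanishes on every open subset. An open box
inside the triangle suffices, because a polynomial vanishing on a product of infinite sets is zero.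
-/
theorem eq_zero_of_triInt_mul_self (p : BiPoly) (h : triInt (p * p) = 0) : p = 0 := by
  have hpos : ∀ x : Pt, 0 ≤ MvPolynomial.eval x (p * p) := fun x => by
    rw [map_mul]; exact mul_self_nonneg _
  have hcont := MvPolynomial.continuous_eval (p * p)
  rw [triInt_apply, setIntegral_eq_zero_iff_of_nonneg_ae (Filter.Eventually.of_forall hpos)
    (integrableOn_eval _)] at h
  set U : Set Pt := Set.pi Set.univ fun _ => Set.Ioo (-(1 / 10)) (1 / 10) with hU
  have hUo : IsOpen U := isOpen_set_pi Set.finite_univ fun _ _ => isOpen_Ioo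
  have hUt : U ⊆ triangle := by
    intro x hx
    have h3 := sqrt_three_mul_self
    have hp := sqrt_three_pos
    obtain ⟨h1, h2⟩ := hx 0 (Set.mem_univ _)
    obtain ⟨h4, h5⟩ := hx 1 (Set.mem_univ _)
    have h6 : √3 < 2 := by nlinarith
    rw [mem_triangle]
    refine ⟨?_, ?_, ?_⟩ <;> nlinarith
  have hae : (fun x : Pt => MvPolynomial.eval x (p * p)) =ᵐ[volume.restrict U] fun _ => 0 :=
    ae_restrict_of_ae_restrict_of_subset hUt h
  have heq : Set.EqOn (fun x : Pt => MvPolynomial.eval x (p * p)) (fun _ => 0) U :=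
    Measure.eqOn_open_of_ae_eq hae hUo hcont.continuousOn continuousOn_const
  refine MvPolynomial.funext_set (fun _ => Set.Ioo (-(1 / 10)) (1 / 10))
    (fun _ => Set.Ioo_infinite (by norm_num)) fun x hx => ?_
  have := heq hx
  simpa using this

theorem massMatrix_mulVec_ne_zero {k : ℕ} {c : Mode k → ℝ} (hc : c ≠ 0) :
    massMatrix k *ᵥ c ≠ 0 := by
  intro h
  obtain ⟨u, rfl⟩ : ∃ u : PolySpace k, ⇑((dubinerBasis k).repr u) = c :=
    ⟨(dubinerBasis k).equivFun.symm c, (dubinerBasis k).equivFun.apply_symm_apply c⟩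
  have h1 := dotProduct_massMatrix_mulVec u u
  rw [h, dotProduct_zero] at h1
  have h2 : u = 0 := Subtype.ext (eq_zero_of_triInt_mul_self _ h1.symm)
  exact hc (by rw [h2, map_zero]; rfl)

/-- The Gram matrix of a basis is nondegenerate. Only this is needed in general degree;
orthonormality is used only for `k = 1`, in `massMatrix_one`. -/
theorem isUnit_massMatrix (k : ℕ) : IsUnit (massMatrix k) := by
  rw [← Matrix.mulVec_injective_iff_isUnit]
  intro c d h
  by_contra hne
  exact massMatrix_mulVec_ne_zero (sub_ne_zero.mpr hne)
    (by rw [Matrix.mulVec_sub]; exact sub_eq_zero.mpr h)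

theorem massMatrix_mul_dgCorrection (k : ℕ) (t : Fin (k + 1) → ℝ) :
    massMatrix k * dgCorrection k t = (bdryInterp k t)ᵀ * surfaceMass k t := by
  rw [dgCorrection, Matrix.mul_assoc, ← Matrix.mul_assoc,
    Matrix.mul_nonsing_inv _ ((Matrix.isUnit_iff_isUnit_det _).mp (isUnit_massMatrix k)),
    Matrix.one_mul]

/-! ## Boundary terms -/

/-- Restriction of a polynomial to an edge. -/
noncomputable def edgePoly (e : Fin 3) : BiPoly →ₐ[ℝ] Polynomial ℝ :=
  MvPolynomial.aeval fun i =>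
    Polynomial.C ((vertex (e + 1) i - vertex e i) / 2) * Polynomial.X +
      Polynomial.C ((vertex (e + 1) i + vertex e i) / 2)

theorem eval_edgePoly (e : Fin 3) (p : BiPoly) (t : ℝ) :
    (edgePoly e p).eval t = MvPolynomial.eval (edgePoint e t) p := by
  have h : (Polynomial.aeval t).comp (edgePoly e) =
      (MvPolynomial.aeval (edgePoint e t) : BiPoly →ₐ[ℝ] ℝ) := by
    apply MvPolynomial.algHom_ext
    intro i
    simp [edgePoly, edgePoint]
    ring
  simpa [MvPolynomial.coe_aeval_eq_eval, Polynomial.coe_aeval_eq_eval] using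
    congrArg (fun f => f p) h

theorem natDegree_edgePoly_le (e : Fin 3) (p : BiPoly) :
    (edgePoly e p).natDegree ≤ p.totalDegree := by
  conv_lhs => rw [MvPolynomial.as_sum p, map_sum]
  refine Polynomial.natDegree_sum_le_of_forall_le _ _ fun s hs => ?_
  have h1 := MvPolynomial.le_totalDegree hs
  rw [Finsupp.sum_fintype _ _ (by simp), Fin.sum_univ_two] at h1
  rw [edgePoly, MvPolynomial.aeval_monomial, Finsupp.prod_fintype _ _ (by simp), Fin.prod_univ_two,
    Polynomial.algebraMap_eq]
  refine (Polynomial.natDegree_C_mul_le _ _).trans (Polynomial.natDegree_mul_le.trans ?_)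
  have h2 := fun i : Fin 2 => Polynomial.natDegree_pow_le_of_le (s i)
    (Polynomial.natDegree_linear_le (a := (vertex (e + 1) i - vertex e i) / 2)
      (b := (vertex (e + 1) i + vertex e i) / 2))
  have := h2 0
  have := h2 1
  omega

theorem eval_eq_sum_lagrange {k : ℕ} {t : Fin (k + 1) → ℝ} (ht : Function.Injective t)
    {f : Polynomial ℝ} (hf : f.natDegree ≤ k) (s : ℝ) :
    f.eval s = ∑ i, f.eval (t i) * (Lagrange.basis Finset.univ t i).eval s := by
  have hd : f.degree < (Finset.univ : Finset (Fin (k + 1))).card := by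
    rw [Finset.card_univ, Fintype.card_fin]
    exact (Polynomial.degree_le_natDegree).trans_lt (by exact_mod_cast Nat.lt_succ_of_le hf)
  have h := Lagrange.eq_interpolate (s := Finset.univ) (v := t) (ht.injOn) hd
  conv_lhs => rw [h, Lagrange.interpolate_apply]
  simp [Polynomial.eval_finsetSum]

theorem sum_lagrange_gram {k : ℕ} {t : Fin (k + 1) → ℝ} (ht : Function.Injective t)
    {f g : Polynomial ℝ} (hf : f.natDegree ≤ k) (hg : g.natDegree ≤ k) :
    ∑ i, ∑ j, f.eval (t i) * (∫ s in (-1 : ℝ)..1, (Lagrange.basis Finset.univ t i).eval s *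
      (Lagrange.basis Finset.univ t j).eval s) * g.eval (t j) =
      ∫ s in (-1 : ℝ)..1, f.eval s * g.eval s := by
  have h : ∀ s, f.eval s * g.eval s = ∑ i, ∑ j, f.eval (t i) * g.eval (t j) *
      ((Lagrange.basis Finset.univ t i).eval s * (Lagrange.basis Finset.univ t j).eval s) := by
    intro s
    rw [eval_eq_sum_lagrange ht hf s, eval_eq_sum_lagrange ht hg s, Finset.sum_mul_sum]
    refine Finset.sum_congr rfl fun i _ => Finset.sum_congr rfl fun j _ => ?_
    ring
  simp only [h]
  rw [intervalIntegral.integral_finsetSum fun i _ =>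
    Continuous.intervalIntegrable (by fun_prop) _ _]
  refine Finset.sum_congr rfl fun i _ => ?_
  rw [intervalIntegral.integral_finsetSum fun j _ =>
    Continuous.intervalIntegrable (by fun_prop) _ _]
  refine Finset.sum_congr rfl fun j _ => ?_
  rw [intervalIntegral.integral_const_mul]
  ring

/-- The normal component of a field along the edge `e`. -/
noncomputable def normalTrace (e : Fin 3) (F : Fin 2 → BiPoly) : BiPoly :=
  ∑ i, edgeNormal e i • F i

theorem eval_normalTrace (e : Fin 3) (F : Fin 2 → BiPoly) (p : Pt) :
    MvPolynomial.eval p (normalTrace e F) = ∑ i, edgeNormal e i * MvPolynomial.eval p (F i) := by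
  simp [normalTrace, MvPolynomial.smul_eval]

theorem sum_edgeNormal_mul_edgePoint (e : Fin 3) (t : ℝ) :
    ∑ i, edgeNormal e i * edgePoint e t i = √3 / 3 := by
  rw [Fin.sum_univ_two]
  fin_cases e
  · simp [edgeNormal_zero, edgePoint_zero]
  · simp [edgeNormal_one, edgePoint_one]; ring
  · simp [edgeNormal_two, edgePoint_two]; ring

/-- The position vector has constant normal component on an edge, so the radial part of a
Raviart–Thomas field contributes degree `k` to the trace and not `k + 1`. -/
theorem natDegree_edgePoly_normalTrace_le {k : ℕ} (e : Fin 3) {F : Fin 2 → BiPoly}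
    (hF : F ∈ RT k) : (edgePoly e (normalTrace e F)).natDegree ≤ k := by
  obtain ⟨q, r, rfl⟩ := hF
  have h1 : edgePoly e (normalTrace e fun i => (q i : BiPoly) + MvPolynomial.X i * (r : BiPoly)) =
      edgePoly e (∑ i, edgeNormal e i • (q i : BiPoly) + (√3 / 3) • (r : BiPoly)) := by
    refine Polynomial.funext fun t => ?_
    have h := sum_edgeNormal_mul_edgePoint e t
    rw [Fin.sum_univ_two] at h
    rw [eval_edgePoly, eval_edgePoly, eval_normalTrace]
    simp only [Fin.sum_univ_two, map_add, map_mul, MvPolynomial.eval_X, MvPolynomial.smul_eval]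
    linear_combination MvPolynomial.eval (edgePoint e t) (r : BiPoly) * h
  rw [h1]
  refine (natDegree_edgePoly_le _ _).trans ?_
  rw [← MvPolynomial.mem_restrictTotalDegree]
  exact Submodule.add_mem _ (Submodule.sum_mem _ fun i _ => Submodule.smul_mem _ _ (q i).2)
    (Submodule.smul_mem _ _ r.2)

theorem bdryInterp_mulVec_repr {k : ℕ} (t : Fin (k + 1) → ℝ) (u : PolySpace k) (j : BdryIdx k) :
    (bdryInterp k t *ᵥ (dubinerBasis k).repr u) j =
      MvPolynomial.eval (edgePoint j.1 (t j.2)) (u : BiPoly) := by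
  conv_rhs => rw [coe_eq_sum_repr u, map_sum]
  refine Finset.sum_congr rfl fun m _ => ?_
  rw [MvPolynomial.smul_eval, mul_comm]
  rfl

/-- Both the trace of `u` and the normal trace of `F` have degree at most `k` on each edge, so
interpolation at `k + 1` distinct nodes loses nothing and the Gram matrix gives the exact boundary
integral. This is why the location of the boundary points plays no role later. -/
theorem dotProduct_surface {k : ℕ} {t : Fin (k + 1) → ℝ} (ht : Function.Injective t)
    {F : Fin 2 → BiPoly} (hF : F ∈ RT k) (u : PolySpace k) :
    (dubinerBasis k).repr u ⬝ᵥ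
        ((bdryInterp k t)ᵀ * surfaceMass k t) *ᵥ fluxDof (bdryFluxPoints k t) F =
      ∑ e, edgeInt e ((u : BiPoly) * normalTrace e F) := by
  rw [← Matrix.mulVec_mulVec, Matrix.dotProduct_mulVec, Matrix.vecMul_transpose, dotProduct,
    Fintype.sum_prod_type]
  refine Finset.sum_congr rfl fun e _ => ?_
  have hu : (edgePoly e (u : BiPoly)).natDegree ≤ k :=
    (natDegree_edgePoly_le _ _).trans ((MvPolynomial.mem_restrictTotalDegree _ _ _).mp u.2)
  have h := sum_lagrange_gram ht hu (natDegree_edgePoly_normalTrace_le e hF)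
  simp only [eval_edgePoly] at h
  rw [edgeInt_apply]
  simp only [map_mul]
  rw [← h]
  refine Finset.sum_congr rfl fun i _ => ?_
  rw [bdryInterp_mulVec_repr, Matrix.mulVec, dotProduct, Fintype.sum_prod_type,
    Finset.sum_eq_single e (fun e' _ he => Finset.sum_eq_zero fun j _ => by
      simp [surfaceMass, he.symm]) (by simp), Finset.mul_sum]
  refine Finset.sum_congr rfl fun j _ => ?_
  rw [eval_normalTrace, mul_assoc]
  simp [surfaceMass, fluxDof, bdryFluxPoints]

theorem sum_edgeInt_normalTrace (u : BiPoly) (F : Fin 2 → BiPoly) :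
    ∑ e, edgeInt e (u * normalTrace e F) =
      triInt (u * divMap F) + ∑ i, triInt (MvPolynomial.pderiv i u * F i) := by
  have h : ∀ i, triInt (u * MvPolynomial.pderiv i (F i)) + triInt (MvPolynomial.pderiv i u * F i) =
      ∑ e, edgeNormal e i * edgeInt e (u * F i) := by
    intro i
    rw [← triInt_pderiv, Derivation.leibniz, map_add, smul_eq_mul, smul_eq_mul,
      mul_comm (F i)]
  have h0 := h 0
  have h1 := h 1
  have hd : divMap F = MvPolynomial.pderiv 0 (F 0) + MvPolynomial.pderiv 1 (F 1) := by
    simp [divMap, Fin.sum_univ_two]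
  have hn : ∀ e, edgeInt e (u * normalTrace e F) =
      edgeNormal e 0 * edgeInt e (u * F 0) + edgeNormal e 1 * edgeInt e (u * F 1) := by
    intro e
    simp [normalTrace, Fin.sum_univ_two, mul_add]
  simp only [hn, Finset.sum_add_distrib, ← h0, ← h1, hd, mul_add, map_add, Fin.sum_univ_two]
  ring

/-- The residual of a field, tested against a polynomial. -/
theorem dotProduct_fieldResidual {k : ℕ} {t : Fin (k + 1) → ℝ} (ht : Function.Injective t)
    (Q : Matrix (Mode k) (Mode k) ℝ) (F : RT k) (u : PolySpace k) :
    (dubinerBasis k).repr u ⬝ᵥ fieldResidual k t F Q =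
      modalForm k Q u (divRT k F) -
        ∑ i, triInt (MvPolynomial.pderiv i (u : BiPoly) * (F : Fin 2 → BiPoly) i) := by
  have h : (dubinerBasis k).repr u ⬝ᵥ massMatrix k *ᵥ (dubinerBasis k).repr (divRT k F) =
      triInt ((u : BiPoly) * divMap F) := dotProduct_massMatrix_mulVec u (divRT k F)
  rw [fieldResidual, Matrix.mulVec_sub, Matrix.mulVec_mulVec, massMatrix_mul_dgCorrection,
    dotProduct_add, dotProduct_sub, dotProduct_surface ht F.2, sum_edgeInt_normalTrace, h,
    modalForm_apply]
  ring

/-- If the residual vanishes, then the field is orthogonal to all gradients of polynomials of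
degree less than `k`. -/
theorem ExtendedRange.sum_triInt_pderiv_mul {k : ℕ} {t : Fin (k + 1) → ℝ} (ht : Function.Injective t)
    {Q : Matrix (Mode k) (Mode k) ℝ} (hQ : ExtendedRange k Q) {F : RT k}
    (hF : fieldResidual k t F Q = 0) {u : BiPoly} (hu : u.totalDegree < k) :
    ∑ i, triInt (MvPolynomial.pderiv i u * (F : Fin 2 → BiPoly) i) = 0 := by
  have h := dotProduct_fieldResidual ht Q F
    ⟨u, (MvPolynomial.mem_restrictTotalDegree _ _ _).mpr hu.le⟩
  rw [hF, dotProduct_zero, hQ.form_eq_zero hu] at h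
  linarith

/-! ## Explicit moments -/

theorem triInt_scaledMonomial_00 : triInt (scaledMonomial 0 0) = √3 := by
  have h := triInt_scaledMonomial 0 0 (by norm_num) _ rfl
  norm_num at h
  linarith

theorem triInt_scaledMonomial_10 : triInt (scaledMonomial 1 0) = 0 := by
  have h := triInt_scaledMonomial 1 0 (by norm_num) _ rfl
  norm_num at h
  linarith

theorem triInt_scaledMonomial_01 : triInt (scaledMonomial 0 1) = 0 := by
  have h := triInt_scaledMonomial 0 1 (by norm_num) _ rfl
  norm_num at h
  linarith

theorem triInt_scaledMonomial_20 : triInt (scaledMonomial 2 0) = √3 * (1 / 6) := by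
  have h := triInt_scaledMonomial 2 0 (by norm_num) _ rfl
  norm_num at h
  linarith

theorem triInt_scaledMonomial_11 : triInt (scaledMonomial 1 1) = 0 := by
  have h := triInt_scaledMonomial 1 1 (by norm_num) _ rfl
  norm_num at h
  linarith

theorem triInt_scaledMonomial_02 : triInt (scaledMonomial 0 2) = √3 * (1 / 2) := by
  have h := triInt_scaledMonomial 0 2 (by norm_num) _ rfl
  norm_num at h
  linarith

theorem triInt_scaledMonomial_30 : triInt (scaledMonomial 3 0) = 0 := by
  have h := triInt_scaledMonomial 3 0 (by norm_num) _ rfl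
  norm_num at h
  linarith

theorem triInt_scaledMonomial_21 : triInt (scaledMonomial 2 1) = √3 * (-(1 / 15)) := by
  have h := triInt_scaledMonomial 2 1 (by norm_num) _ rfl
  norm_num at h
  linarith

theorem triInt_scaledMonomial_12 : triInt (scaledMonomial 1 2) = 0 := by
  have h := triInt_scaledMonomial 1 2 (by norm_num) _ rfl
  norm_num at h
  linarith

theorem triInt_scaledMonomial_03 : triInt (scaledMonomial 0 3) = √3 * (1 / 5) := by
  have h := triInt_scaledMonomial 0 3 (by norm_num) _ rfl
  norm_num at h
  linarith

theorem triInt_scaledMonomial_40 : triInt (scaledMonomial 4 0) = √3 * (1 / 15) := by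
  have h := triInt_scaledMonomial 4 0 (by norm_num) _ rfl
  norm_num at h
  linarith

theorem triInt_scaledMonomial_22 : triInt (scaledMonomial 2 2) = √3 * (1 / 15) := by
  have h := triInt_scaledMonomial 2 2 (by norm_num) _ rfl
  norm_num at h
  linarith

theorem triInt_scaledMonomial_41 : triInt (scaledMonomial 4 1) = √3 * (-(4 / 105)) := by
  have h := triInt_scaledMonomial 4 1 (by norm_num) _ rfl
  norm_num at h
  linarith

theorem triInt_scaledMonomial_23 : triInt (scaledMonomial 2 3) = √3 * (-(4 / 105)) := by
  have h := triInt_scaledMonomial 2 3 (by norm_num) _ rfl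
  norm_num at h
  linarith

theorem X_zero_mul_scaledMonomial (a b : ℕ) :
    MvPolynomial.X 0 * scaledMonomial a b = scaledMonomial (a + 1) b := by
  rw [scaledMonomial, scaledMonomial]; ring

theorem X_one_mul_scaledMonomial (a b : ℕ) :
    MvPolynomial.X 1 * scaledMonomial a b = (√3 / 3) • scaledMonomial a (b + 1) := by
  have h : (MvPolynomial.X 1 : BiPoly) =
      (√3 / 3) • (MvPolynomial.C √3 * MvPolynomial.X 1) := by
    rw [MvPolynomial.smul_eq_C_mul, ← mul_assoc, ← map_mul,
      show √3 / 3 * √3 = 1 by linear_combination sqrt_three_mul_self / 3, map_one, one_mul]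
  conv_lhs => rw [h]
  rw [scaledMonomial, scaledMonomial, smul_mul_assoc]
  congr 1
  ring

theorem scaledMonomial_mem {k a b : ℕ} (h : a + b ≤ k) : scaledMonomial a b ∈ PolySpace k := by
  have e : scaledMonomial a b =
      √3 ^ b • (MvPolynomial.X 0 ^ a * MvPolynomial.X 1 ^ b : BiPoly) := by
    rw [scaledMonomial, MvPolynomial.smul_eq_C_mul, mul_pow, map_pow]; ring
  rw [e]
  exact Submodule.smul_mem _ _ (X_pow_mul_mem k a b h)

/-! ## Fields orthogonal to gradients -/

theorem mem_RT {k : ℕ} {p q r : BiPoly} (hp : p ∈ PolySpace k) (hq : q ∈ PolySpace k)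
    (hr : r ∈ PolySpace k) : ![p + MvPolynomial.X 0 * r, q + MvPolynomial.X 1 * r] ∈ RT k := by
  refine ⟨![⟨p, hp⟩, ⟨q, hq⟩], ⟨r, hr⟩, ?_⟩
  ext1 i
  fin_cases i <;> rfl

theorem mem_RT_of_mem {k : ℕ} {p q : BiPoly} (hp : p ∈ PolySpace k) (hq : q ∈ PolySpace k) :
    ![p, q] ∈ RT k := by
  simpa using mem_RT hp hq (zero_mem _)

/-- All fields in `RT_k` whose degrees of freedom at `S` vanish are orthogonal to the gradients of
polynomials of degree less than `k`. -/
def OrthogonalToGradients {ι : Type} (k : ℕ) (S : FluxPoints ι) : Prop :=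
  ∀ F ∈ RT k, fluxDof S F = 0 → ∀ u : BiPoly, u.totalDegree < k →
    ∑ i, triInt (MvPolynomial.pderiv i u * F i) = 0

/-- The reduction on which all negative results rest: the hypothesis concerns the interior points
alone, while the conclusion covers all boundary points and all admissible `Q`. -/
theorem ExtendedRange.exists_fieldResidual_ne_zero {ι : Type} {k : ℕ} {S : FluxPoints ι}
    (hS : ¬ OrthogonalToGradients k S) {t : Fin (k + 1) → ℝ} (ht : IsEdgeNodes k t)
    {Q : Matrix (Mode k) (Mode k) ℝ} (hQ : ExtendedRange k Q) :
    ∃ F : RT k, fluxDof S F = 0 ∧ fieldResidual k t F Q ≠ 0 := by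
  by_contra! h
  exact hS fun F hF hdof u hu => hQ.sum_triInt_pderiv_mul ht.1 (h ⟨F, hF⟩ hdof) hu

namespace OrthogonalToGradients

variable {ι : Type} {k : ℕ} {S : FluxPoints ι}

/-- Test with the coordinate function `x_i`, whose gradient is a unit vector. -/
theorem triInt_eq_zero (h : OrthogonalToGradients k S) (hk : 2 ≤ k) {F : Fin 2 → BiPoly}
    (hF : F ∈ RT k) (hdof : fluxDof S F = 0) (i : Fin 2) : triInt (F i) = 0 := by
  have := h F hF hdof (MvPolynomial.X i) (by rw [MvPolynomial.totalDegree_X]; omega)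
  fin_cases i <;> simpa [MvPolynomial.pderiv_X] using this

/-- Test with `x²`, which is allowed from `k = 3` on. -/
theorem triInt_X_zero_mul (h : OrthogonalToGradients k S) (hk : 3 ≤ k) {F : Fin 2 → BiPoly}
    (hF : F ∈ RT k) (hdof : fluxDof S F = 0) : triInt (MvPolynomial.X 0 * F 0) = 0 := by
  have := h F hF hdof (MvPolynomial.X 0 ^ 2) (by rw [MvPolynomial.totalDegree_X_pow]; omega)
  have h2 : triInt (2 * MvPolynomial.X 0 * F 0) = 0 := by
    simpa [MvPolynomial.pderiv_X, Derivation.leibniz_pow] using this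
  rw [mul_assoc, two_mul, map_add] at h2
  linarith

end OrthogonalToGradients

theorem fluxDof_collocated {ι : Type} (x : ι → Pt) (F : Fin 2 → BiPoly) (s : ι × Fin 2) :
    fluxDof (collocated x) F s = MvPolynomial.eval (x s.1) (F s.2) := by
  simp [fluxDof, collocated, Pi.single_apply]

theorem fluxDof_eq_zero {ι : Type} {S : FluxPoints ι} {F : Fin 2 → BiPoly}
    (h : ∀ s i, MvPolynomial.eval (S.pt s) (F i) = 0) : fluxDof S F = 0 := by
  ext s
  simp [fluxDof, h]

/-- The orbit is the vertex set scaled by `1 - 3z` about the centroid. This factor is the natural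
orbit parameter below: it is zero at the centroid and may have either sign. -/
theorem orbit3_eq (z : ℝ) (i : Fin 3) :
    orbit3 z i = ![(1 - 3 * z) * (![-1, 1, 0] : Fin 3 → ℝ) i,
      (1 - 3 * z) * (![-1, -1, 2] : Fin 3 → ℝ) i * (√3 / 3)] := by
  ext j
  fin_cases j <;> fin_cases i <;>
  · simp [orbit3, baryPoint, Fin.sum_univ_three, vertex, div_eq_mul_inv, sqrt_three_inv]
    try ring

theorem eval_orbit3_scaledMonomial (z : ℝ) (i : Fin 3) (a b : ℕ) :
    MvPolynomial.eval (orbit3 z i) (scaledMonomial a b) =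
      ((1 - 3 * z) * (![-1, 1, 0] : Fin 3 → ℝ) i) ^ a *
        ((1 - 3 * z) * (![-1, -1, 2] : Fin 3 → ℝ) i) ^ b := by
  rw [eval_scaledMonomial, orbit3_eq]
  simp only [Matrix.cons_val_zero, Matrix.cons_val_one]
  congr 2
  linear_combination ((1 - 3 * z) * (![-1, -1, 2] : Fin 3 → ℝ) i / 3) * sqrt_three_mul_self

theorem orbit6_eq (z₁ z₂ : ℝ) (σ : Equiv.Perm (Fin 3)) :
    orbit6 z₁ z₂ σ = ![(![z₁, z₂, 1 - z₁ - z₂] : Fin 3 → ℝ) (σ 1) -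
      (![z₁, z₂, 1 - z₁ - z₂] : Fin 3 → ℝ) (σ 0),
      (3 * (![z₁, z₂, 1 - z₁ - z₂] : Fin 3 → ℝ) (σ 2) - 1) * (√3 / 3)] := by
  have h : ∑ j, (![z₁, z₂, 1 - z₁ - z₂] : Fin 3 → ℝ) (σ j) = 1 := by
    rw [Equiv.sum_comp σ (![z₁, z₂, 1 - z₁ - z₂] : Fin 3 → ℝ), Fin.sum_univ_three]
    simp
  set w : Fin 3 → ℝ := ![z₁, z₂, 1 - z₁ - z₂]
  rw [Fin.sum_univ_three] at h
  ext j
  fin_cases j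
  · simp [orbit6, baryPoint, Fin.sum_univ_three, vertex, w]
    ring
  · simp [orbit6, baryPoint, Fin.sum_univ_three, vertex, div_eq_mul_inv, sqrt_three_inv]
    linear_combination (-√3 / 3) * h

/-! ## Degree three -/

/-- With `s = 1 - 3z` the orbit parameter, monomials restrict on an orbit to powers of `s` times a
fixed pattern. Fields are chosen whose values at the orbit points are multiples of `(s - a)(s - b)`,
so they vanish on both orbits, also when the orbits coincide. Their moments give three equations in
`a + b` and `a b`. -/
theorem not_orthogonal_two_orbit3 (z : Fin 2 → ℝ) :
    ¬ OrthogonalToGradients 3 (collocated fun s : Fin 2 × Fin 3 => orbit3 (z s.1) s.2) := by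
  intro h
  have h3 := sqrt_three_pos
  set a : ℝ := 1 - 3 * z 0 with ha
  set b : ℝ := 1 - 3 * z 1 with hb
  have hz : ∀ o : Fin 2, (1 - 3 * z o) ^ 2 - (a + b) * (1 - 3 * z o) + a * b = 0 := by
    intro o
    fin_cases o <;> simp only [ha, hb, Fin.mk_zero, Fin.mk_one, Fin.isValue] <;> ring
  have hm : ∀ {i j : ℕ}, i + j ≤ 3 → scaledMonomial i j ∈ PolySpace 3 := scaledMonomial_mem
  have e1 : 1 / 10 - (a + b) / 10 + a * b / 4 = 0 := by
    -- On the orbit with parameter `s` the values of `p` are `s (s - a)(s - b)` times `-1, 1, 0`.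
    set p : BiPoly := (3 / 4 : ℝ) • scaledMonomial 3 0 + (1 / 4 : ℝ) • scaledMonomial 1 2 +
      (a + b) • scaledMonomial 1 1 + (a * b) • scaledMonomial 1 0 with hp
    have hmem : ![p, 0] ∈ RT 3 := by
      refine mem_RT_of_mem ?_ (zero_mem _)
      exact add_mem (add_mem (add_mem (Submodule.smul_mem _ _ (hm (by norm_num)))
        (Submodule.smul_mem _ _ (hm (by norm_num)))) (Submodule.smul_mem _ _ (hm (by norm_num))))
        (Submodule.smul_mem _ _ (hm (by norm_num)))
    have hdof : fluxDof (collocated fun s : Fin 2 × Fin 3 => orbit3 (z s.1) s.2) ![p, 0] = 0 := by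
      ext ⟨⟨o, i⟩, c⟩
      rw [fluxDof_collocated]
      fin_cases c
      · simp only [hp, map_add, MvPolynomial.smul_eval, eval_orbit3_scaledMonomial,
          Matrix.cons_val_zero, Fin.zero_eta, Pi.zero_apply]
        fin_cases i <;> simp
        · linear_combination (-(1 - 3 * z o)) * hz o
        · linear_combination ((1 - 3 * z o)) * hz o
      · simp
    have := h.triInt_X_zero_mul le_rfl hmem hdof
    simp only [Matrix.cons_val_zero, hp, mul_add, mul_smul_comm, X_zero_mul_scaledMonomial, map_add,
      map_smul, smul_eq_mul, triInt_scaledMonomial_40, triInt_scaledMonomial_22,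
      triInt_scaledMonomial_21, triInt_scaledMonomial_20, Nat.reduceAdd] at this
    have h4 : √3 * (1 / 10 - (a + b) / 10 + a * b / 4) = 0 := by linear_combination (3 / 2) * this
    exact (mul_eq_zero.mp h4).resolve_left h3.ne'
  have e2 : (a + b) / 10 - ((a + b) ^ 2 - a * b) / 4 + (a * b) ^ 2 = 0 := by
    -- Here `p` takes the value `((a + b) s + a b)(s - a)(s - b)` at all three points. The cofactor
    -- is chosen to cancel the term linear in `s`, since the triangle has no invariant linear
    -- polynomial.
    set p : BiPoly := ((a + b) / 8) • scaledMonomial 0 3 - (9 * (a + b) / 8) • scaledMonomial 2 1 -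
      (3 * ((a + b) ^ 2 - a * b) / 4) • scaledMonomial 2 0 -
      (((a + b) ^ 2 - a * b) / 4) • scaledMonomial 0 2 +
      ((a * b) ^ 2) • scaledMonomial 0 0 with hp
    have hmem : ![p, 0] ∈ RT 3 := by
      refine mem_RT_of_mem ?_ (zero_mem _)
      exact add_mem (sub_mem (sub_mem (sub_mem (Submodule.smul_mem _ _ (hm (by norm_num)))
        (Submodule.smul_mem _ _ (hm (by norm_num)))) (Submodule.smul_mem _ _ (hm (by norm_num))))
        (Submodule.smul_mem _ _ (hm (by norm_num)))) (Submodule.smul_mem _ _ (hm (by norm_num)))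
    have hdof : fluxDof (collocated fun s : Fin 2 × Fin 3 => orbit3 (z s.1) s.2) ![p, 0] = 0 := by
      ext ⟨⟨o, i⟩, c⟩
      rw [fluxDof_collocated]
      fin_cases c
      · simp only [hp, map_add, map_sub, MvPolynomial.smul_eval, eval_orbit3_scaledMonomial,
          Matrix.cons_val_zero, Fin.zero_eta, Pi.zero_apply]
        fin_cases i <;> simp <;>
          linear_combination ((a + b) * (1 - 3 * z o) + a * b) * hz o
      · simp
    have := h.triInt_eq_zero (by norm_num) hmem hdof 0
    simp only [Matrix.cons_val_zero, hp, map_add, map_sub,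
      map_smul, smul_eq_mul, triInt_scaledMonomial_03, triInt_scaledMonomial_21,
      triInt_scaledMonomial_20, triInt_scaledMonomial_02, triInt_scaledMonomial_00] at this
    have h4 : √3 * ((a + b) / 10 - ((a + b) ^ 2 - a * b) / 4 + (a * b) ^ 2) = 0 := by
      linear_combination this
    exact (mul_eq_zero.mp h4).resolve_left h3.ne'
  have e3 : 2 / 35 - (a + b) / 10 + a * b / 10 = 0 := by
    -- The invariant cubic `r` equals `s ^ 3` on an orbit, so the radial part supplies `s ^ 4`. The
    -- whole field becomes `s ^ 2 (s - a)(s - b)` times the vertex vector, which vanishes on both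
    -- orbits.
    set r : BiPoly := (1 / 8 : ℝ) • scaledMonomial 0 3 - (9 / 8 : ℝ) • scaledMonomial 2 1 with hr
    set p : BiPoly := (-(3 * (a + b) / 4)) • scaledMonomial 3 0 -
      ((a + b) / 4) • scaledMonomial 1 2 - (a * b) • scaledMonomial 1 1 with hp
    set q : BiPoly := (√3 / 3) • ((-(3 * (a + b) / 4)) • scaledMonomial 2 1 -
      ((a + b) / 4) • scaledMonomial 0 3 - (3 * (a * b) / 2) • scaledMonomial 2 0 +
      (a * b / 2) • scaledMonomial 0 2) with hq
    have hmem : ![p + MvPolynomial.X 0 * r, q + MvPolynomial.X 1 * r] ∈ RT 3 := by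
      refine mem_RT ?_ ?_ ?_
      · exact sub_mem (sub_mem (Submodule.smul_mem _ _ (hm (by norm_num)))
          (Submodule.smul_mem _ _ (hm (by norm_num)))) (Submodule.smul_mem _ _ (hm (by norm_num)))
      · exact Submodule.smul_mem _ _ (add_mem (sub_mem (sub_mem
          (Submodule.smul_mem _ _ (hm (by norm_num)))
          (Submodule.smul_mem _ _ (hm (by norm_num)))) (Submodule.smul_mem _ _ (hm (by norm_num))))
          (Submodule.smul_mem _ _ (hm (by norm_num))))
      · exact sub_mem (Submodule.smul_mem _ _ (hm (by norm_num)))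
          (Submodule.smul_mem _ _ (hm (by norm_num)))
    have hdof : fluxDof (collocated fun s : Fin 2 × Fin 3 => orbit3 (z s.1) s.2)
        ![p + MvPolynomial.X 0 * r, q + MvPolynomial.X 1 * r] = 0 := by
      ext ⟨⟨o, i⟩, c⟩
      rw [fluxDof_collocated]
      fin_cases c
      · simp only [hp, hr, mul_sub, mul_smul_comm, X_zero_mul_scaledMonomial, map_add, map_sub,
          MvPolynomial.smul_eval, eval_orbit3_scaledMonomial,
          Matrix.cons_val_zero, Fin.zero_eta, Pi.zero_apply]
        fin_cases i <;> simp
        · linear_combination (-(1 - 3 * z o) ^ 2) * hz o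
        · linear_combination ((1 - 3 * z o) ^ 2) * hz o
      · simp only [hq, hr, mul_sub, mul_smul_comm, X_one_mul_scaledMonomial, map_add, map_sub,
          MvPolynomial.smul_eval, eval_orbit3_scaledMonomial,
          Matrix.cons_val_one, Matrix.cons_val_zero, Fin.mk_one, Pi.zero_apply]
        fin_cases i <;> simp
        · linear_combination (-(√3 / 3) * (1 - 3 * z o) ^ 2) * hz o
        · linear_combination (-(√3 / 3) * (1 - 3 * z o) ^ 2) * hz o
        · linear_combination (2 * (√3 / 3) * (1 - 3 * z o) ^ 2) * hz o
    have t0 := h.triInt_X_zero_mul le_rfl hmem hdof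
    simp only [Matrix.cons_val_zero, hp, hr, mul_add, mul_sub, mul_smul_comm,
      X_zero_mul_scaledMonomial, map_add, map_sub, map_smul, smul_eq_mul,
      triInt_scaledMonomial_40, triInt_scaledMonomial_22, triInt_scaledMonomial_21,
      triInt_scaledMonomial_23, triInt_scaledMonomial_41, Nat.reduceAdd] at t0
    have h4 : √3 * (2 / 35 - (a + b) / 10 + a * b / 10) = 0 := by linear_combination (3 / 2) * t0
    exact (mul_eq_zero.mp h4).resolve_left h3.ne'
  -- The two linear equations `e1` and `e3` fix the product and the sum, and these values contradict
  -- `e2`.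
  have h5 : a * b = -2 / 7 := by linarith
  have h6 : a + b = 2 / 7 := by linarith
  rw [h5, h6] at e2
  norm_num at e2

theorem orbit6_bary_sum (z₁ z₂ : ℝ) (σ : Equiv.Perm (Fin 3)) (f : ℝ → ℝ) :
    f ((![z₁, z₂, 1 - z₁ - z₂] : Fin 3 → ℝ) (σ 0)) +
      f ((![z₁, z₂, 1 - z₁ - z₂] : Fin 3 → ℝ) (σ 1)) +
      f ((![z₁, z₂, 1 - z₁ - z₂] : Fin 3 → ℝ) (σ 2)) = f z₁ + f z₂ + f (1 - z₁ - z₂) := by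
  have h := Equiv.sum_comp σ fun j => f ((![z₁, z₂, 1 - z₁ - z₂] : Fin 3 → ℝ) j)
  rw [Fin.sum_univ_three, Fin.sum_univ_three] at h
  exact h

theorem eval_orbit6_scaledMonomial (z₁ z₂ : ℝ) (σ : Equiv.Perm (Fin 3)) (a b : ℕ) :
    MvPolynomial.eval (orbit6 z₁ z₂ σ) (scaledMonomial a b) =
      ((![z₁, z₂, 1 - z₁ - z₂] : Fin 3 → ℝ) (σ 1) -
        (![z₁, z₂, 1 - z₁ - z₂] : Fin 3 → ℝ) (σ 0)) ^ a *
        (3 * (![z₁, z₂, 1 - z₁ - z₂] : Fin 3 → ℝ) (σ 2) - 1) ^ b := by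
  rw [eval_scaledMonomial, orbit6_eq]
  simp only [Matrix.cons_val_zero, Matrix.cons_val_one]
  congr 2
  linear_combination
    ((3 * (![z₁, z₂, 1 - z₁ - z₂] : Fin 3 → ℝ) (σ 2) - 1) / 3) * sqrt_three_mul_self

/-- All six points lie on the circle `g = 0` about the centroid. The mean of `g` forces the squared
radius to be `1/3`, whereas the `x`-moment of `x g` does not vanish for that radius. -/
theorem not_orthogonal_orbit6_three (z₁ z₂ : ℝ) :
    ¬ OrthogonalToGradients 3 (collocated (orbit6 z₁ z₂)) := by
  intro h
  have h3 := sqrt_three_pos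
  -- The squared distance of the orbit from the centroid.
  set κ : ℝ := 2 * (z₁ ^ 2 + z₂ ^ 2 + (1 - z₁ - z₂) ^ 2) - 2 / 3 with hκ
  have hm : ∀ {i j : ℕ}, i + j ≤ 3 → scaledMonomial i j ∈ PolySpace 3 := scaledMonomial_mem
  set g : BiPoly := scaledMonomial 2 0 + (1 / 3 : ℝ) • scaledMonomial 0 2 -
    κ • scaledMonomial 0 0 with hg
  have hg0 : ∀ σ, MvPolynomial.eval (orbit6 z₁ z₂ σ) g = 0 := by
    intro σ
    simp only [hg, map_add, map_sub, MvPolynomial.smul_eval, eval_orbit6_scaledMonomial]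
    have h1 := orbit6_bary_sum z₁ z₂ σ fun x => x
    have h2 := orbit6_bary_sum z₁ z₂ σ fun x => x ^ 2
    set w : Fin 3 → ℝ := ![z₁, z₂, 1 - z₁ - z₂]
    have h4 : (w (σ 0) + w (σ 1)) ^ 2 = (1 - w (σ 2)) ^ 2 := by
      congr 1
      linarith
    rw [hκ]
    linear_combination 2 * h2 - h4
  have e1 : κ = 1 / 3 := by
    have hmem : ![g, 0] ∈ RT 3 := by
      refine mem_RT_of_mem ?_ (zero_mem _)
      exact sub_mem (add_mem (hm (by norm_num)) (Submodule.smul_mem _ _ (hm (by norm_num))))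
        (Submodule.smul_mem _ _ (hm (by norm_num)))
    have hdof : fluxDof (collocated (orbit6 z₁ z₂)) ![g, 0] = 0 := by
      refine fluxDof_eq_zero fun s i => ?_
      fin_cases i
      · exact hg0 s.1
      · simp
    have := h.triInt_eq_zero (by norm_num) hmem hdof 0
    simp only [Matrix.cons_val_zero, hg, map_add, map_sub, map_smul, smul_eq_mul,
      triInt_scaledMonomial_20, triInt_scaledMonomial_02, triInt_scaledMonomial_00] at this
    have h4 : √3 * (κ - 1 / 3) = 0 := by linear_combination -this
    linarith [(mul_eq_zero.mp h4).resolve_left h3.ne']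
  have hmem : ![MvPolynomial.X 0 * g, 0] ∈ RT 3 := by
    refine mem_RT_of_mem ?_ (zero_mem _)
    simp only [hg, mul_add, mul_sub, mul_smul_comm, X_zero_mul_scaledMonomial]
    exact sub_mem (add_mem (hm (by norm_num)) (Submodule.smul_mem _ _ (hm (by norm_num))))
      (Submodule.smul_mem _ _ (hm (by norm_num)))
  have hdof : fluxDof (collocated (orbit6 z₁ z₂)) ![MvPolynomial.X 0 * g, 0] = 0 := by
    refine fluxDof_eq_zero fun s i => ?_
    fin_cases i
    · exact (map_mul _ _ _).trans (mul_eq_zero_of_right _ (hg0 s.1))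
    · simp
  have := h.triInt_X_zero_mul le_rfl hmem hdof
  simp only [Matrix.cons_val_zero, hg, mul_add, mul_sub, mul_smul_comm, X_zero_mul_scaledMonomial,
    map_add, map_sub, map_smul, smul_eq_mul, triInt_scaledMonomial_40, triInt_scaledMonomial_22,
    triInt_scaledMonomial_20, e1, Nat.reduceAdd] at this
  have h4 : √3 * (1 / 30) = 0 := by linear_combination this
  linarith

/-! ## Degree two, collocated points -/

/-- Some field in `RT_2` vanishes at a three-point orbit but has nonzero mean. -/
theorem exists_mem_RT_orbit3 (z : ℝ) : ∃ F ∈ RT 2,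
    (∀ i c, MvPolynomial.eval (orbit3 z i) (F c) = 0) ∧ triInt (F 0) ≠ 0 := by
  have h3 := sqrt_three_pos
  have hm : ∀ {i j : ℕ}, i + j ≤ 2 → scaledMonomial i j ∈ PolySpace 2 := scaledMonomial_mem
  set s : ℝ := 1 - 3 * z with hs
  -- The circle through the three points has nonzero mean except when `s ^ 2 = 1 / 4`. In that case
  -- a genuinely cubic field with radial part `√3 x y` is used; its mean could vanish only for `s =
  -- 2 / 5`.
  by_cases h : s ^ 2 = 1 / 4
  · set r : BiPoly := scaledMonomial 1 1
    set p : BiPoly := (2 / 3 * s ^ 3) • scaledMonomial 0 0 - (s ^ 2 / 3) • scaledMonomial 0 1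
      with hp
    set q : BiPoly := (-(√3 / 3) * s ^ 2) • scaledMonomial 1 0 with hq
    refine ⟨![p + MvPolynomial.X 0 * r, q + MvPolynomial.X 1 * r], mem_RT ?_ ?_ ?_, ?_, ?_⟩
    · exact sub_mem (Submodule.smul_mem _ _ (hm (by norm_num)))
        (Submodule.smul_mem _ _ (hm (by norm_num)))
    · exact Submodule.smul_mem _ _ (hm (by norm_num))
    · exact hm (by norm_num)
    · intro i c
      fin_cases c
      · simp only [hp, r, X_zero_mul_scaledMonomial, map_add, map_sub, MvPolynomial.smul_eval,
          eval_orbit3_scaledMonomial, Matrix.cons_val_zero, Fin.zero_eta]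
        fin_cases i <;> simp <;> ring
      · simp only [hq, r, X_one_mul_scaledMonomial, map_add, MvPolynomial.smul_eval,
          eval_orbit3_scaledMonomial, Matrix.cons_val_one, Matrix.cons_val_zero, Fin.mk_one]
        fin_cases i <;> simp <;> ring
    · simp only [Matrix.cons_val_zero, hp, r, X_zero_mul_scaledMonomial, map_add, map_sub, map_smul,
        smul_eq_mul, triInt_scaledMonomial_00, triInt_scaledMonomial_01, triInt_scaledMonomial_21,
        Nat.reduceAdd]
      intro h0
      have h4 : √3 * (s - 2 / 5) = 0 := by linear_combination 6 * h0 - 4 * √3 * s * h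
      have h5 : s = 2 / 5 := by linarith [(mul_eq_zero.mp h4).resolve_left h3.ne']
      rw [h5] at h
      norm_num at h
  · set g : BiPoly := scaledMonomial 2 0 + (1 / 3 : ℝ) • scaledMonomial 0 2 -
      (4 / 3 * s ^ 2) • scaledMonomial 0 0 with hg
    refine ⟨![g, 0], mem_RT_of_mem ?_ (zero_mem _), ?_, ?_⟩
    · exact sub_mem (add_mem (hm (by norm_num)) (Submodule.smul_mem _ _ (hm (by norm_num))))
        (Submodule.smul_mem _ _ (hm (by norm_num)))
    · intro i c
      fin_cases c
      · simp only [hg, map_add, map_sub, MvPolynomial.smul_eval,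
          eval_orbit3_scaledMonomial, Matrix.cons_val_zero, Fin.zero_eta]
        fin_cases i <;> simp <;> ring
      · simp
    · simp only [Matrix.cons_val_zero, hg, map_add, map_sub, map_smul, smul_eq_mul,
        triInt_scaledMonomial_20, triInt_scaledMonomial_02, triInt_scaledMonomial_00]
      intro h0
      have h4 : √3 * (s ^ 2 - 1 / 4) = 0 := by linear_combination -(3 / 4) * h0
      exact h (by linarith [(mul_eq_zero.mp h4).resolve_left h3.ne'])

/-- Both components of the field vanish at the orbit, so the normals are irrelevant. This also
settles the degenerate six-point configurations. -/
theorem not_orthogonal_of_pt_eq_orbit3 {ι : Type} {S : FluxPoints ι} {z : ℝ}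
    (hS : ∀ s, ∃ i, S.pt s = orbit3 z i) : ¬ OrthogonalToGradients 2 S := by
  intro h
  obtain ⟨F, hF, hF0, hF1⟩ := exists_mem_RT_orbit3 z
  refine hF1 (h.triInt_eq_zero le_rfl hF (fluxDof_eq_zero fun s c => ?_) 0)
  obtain ⟨i, hi⟩ := hS s
  rw [hi]
  exact hF0 i c

/-! ## Degree two, one normal at each point -/

/-- If the fields vanishing at `S` have mean zero, then integration over the triangle is a
quadrature rule on `RT_2` whose matrix-valued weights have rank at most one. -/
theorem OrthogonalToGradients.exists_quadrature {ι : Type} [Fintype ι] {S : FluxPoints ι}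
    (h : OrthogonalToGradients 2 S) : ∃ N : Fin 2 → Fin 2 → ι → ℝ,
      (∀ s, N 0 0 s * N 1 1 s = N 0 1 s * N 1 0 s) ∧
      ∀ F ∈ RT 2, ∀ c, triInt (F c) = ∑ s, (N c 0 s * MvPolynomial.eval (S.pt s) (F 0) +
        N c 1 s * MvPolynomial.eval (S.pt s) (F 1)) := by
  let L : ι → RT 2 →ₗ[ℝ] ℝ := fun s =>
    (∑ i, S.normal s i • ((MvPolynomial.aeval (S.pt s)).toLinearMap ∘ₗ LinearMap.proj i)) ∘ₗ
      (RT 2).subtype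
  have hL : ∀ s F, L s F = fluxDof S F s := by
    intro s F
    simp [L, fluxDof]
  have hspan : ∀ c : Fin 2, ∃ a : ι → ℝ, ∀ F : RT 2,
      triInt ((F : Fin 2 → BiPoly) c) = ∑ s, a s * L s F := by
    intro c
    -- Duality: a functional vanishing on the common kernel of finitely many functionals is a
    -- combination of them.
    have hker : ⨅ s, LinearMap.ker (L s) ≤
        LinearMap.ker (triInt ∘ₗ LinearMap.proj c ∘ₗ (RT 2).subtype) := by
      intro F hF
      rw [Submodule.mem_iInf] at hF
      refine LinearMap.mem_ker.mpr (h.triInt_eq_zero le_rfl F.2 ?_ c)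
      ext s
      rw [← hL]
      exact LinearMap.mem_ker.mp (hF s)
    have hmem := mem_span_of_iInf_ker_le_ker hker
    obtain ⟨a, ha⟩ := (Submodule.mem_span_range_iff_exists_fun ℝ).mp hmem
    refine ⟨a, fun F => ?_⟩
    have := congrArg (fun f => f F) ha
    simpa using this.symm
  choose a ha using hspan
  -- At each point the weight is the outer product of a coefficient vector with the normal, which is
  -- why its determinant is zero.
  refine ⟨fun c c' s => a c s * S.normal s c', fun s => by ring, fun F hF c => ?_⟩
  rw [ha c ⟨F, hF⟩]
  refine Finset.sum_congr rfl fun s _ => ?_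
  rw [hL, fluxDof, Fin.sum_univ_two]
  ring

/-- Consequences of a quadrature rule for constant multiples and radial multiples of a
polynomial. -/
theorem quadrature_components {ι : Type} [Fintype ι] {S : FluxPoints ι}
    {N : Fin 2 → Fin 2 → ι → ℝ}
    (hN : ∀ F ∈ RT 2, ∀ c, triInt (F c) = ∑ s, (N c 0 s * MvPolynomial.eval (S.pt s) (F 0) +
        N c 1 s * MvPolynomial.eval (S.pt s) (F 1))) :
    (∀ (c c' : Fin 2) (p : BiPoly), p ∈ PolySpace 2 →
      (if c = c' then 1 else 0) * triInt p = ∑ s, N c c' s * MvPolynomial.eval (S.pt s) p) ∧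
    ∀ (c : Fin 2) (r : BiPoly), r ∈ PolySpace 2 → triInt (MvPolynomial.X c * r) =
      ∑ s, (N c 0 s * MvPolynomial.eval (S.pt s) (MvPolynomial.X 0 * r) +
        N c 1 s * MvPolynomial.eval (S.pt s) (MvPolynomial.X 1 * r)) := by
  refine ⟨fun c c' p hp => ?_, fun c r hr => ?_⟩
  · have h0 := hN ![p, 0] (mem_RT_of_mem hp (zero_mem _)) c
    have h1 := hN ![0, p] (mem_RT_of_mem (zero_mem _) hp) c
    fin_cases c <;> fin_cases c' <;> simp at h0 h1 ⊢ <;> assumption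
  · have h0 := hN ![0 + MvPolynomial.X 0 * r, 0 + MvPolynomial.X 1 * r]
      (mem_RT (zero_mem _) (zero_mem _) hr) c
    simp only [zero_add, Matrix.cons_val_zero, Matrix.cons_val_one] at h0
    rw [← h0]
    fin_cases c <;> rfl

theorem eq_of_mul_sub_eq_zero {a x y : ℝ} (ha : a ≠ 0) (h : a * (x - y) = 0) : x = y :=
  sub_eq_zero.mp ((mul_eq_zero.mp h).resolve_left ha)

/-- Weights of a quadrature rule of degree two on two three-point orbits. -/
theorem two_orbit3_weights {a b δ : ℝ} (hab : a ≠ b) {f g : Fin 3 → ℝ}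
    (h10 : a * (f 1 - f 0) + b * (g 1 - g 0) = 0)
    (h01 : a * (2 * f 2 - f 0 - f 1) + b * (2 * g 2 - g 0 - g 1) = 0)
    (h20 : a ^ 2 * (f 0 + f 1) + b ^ 2 * (g 0 + g 1) = δ / 6)
    (h11 : a ^ 2 * (f 0 - f 1) + b ^ 2 * (g 0 - g 1) = 0)
    (h02 : a ^ 2 * (f 0 + f 1 + 4 * f 2) + b ^ 2 * (g 0 + g 1 + 4 * g 2) = δ / 2) :
    a ≠ 0 → f 1 = f 0 ∧ f 2 = f 0 := by
  intro ha
  -- The deviations from constancy on the two orbits satisfy a linear system with coefficients `a,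
  -- b` and `a ^ 2, b ^ 2`: the first moments and the trace-free second moments have the same
  -- symmetry type. Eliminating `g` leaves the factor `a (a - b)`.
  have hab' : a * (a - b) ≠ 0 := mul_ne_zero ha (sub_ne_zero.mpr hab)
  have e1 : f 1 = f 0 := eq_of_mul_sub_eq_zero hab' (by linear_combination (-b) * h10 - h11)
  refine ⟨e1, ?_⟩
  have e2 : 2 * f 2 = f 0 + f 1 :=
    eq_of_mul_sub_eq_zero hab' (by linear_combination (-b) * h01 + (h02 - 3 * h20) / 2)
  linarith

/-- Away from the centroid the matrix weights are constant on each orbit. In the generic case the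
zeroth and second moments say that `N₁ + N₂` and `a² N₁ + b² N₂` are multiples of the identity. It
is enough to show that `N₁` has equal diagonal entries and a zero off-diagonal one: then singularity
kills the diagonals of both weights, contradicting the nonzero sum. -/
theorem not_orthogonal_two_orbit3_two (z : Fin 2 → ℝ) (n : Fin 2 × Fin 3 → Pt) :
    ¬ OrthogonalToGradients 2 ⟨fun s => orbit3 (z s.1) s.2, n⟩ := by
  intro h
  rcases eq_or_ne (z 0) (z 1) with hz | hz
  · refine not_orthogonal_of_pt_eq_orbit3 (z := z 0) (fun s => ⟨s.2, ?_⟩) h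
    obtain ⟨o, i⟩ := s
    fin_cases o
    · rfl
    · simp [hz]
  have h3 := sqrt_three_pos
  have hk := sqrt_three_mul_self
  have hm : ∀ {i j : ℕ}, i + j ≤ 2 → scaledMonomial i j ∈ PolySpace 2 := scaledMonomial_mem
  obtain ⟨N, hdet, hN⟩ := h.exists_quadrature
  obtain ⟨hq, hr⟩ := quadrature_components hN
  set a : ℝ := 1 - 3 * z 0 with ha
  set b : ℝ := 1 - 3 * z 1 with hb
  have hab : a ≠ b := fun hh => hz (by linarith)
  have hQ : ∀ (c c' : Fin 2) (δ : ℝ), δ = (if c = c' then √3 else 0) →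
      N c c' (0, 0) + N c c' (0, 1) + N c c' (0, 2) + (N c c' (1, 0) + N c c' (1, 1) +
        N c c' (1, 2)) = δ ∧
      a * (N c c' (0, 1) - N c c' (0, 0)) + b * (N c c' (1, 1) - N c c' (1, 0)) = 0 ∧
      a * (2 * N c c' (0, 2) - N c c' (0, 0) - N c c' (0, 1)) +
        b * (2 * N c c' (1, 2) - N c c' (1, 0) - N c c' (1, 1)) = 0 ∧
      a ^ 2 * (N c c' (0, 0) + N c c' (0, 1)) + b ^ 2 * (N c c' (1, 0) + N c c' (1, 1)) = δ / 6 ∧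
      a ^ 2 * (N c c' (0, 0) - N c c' (0, 1)) + b ^ 2 * (N c c' (1, 0) - N c c' (1, 1)) = 0 ∧
      a ^ 2 * (N c c' (0, 0) + N c c' (0, 1) + 4 * N c c' (0, 2)) +
        b ^ 2 * (N c c' (1, 0) + N c c' (1, 1) + 4 * N c c' (1, 2)) = δ / 2 := by
    intro c c' δ hδ
    have hδ' : (if c = c' then (1 : ℝ) else 0) * √3 = δ := by rw [hδ]; split_ifs <;> simp
    have q00 := hq c c' _ (hm (i := 0) (j := 0) (by norm_num))
    have q10 := hq c c' _ (hm (i := 1) (j := 0) (by norm_num))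
    have q01 := hq c c' _ (hm (i := 0) (j := 1) (by norm_num))
    have q20 := hq c c' _ (hm (i := 2) (j := 0) (by norm_num))
    have q11 := hq c c' _ (hm (i := 1) (j := 1) (by norm_num))
    have q02 := hq c c' _ (hm (i := 0) (j := 2) (by norm_num))
    simp only [Fintype.sum_prod_type, Fin.sum_univ_two, Fin.sum_univ_three,
      eval_orbit3_scaledMonomial, ← ha, ← hb, triInt_scaledMonomial_00, triInt_scaledMonomial_10,
      triInt_scaledMonomial_01, triInt_scaledMonomial_20, triInt_scaledMonomial_11,
      triInt_scaledMonomial_02, ← mul_assoc, hδ', Matrix.cons_val_zero, Matrix.cons_val_one,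
      Matrix.cons_val] at q00 q10 q01 q20 q11 q02
    refine ⟨?_, ?_, ?_, ?_, ?_, ?_⟩
    · linear_combination -q00
    · linear_combination -q10
    · linear_combination -q01
    · linear_combination -q20
    · linear_combination -q11
    · linear_combination -q02
  have hA : a ≠ 0 → ∀ c c', N c c' (0, 1) = N c c' (0, 0) ∧ N c c' (0, 2) = N c c' (0, 0) := by
    intro ha0 c c'
    obtain ⟨_, h2, h3, h4, h5, h6⟩ := hQ c c' _ rfl
    exact two_orbit3_weights hab (f := fun i => N c c' (0, i)) (g := fun i => N c c' (1, i))
      h2 h3 h4 h5 h6 ha0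
  have hB : b ≠ 0 → ∀ c c', N c c' (1, 1) = N c c' (1, 0) ∧ N c c' (1, 2) = N c c' (1, 0) := by
    intro hb0 c c'
    obtain ⟨_, h2, h3, h4, h5, h6⟩ := hQ c c' _ rfl
    exact two_orbit3_weights hab.symm (f := fun i => N c c' (1, i)) (g := fun i => N c c' (0, i))
      (by rw [add_comm]; exact h2) (by rw [add_comm]; exact h3) (by rw [add_comm]; exact h4)
      (by rw [add_comm]; exact h5) (by rw [add_comm]; exact h6) hb0
  have q00 := hQ 0 0 √3 (by simp)
  have q01 := hQ 0 1 0 (by simp)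
  have q10 := hQ 1 0 0 (by simp)
  have q11 := hQ 1 1 √3 (by simp)
  have d0 := hdet (0, 0)
  have d1 := hdet (1, 0)
  -- An orbit collapsed to the centroid is invisible to second moments, so the other orbit carries a
  -- nonzero multiple of the identity as weight, which is not singular.
  rcases eq_or_ne a 0 with ha0 | ha0
  · have hb0 : b ≠ 0 := fun hh => hab (by rw [ha0, hh])
    have hB := hB hb0
    have e : ∀ c c' δ, a ^ 2 * (N c c' (0, 0) + N c c' (0, 1)) +
        b ^ 2 * (N c c' (1, 0) + N c c' (1, 1)) = δ / 6 → N c c' (1, 0) = δ / (12 * b ^ 2) := by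
      intro c c' δ hh
      rw [ha0, (hB c c').1] at hh
      field_simp
      linarith
    rw [e 0 0 _ q00.2.2.2.1, e 0 1 _ q01.2.2.2.1, e 1 0 _ q10.2.2.2.1, e 1 1 _ q11.2.2.2.1] at d1
    have : 0 < √3 / (12 * b ^ 2) := by positivity
    simp at d1
    exact absurd d1 hb0
  rcases eq_or_ne b 0 with hb0 | hb0
  · have hA := hA ha0
    have e : ∀ c c' δ, a ^ 2 * (N c c' (0, 0) + N c c' (0, 1)) +
        b ^ 2 * (N c c' (1, 0) + N c c' (1, 1)) = δ / 6 → N c c' (0, 0) = δ / (12 * a ^ 2) := by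
      intro c c' δ hh
      rw [hb0, (hA c c').1] at hh
      field_simp
      linarith
    rw [e 0 0 _ q00.2.2.2.1, e 0 1 _ q01.2.2.2.1, e 1 0 _ q10.2.2.2.1, e 1 1 _ q11.2.2.2.1] at d0
    have : 0 < √3 / (12 * a ^ 2) := by positivity
    simp at d0
    exact absurd d0 ha0
  have hA := hA ha0
  have hB := hB hb0
  have s : ∀ c c' δ, N c c' (0, 0) + N c c' (0, 1) + N c c' (0, 2) + (N c c' (1, 0) +
      N c c' (1, 1) + N c c' (1, 2)) = δ → N c c' (0, 0) + N c c' (1, 0) = δ / 3 := by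
    intro c c' δ hh
    linarith [(hA c c').1, (hA c c').2, (hB c c').1, (hB c c').2]
  have s00 := s _ _ _ q00.1
  have s01 := s _ _ _ q01.1
  have s10 := s _ _ _ q10.1
  have s11 := s _ _ _ q11.1
  have t : ∀ c c' δ, a ^ 2 * (N c c' (0, 0) + N c c' (0, 1)) +
      b ^ 2 * (N c c' (1, 0) + N c c' (1, 1)) = δ / 6 →
      a ^ 2 * N c c' (0, 0) + b ^ 2 * N c c' (1, 0) = δ / 12 := by
    intro c c' δ hh
    rw [(hA c c').1, (hB c c').1] at hh
    linarith
  have t00 := t _ _ _ q00.2.2.2.1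
  have t01 := t _ _ _ q01.2.2.2.1
  have t11 := t _ _ _ q11.2.2.2.1
  suffices hs : N 0 0 (0, 0) = N 1 1 (0, 0) ∧ N 0 1 (0, 0) = 0 by
    obtain ⟨hs1, hs2⟩ := hs
    have hs3 : N 0 1 (1, 0) = 0 := by linarith
    rw [hs2, zero_mul, hs1, mul_self_eq_zero] at d0
    have hs4 : N 0 0 (1, 0) = N 1 1 (1, 0) := by linarith
    rw [hs3, zero_mul, hs4, mul_self_eq_zero] at d1
    linarith
  -- For `a = -b` the second moment repeats the zeroth one. The missing information on `N₁ - N₂`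
  -- comes from the radial cubic fields, because cubes distinguish opposite parameters.
  by_cases hsq : a + b = 0
  · have hba : b = -a := by linarith
    have r0 := hr 0 (scaledMonomial 1 1) (hm (by norm_num))
    have r1 := hr 1 (scaledMonomial 2 0 - (1 / 3 : ℝ) • scaledMonomial 0 2)
      (sub_mem (hm (by norm_num)) (Submodule.smul_mem _ _ (hm (by norm_num))))
    have r2 := hr 0 (scaledMonomial 2 0 - (1 / 3 : ℝ) • scaledMonomial 0 2)
      (sub_mem (hm (by norm_num)) (Submodule.smul_mem _ _ (hm (by norm_num))))
    simp only [mul_sub, mul_smul_comm, X_zero_mul_scaledMonomial, X_one_mul_scaledMonomial,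
      map_sub, map_smul, MvPolynomial.smul_eval, smul_eq_mul, Nat.reduceAdd,
      Fintype.sum_prod_type, Fin.sum_univ_two, Fin.sum_univ_three,
      eval_orbit3_scaledMonomial, ← ha, ← hb, triInt_scaledMonomial_21, triInt_scaledMonomial_30,
      triInt_scaledMonomial_12, triInt_scaledMonomial_03, Matrix.cons_val_zero,
      Matrix.cons_val_one, Matrix.cons_val, (hA _ _).1, (hA _ _).2, (hB _ _).1, (hB _ _).2, hba]
      at r0 r1 r2
    have ha3 : a ^ 3 ≠ 0 := pow_ne_zero 3 ha0
    have u1 : N 0 1 (0, 0) - N 0 1 (1, 0) = 0 := by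
      have : √3 * a ^ 3 * (N 0 1 (0, 0) - N 0 1 (1, 0) - 0) = 0 := by
        linear_combination (3 / 4) * r2
      exact eq_of_mul_sub_eq_zero (mul_ne_zero h3.ne' ha3) this
    have u2 : N 0 0 (0, 0) - N 0 0 (1, 0) = N 1 1 (0, 0) - N 1 1 (1, 0) := by
      refine eq_of_mul_sub_eq_zero (mul_ne_zero h3.ne' ha3) ?_
      linear_combination (√3 / 2) * r0 - (3 / 4) * r1
    exact ⟨by linarith, by linarith⟩
  · have hsq' : a ^ 2 - b ^ 2 ≠ 0 := by
      rw [sq_sub_sq]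
      exact mul_ne_zero hsq (sub_ne_zero.mpr hab)
    exact ⟨eq_of_mul_sub_eq_zero hsq' (by linear_combination t00 - t11 - b ^ 2 * (s00 - s11)),
      eq_of_mul_sub_eq_zero hsq' (by linear_combination t01 - b ^ 2 * s01)⟩

/-! ### Six-point orbits with one normal at each point -/

theorem sum_perm_three (f : Equiv.Perm (Fin 3) → ℝ) :
    ∑ σ, f σ = f 1 + f (finRotate 3) + f (finRotate 3)⁻¹ + (f (Equiv.swap 0 1) +
      f (Equiv.swap 0 2) + f (Equiv.swap 1 2)) := by
  have h : (Finset.univ : Finset (Equiv.Perm (Fin 3))) = {1, finRotate 3, (finRotate 3)⁻¹,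
      Equiv.swap 0 1, Equiv.swap 0 2, Equiv.swap 1 2} := by decide
  rw [h, Finset.sum_insert (by decide), Finset.sum_insert (by decide),
    Finset.sum_insert (by decide), Finset.sum_insert (by decide), Finset.sum_insert (by decide),
    Finset.sum_singleton]
  ring

/-- The value of `x^a (√3 y)^b` at the points of a six-point orbit, grouped by parity. -/
theorem sum_orbit6_scaledMonomial (z₁ z₂ : ℝ) (f : Equiv.Perm (Fin 3) → ℝ) (a b : ℕ) :
    ∑ σ, f σ * MvPolynomial.eval (orbit6 z₁ z₂ σ) (scaledMonomial a b) =
      f 1 * ((z₂ - z₁) ^ a * (3 * (1 - z₁ - z₂) - 1) ^ b) +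
      f (finRotate 3) * ((1 - z₁ - z₂ - z₂) ^ a * (3 * z₁ - 1) ^ b) +
      f (finRotate 3)⁻¹ * ((z₁ - (1 - z₁ - z₂)) ^ a * (3 * z₂ - 1) ^ b) +
      (f (Equiv.swap 0 1) * ((z₁ - z₂) ^ a * (3 * (1 - z₁ - z₂) - 1) ^ b) +
      f (Equiv.swap 0 2) * ((z₂ - (1 - z₁ - z₂)) ^ a * (3 * z₁ - 1) ^ b) +
      f (Equiv.swap 1 2) * ((1 - z₁ - z₂ - z₁) ^ a * (3 * z₂ - 1) ^ b)) := by
  rw [sum_perm_three]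
  simp only [eval_orbit6_scaledMonomial]
  rfl

/-- Weights of a quadrature rule of degree two on a six-point orbit: they are constant on each
parity class. The points are `(d i, 3 w i - 1)` and `(-d i, 3 w i - 1)`. -/
theorem orbit6_weights {w₀ w₁ w₂ δ e₀ e₁ e₂ o₀ o₁ o₂ : ℝ} (hw : w₀ + w₁ + w₂ = 1)
    (h01 : w₀ ≠ w₁) (h02 : w₀ ≠ w₂) (h12 : w₁ ≠ w₂)
    (q00 : e₀ + e₁ + e₂ + (o₀ + o₁ + o₂) = δ)
    (q10 : (e₀ - o₀) * (w₂ - w₁) + (e₁ - o₁) * (w₀ - w₂) + (e₂ - o₂) * (w₁ - w₀) = 0)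
    (q01 : (e₀ + o₀) * (3 * w₀ - 1) + (e₁ + o₁) * (3 * w₁ - 1) + (e₂ + o₂) * (3 * w₂ - 1) = 0)
    (q20 : (e₀ + o₀) * (w₂ - w₁) ^ 2 + (e₁ + o₁) * (w₀ - w₂) ^ 2 + (e₂ + o₂) * (w₁ - w₀) ^ 2 =
      δ / 6)
    (q11 : (e₀ - o₀) * ((w₂ - w₁) * (3 * w₀ - 1)) + (e₁ - o₁) * ((w₀ - w₂) * (3 * w₁ - 1)) +
      (e₂ - o₂) * ((w₁ - w₀) * (3 * w₂ - 1)) = 0)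
    (q02 : (e₀ + o₀) * (3 * w₀ - 1) ^ 2 + (e₁ + o₁) * (3 * w₁ - 1) ^ 2 +
      (e₂ + o₂) * (3 * w₂ - 1) ^ 2 = δ / 2) :
    (e₁ = e₀ ∧ e₂ = e₀) ∧ (o₁ = o₀ ∧ o₂ = o₀) ∧ e₀ + o₀ = δ / 3 := by
  have n01 := sub_ne_zero.mpr h01
  have n02 := sub_ne_zero.mpr h02
  have n12 := sub_ne_zero.mpr h12
  -- The moments odd in `x` are two equations for the differences `e i - o i`. Constants solve them,
  -- and for distinct `w i` nothing else does.
  have r : (e₀ - o₀) * ((w₂ - w₁) * w₀) + (e₁ - o₁) * ((w₀ - w₂) * w₁) +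
      (e₂ - o₂) * ((w₁ - w₀) * w₂) = 0 := by linear_combination (q11 + q10) / 3
  have t1 : e₁ - o₁ = e₀ - o₀ :=
    eq_of_mul_sub_eq_zero (mul_ne_zero n02 n12) (by linear_combination r - w₂ * q10)
  have t2 : e₂ - o₂ = e₀ - o₀ :=
    eq_of_mul_sub_eq_zero (mul_ne_zero n01 n12) (by linear_combination r - w₁ * q10)
  have s1 : (e₀ + o₀ - δ / 3) + (e₁ + o₁ - δ / 3) + (e₂ + o₂ - δ / 3) = 0 := by
    linear_combination q00
  have sw : (e₀ + o₀ - δ / 3) * w₀ + (e₁ + o₁ - δ / 3) * w₁ + (e₂ + o₂ - δ / 3) * w₂ = 0 := by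
    linear_combination (q01 + q00) / 3 - δ / 3 * hw
  have sw2' : (e₀ + o₀) * w₀ ^ 2 + (e₁ + o₁) * w₁ ^ 2 + (e₂ + o₂) * w₂ ^ 2 = δ / 6 := by
    linear_combination (q02 + 2 * q01 + q00) / 9
  obtain rfl : w₂ = 1 - w₀ - w₁ := by linarith
  -- The sums minus `δ / 3` are to be orthogonal to `1, w, w ^ 2`, hence zero by a Vandermonde
  -- argument. The last orthogonality needs the correct orbit radius, which `hδ` extracts by
  -- comparing the `x²` and `y²` moments; for `δ = 0` it is automatic.
  have sw2 : (e₀ + o₀ - δ / 3) * w₀ ^ 2 + (e₁ + o₁ - δ / 3) * w₁ ^ 2 +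
      (e₂ + o₂ - δ / 3) * (1 - w₀ - w₁) ^ 2 = 0 := by
    have hδ : δ * (1 - 4 * (w₀ * w₁ + (w₀ + w₁) * (1 - w₀ - w₁))) = 0 := by
      linear_combination q20 - (1 - 4 * (w₀ * w₁ + (w₀ + w₁) * (1 - w₀ - w₁))) * q00 -
        2 * ((q01 + q00) / 3) + 3 * sw2'
    linear_combination sw2' - hδ / 6
  have v0 : e₀ + o₀ = δ / 3 :=
    eq_of_mul_sub_eq_zero (mul_ne_zero n01 n02)
      (by linear_combination sw2 - (w₁ + (1 - w₀ - w₁)) * sw + w₁ * (1 - w₀ - w₁) * s1)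
  have v1 : e₁ + o₁ = δ / 3 :=
    eq_of_mul_sub_eq_zero (mul_ne_zero n01 n12)
      (by linear_combination -sw2 + (w₀ + (1 - w₀ - w₁)) * sw - w₀ * (1 - w₀ - w₁) * s1)
  have v2 : e₂ + o₂ = δ / 3 := by linarith
  exact ⟨⟨by linarith, by linarith⟩, ⟨by linarith, by linarith⟩, v0⟩

theorem orbit6_eq_orbit3 {z₁ z₂ z : ℝ} {c : Fin 3}
    (h : ∀ j, (![z₁, z₂, 1 - z₁ - z₂] : Fin 3 → ℝ) j = if j = c then 1 - 2 * z else z)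
    (σ : Equiv.Perm (Fin 3)) : orbit6 z₁ z₂ σ = orbit3 z (σ.symm c) := by
  rw [orbit6, orbit3]
  congr 1
  funext j
  rw [h]
  simp only [Equiv.eq_symm_apply]

theorem orbit6_quadrature_weights {z₁ z₂ : ℝ} (h12 : z₁ ≠ z₂) (h13 : z₁ ≠ 1 - z₁ - z₂)
    (h23 : z₂ ≠ 1 - z₁ - z₂) {N : Fin 2 → Fin 2 → Equiv.Perm (Fin 3) → ℝ}
    (hq : ∀ (c c' : Fin 2) (p : BiPoly), p ∈ PolySpace 2 → (if c = c' then 1 else 0) * triInt p =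
      ∑ σ, N c c' σ * MvPolynomial.eval (orbit6 z₁ z₂ σ) p)
    (c c' : Fin 2) (δ : ℝ) (hδ : δ = if c = c' then √3 else 0) :
    (N c c' (finRotate 3) = N c c' 1 ∧ N c c' (finRotate 3)⁻¹ = N c c' 1) ∧
      (N c c' (Equiv.swap 0 2) = N c c' (Equiv.swap 0 1) ∧
        N c c' (Equiv.swap 1 2) = N c c' (Equiv.swap 0 1)) ∧
      N c c' 1 + N c c' (Equiv.swap 0 1) = δ / 3 := by
  have hm : ∀ {i j : ℕ}, i + j ≤ 2 → scaledMonomial i j ∈ PolySpace 2 := scaledMonomial_mem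
  have hδ' : (if c = c' then (1 : ℝ) else 0) * √3 = δ := by rw [hδ]; split_ifs <;> simp
  have q00 := hq c c' _ (hm (i := 0) (j := 0) (by norm_num))
  have q10 := hq c c' _ (hm (i := 1) (j := 0) (by norm_num))
  have q01 := hq c c' _ (hm (i := 0) (j := 1) (by norm_num))
  have q20 := hq c c' _ (hm (i := 2) (j := 0) (by norm_num))
  have q11 := hq c c' _ (hm (i := 1) (j := 1) (by norm_num))
  have q02 := hq c c' _ (hm (i := 0) (j := 2) (by norm_num))
  simp only [sum_orbit6_scaledMonomial, triInt_scaledMonomial_00, triInt_scaledMonomial_10,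
    triInt_scaledMonomial_01, triInt_scaledMonomial_20, triInt_scaledMonomial_11,
    triInt_scaledMonomial_02, ← mul_assoc, hδ'] at q00 q10 q01 q20 q11 q02
  refine orbit6_weights (w₀ := 1 - z₁ - z₂) (w₁ := z₁) (w₂ := z₂) (by ring) h13.symm h23.symm h12
    ?_ ?_ ?_ ?_ ?_ ?_
  · linear_combination -q00
  · linear_combination -q10
  · linear_combination -q01
  · linear_combination -q20
  · linear_combination -q11
  · linear_combination -q02

-- If two barycentric coordinates agree, the points lie on a three-point orbit. Otherwise the weight
-- matrices are constant on the even and on the odd permutations. The radial cubic fields then give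
-- the even weight equal diagonal entries `√3 / 6` and opposite off-diagonal entries, so its
-- determinant is positive.
set_option maxHeartbeats 800000 in
theorem not_orthogonal_orbit6_two (z₁ z₂ : ℝ) (n : Equiv.Perm (Fin 3) → Pt) :
    ¬ OrthogonalToGradients 2 ⟨orbit6 z₁ z₂, n⟩ := by
  intro h
  rcases eq_or_ne z₁ z₂ with h12 | h12
  · refine not_orthogonal_of_pt_eq_orbit3 (z := z₁)
      (fun σ => ⟨_, orbit6_eq_orbit3 (c := 2) (fun j => ?_) σ⟩) h
    fin_cases j <;> simp [h12]
    ring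
  rcases eq_or_ne z₁ (1 - z₁ - z₂) with h13 | h13
  · refine not_orthogonal_of_pt_eq_orbit3 (z := z₁)
      (fun σ => ⟨_, orbit6_eq_orbit3 (c := 1) (fun j => ?_) σ⟩) h
    fin_cases j <;> simp <;> linarith
  rcases eq_or_ne z₂ (1 - z₁ - z₂) with h23 | h23
  · refine not_orthogonal_of_pt_eq_orbit3 (z := z₂)
      (fun σ => ⟨_, orbit6_eq_orbit3 (c := 0) (fun j => ?_) σ⟩) h
    fin_cases j <;> simp <;> linarith
  have h3 := sqrt_three_pos
  have hk := sqrt_three_mul_self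
  have hm : ∀ {i j : ℕ}, i + j ≤ 2 → scaledMonomial i j ∈ PolySpace 2 := scaledMonomial_mem
  obtain ⟨N, hdet, hN⟩ := h.exists_quadrature
  obtain ⟨hq, hr⟩ := quadrature_components hN
  have hQ := orbit6_quadrature_weights h12 h13 h23 hq
  obtain ⟨⟨e1, e2⟩, ⟨e3, e4⟩, e5⟩ := hQ 0 0 √3 (by simp)
  obtain ⟨⟨f1, f2⟩, ⟨f3, f4⟩, f5⟩ := hQ 0 1 0 (by simp)
  obtain ⟨⟨g1, g2⟩, ⟨g3, g4⟩, g5⟩ := hQ 1 0 0 (by simp)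
  obtain ⟨⟨k1, k2⟩, ⟨k3, k4⟩, k5⟩ := hQ 1 1 √3 (by simp)
  have e6 : N 0 0 (Equiv.swap 0 1) = √3 / 3 - N 0 0 1 := by linarith
  have f6 : N 0 1 (Equiv.swap 0 1) = -N 0 1 1 := by linarith
  have g6 : N 1 0 (Equiv.swap 0 1) = -N 1 0 1 := by linarith
  have k6 : N 1 1 (Equiv.swap 0 1) = √3 / 3 - N 1 1 1 := by linarith
  have r1 := fun c => hr c _ (hm (i := 2) (j := 0) (by norm_num))
  have r2 := fun c => hr c _ (hm (i := 0) (j := 2) (by norm_num))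
  have r3 := fun c => hr c _ (hm (i := 1) (j := 1) (by norm_num))
  simp only [X_zero_mul_scaledMonomial, X_one_mul_scaledMonomial, Nat.reduceAdd,
    MvPolynomial.smul_eval, ← mul_assoc, Finset.sum_add_distrib, sum_orbit6_scaledMonomial]
    at r1 r2 r3
  have r10 := r1 0
  have r11 := r1 1
  have r20 := r2 0
  have r21 := r2 1
  have r30 := r3 0
  have r31 := r3 1
  simp only [X_zero_mul_scaledMonomial, X_one_mul_scaledMonomial, Nat.reduceAdd, map_smul,
    smul_eq_mul, triInt_scaledMonomial_21, triInt_scaledMonomial_30, triInt_scaledMonomial_12,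
    triInt_scaledMonomial_03, e1, e2, e3, e4, e6, f1, f2, f3, f4, f6,
    g1, g2, g3, g4, g6, k1, k2, k3, k4, k6] at r10 r11 r20 r21 r30 r31
  -- The Vandermonde product of the barycentric coordinates, antisymmetric under permutations: it
  -- detects the difference between the even and odd weights in the cubic moments.
  set H : ℝ := (z₁ - z₂) * (z₂ - (1 - z₁ - z₂)) * (z₁ - (1 - z₁ - z₂)) with hH
  have hH0 : H ≠ 0 := mul_ne_zero (mul_ne_zero (sub_ne_zero.mpr h12) (sub_ne_zero.mpr h23))
    (sub_ne_zero.mpr h13)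
  have c1 : N 0 0 1 = √3 / 6 := by
    refine eq_of_mul_sub_eq_zero hH0 ?_
    linear_combination -(r10 - r20 / 3) / 12
  have c2 : N 1 1 1 = √3 / 6 := by
    refine eq_of_mul_sub_eq_zero (mul_ne_zero h3.ne' hH0) ?_
    linear_combination r31 / 6
  have c3 : N 0 1 1 = -N 1 0 1 := by
    refine eq_of_mul_sub_eq_zero hH0 ?_
    linear_combination -(r11 - r21 / 3 - 2 * √3 / 3 * r30) / 12 - H * N 0 1 1 / 3 * hk
  have d := hdet 1
  rw [c1, c2, c3] at d
  -- The singularity condition now reads `1 / 12 = -(N 1 0 1) ^ 2`.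
  nlinarith [mul_self_nonneg (N 1 0 1)]

/-! ## Unisolvence and the residual matrix -/

/-- Multiplication of a scalar polynomial by the position vector. -/
noncomputable def radialMap : BiPoly →ₗ[ℝ] Fin 2 → BiPoly :=
  LinearMap.pi fun i => LinearMap.mulLeft ℝ (MvPolynomial.X i)

/-- A parametrisation of `RT_k` by two polynomials and a homogeneous polynomial of degree `k`. -/
noncomputable def paramRT (k : ℕ) :
    ((Fin 2 → PolySpace k) × (Fin (k + 1) → ℝ)) →ₗ[ℝ] Fin 2 → BiPoly :=
  LinearMap.coprod (LinearMap.pi fun i => (PolySpace k).subtype ∘ₗ LinearMap.proj i)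
    (radialMap ∘ₗ Fintype.linearCombination ℝ fun a : Fin (k + 1) =>
      (MvPolynomial.X 0 ^ (a : ℕ) * MvPolynomial.X 1 ^ (k - a) : BiPoly))

/-- Monomials of degree less than `k`, multiplied by the position vector, already lie in `(P_k)²`,
so only the homogeneous part of degree `k` is new. -/
theorem RT_le_range_paramRT (k : ℕ) : RT k ≤ LinearMap.range (paramRT k) := by
  have hP : ∀ q : Fin 2 → PolySpace k,
      (fun i => (q i : BiPoly)) ∈ LinearMap.range (paramRT k) := by
    intro q
    refine ⟨(q, 0), ?_⟩
    ext1 i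
    simp [paramRT]
  have hr : PolySpace k ≤ (LinearMap.range (paramRT k)).comap radialMap := by
    intro r hr
    rw [MvPolynomial.as_sum r]
    refine Submodule.sum_mem _ fun s hs => ?_
    have h1 := MvPolynomial.le_totalDegree hs
    have h2 := (MvPolynomial.mem_restrictTotalDegree _ _ _).mp hr
    rw [Finsupp.sum_fintype _ _ (by simp), Fin.sum_univ_two] at h1
    rw [MvPolynomial.monomial_eq, Finsupp.prod_fintype _ _ (by simp), Fin.prod_univ_two,
      ← MvPolynomial.smul_eq_C_mul]
    refine Submodule.smul_mem _ _ ?_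
    rw [Submodule.mem_comap]
    rcases Nat.lt_or_ge (s 0 + s 1) k with h | h
    · have h0 := X_pow_mul_mem k (s 0 + 1) (s 1) (by omega)
      have h1 := X_pow_mul_mem k (s 0) (s 1 + 1) (by omega)
      convert hP ![⟨_, h0⟩, ⟨_, h1⟩] using 1
      ext1 i
      fin_cases i <;> simp [radialMap] <;> ring
    · refine ⟨(0, Pi.single ⟨s 0, by omega⟩ 1), ?_⟩
      have e : k - s 0 = s 1 := by omega
      simp [paramRT, Fintype.linearCombination_apply, Pi.single_apply, e]
  rintro _ ⟨q, r, rfl⟩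
  exact Submodule.add_mem _ (hP q) (hr r.2)

/-- An upper bound is enough: when a Lagrange basis exists, its linear independence supplies the
opposite inequality. -/
theorem finrank_RT_le (k : ℕ) :
    Module.finrank ℝ (RT k) ≤ 2 * Fintype.card (Mode k) + (k + 1) := by
  have hfin : FiniteDimensional ℝ (PolySpace k) := Module.Basis.finiteDimensional_of_finite (dubinerBasis k)
  refine (Submodule.finrank_mono (RT_le_range_paramRT k)).trans
    ((LinearMap.finrank_range_le _).trans ?_)
  rw [Module.finrank_prod, Module.finrank_pi_fintype, card_mode]
  simp

instance finiteDimensional_RT (k : ℕ) : FiniteDimensional ℝ (RT k) := by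
  have hfin : FiniteDimensional ℝ (PolySpace k) := Module.Basis.finiteDimensional_of_finite (dubinerBasis k)
  exact Submodule.finiteDimensional_of_le (RT_le_range_paramRT k)

theorem fluxDof_add {ι : Type} (S : FluxPoints ι) (F G : Fin 2 → BiPoly) :
    fluxDof S (F + G) = fluxDof S F + fluxDof S G := by
  ext s
  simp [fluxDof, mul_add, Finset.sum_add_distrib]

theorem fluxDof_smul {ι : Type} (S : FluxPoints ι) (c : ℝ) (F : Fin 2 → BiPoly) :
    fluxDof S (c • F) = c • fluxDof S F := by
  ext s
  simp [fluxDof, MvPolynomial.smul_eval]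
  ring

/-- The degrees of freedom as a linear map. -/
noncomputable def fluxDofMap {ι : Type} (k : ℕ) (S : FluxPoints ι) : RT k →ₗ[ℝ] ι → ℝ where
  toFun F := fluxDof S F
  map_add' F G := fluxDof_add S F G
  map_smul' c F := fluxDof_smul S c F

/-- The residual as a linear map. -/
noncomputable def fieldResidualMap (k : ℕ) (t : Fin (k + 1) → ℝ) (Q : Matrix (Mode k) (Mode k) ℝ) :
    RT k →ₗ[ℝ] Mode k → ℝ where
  toFun F := fieldResidual k t F Q
  map_add' F G := by
    simp only [fieldResidual, map_add, Finsupp.coe_add, Submodule.coe_add, fluxDof_add,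
      Matrix.mulVec_add, Matrix.mulVec_sub]
    abel
  map_smul' c F := by
    simp only [fieldResidual, map_smul, Finsupp.coe_smul, Submodule.coe_smul, fluxDof_smul,
      Matrix.mulVec_smul, Matrix.mulVec_sub, smul_add, smul_sub, RingHom.id_apply]

theorem IsSDBasis.fluxDof_bdry_inl {ι : Type} [DecidableEq ι] {k : ℕ} {t : Fin (k + 1) → ℝ}
    {S : FluxPoints ι} {h : BdryIdx k ⊕ ι → RT k} (hh : IsSDBasis k t S h) (j : BdryIdx k) :
    fluxDof (bdryFluxPoints k t) (h (Sum.inl j)) = Pi.single j 1 := by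
  ext s'
  rw [hh.1, Pi.single_apply]
  simp only [Sum.inl.injEq, eq_comm]

theorem IsSDBasis.residual_apply {ι : Type} [DecidableEq ι] {k : ℕ} {t : Fin (k + 1) → ℝ}
    {S : FluxPoints ι} {h : BdryIdx k ⊕ ι → RT k} (hh : IsSDBasis k t S h)
    (Q : Matrix (Mode k) (Mode k) ℝ) (j : BdryIdx k) (m : Mode k) :
    residual k t h Q m j = fieldResidual k t (h (Sum.inl j)) Q m := by
  rw [fieldResidual, hh.fluxDof_bdry_inl, Matrix.mulVec_single_one]
  simp only [residual, Matrix.add_apply, Matrix.mul_apply, Pi.add_apply, Matrix.mulVec, dotProduct]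
  rfl

/-- A field whose interior degrees of freedom vanish is the combination of the boundary Lagrange
functions given by its boundary degrees of freedom. -/
theorem IsSDBasis.eq_sum {ι : Type} [Fintype ι] [DecidableEq ι] {k : ℕ} {t : Fin (k + 1) → ℝ}
    {S : FluxPoints ι} {h : BdryIdx k ⊕ ι → RT k} (hh : IsSDBasis k t S h)
    (hcard : 2 * Fintype.card (Mode k) + (k + 1) ≤ 3 * (k + 1) + Fintype.card ι)
    {F : RT k} (hF : fluxDof S F = 0) :
    F = ∑ j, fluxDof (bdryFluxPoints k t) F j • h (Sum.inl j) := by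
  have hb : ∀ s, fluxDofMap k (bdryFluxPoints k t) (h s) =
      fun s' => if s = Sum.inl s' then 1 else 0 := fun s => funext (hh.1 s)
  have hi : ∀ s, fluxDofMap k S (h s) = fun s' => if s = Sum.inr s' then 1 else 0 :=
    fun s => funext (hh.2 s)
  have db : ∀ (c : BdryIdx k ⊕ ι → ℝ) j,
      fluxDofMap k (bdryFluxPoints k t) (∑ s, c s • h s) j = c (Sum.inl j) := by
    intro c j
    simp [map_sum, hb]
  have di : ∀ (c : BdryIdx k ⊕ ι → ℝ) j,
      fluxDofMap k S (∑ s, c s • h s) j = c (Sum.inr j) := by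
    intro c j
    simp [map_sum, hi]
  have hli : LinearIndependent ℝ h := by
    rw [Fintype.linearIndependent_iff]
    intro c hc s
    rcases s with j | j
    · rw [← db c j, hc, map_zero]; rfl
    · rw [← di c j, hc, map_zero]; rfl
  have hc : Fintype.card (BdryIdx k ⊕ ι) = 3 * (k + 1) + Fintype.card ι := by simp
  -- Nodal duality gives independence; the assumed count of degrees of freedom turns this into
  -- spanning.
  have hspan := hli.span_eq_top_of_card_eq_finrank' (le_antisymm hli.fintype_card_le_finrank
    ((finrank_RT_le k).trans (hcard.trans hc.ge)))
  have hFm : F ∈ Submodule.span ℝ (Set.range h) := by rw [hspan]; trivial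
  obtain ⟨c, hc⟩ := (Submodule.mem_span_range_iff_exists_fun ℝ).mp hFm
  have h1 : ∀ j, c (Sum.inr j) = 0 := by
    intro j
    rw [← di c j, hc]
    exact congrFun hF j
  have h2 : ∀ j, fluxDof (bdryFluxPoints k t) F j = c (Sum.inl j) := by
    intro j
    rw [← db c j, hc]
    rfl
  simp only [h2]
  rw [← hc, Fintype.sum_sum_type]
  simp [h1]

theorem residual_eq {ι : Type} {k : ℕ} (t : Fin (k + 1) → ℝ) (h : BdryIdx k ⊕ ι → RT k)
    (Q : Matrix (Mode k) (Mode k) ℝ) :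
    residual k t h Q = (massMatrix k + Q) * sdCorrection k h -
      (bdryInterp k t)ᵀ * surfaceMass k t := by
  rw [residual, Matrix.mul_sub, massMatrix_mul_dgCorrection, Matrix.add_mul]
  abel

theorem ExtendedRange.isUnit_add {k : ℕ} {Q : Matrix (Mode k) (Mode k) ℝ}
    (hQ : ExtendedRange k Q) : IsUnit (massMatrix k + Q).det := by
  rw [← Matrix.isUnit_iff_isUnit_det, ← Matrix.mulVec_injective_iff_isUnit]
  intro c d h
  by_contra hne
  have h1 := hQ.pos _ (sub_ne_zero.mpr hne)
  rw [Matrix.mulVec_sub, sub_eq_zero.mpr h, dotProduct_zero] at h1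
  exact lt_irrefl _ h1

/-- By the definition of `C_DG`, the residual is `(M + Q) C_SD - L_∂ᵀ W_∂`, and `M + Q` is
invertible because it is positive definite. -/
theorem ExtendedRange.residual_eq_zero_iff {ι : Type} {k : ℕ} {Q : Matrix (Mode k) (Mode k) ℝ}
    (hQ : ExtendedRange k Q) (t : Fin (k + 1) → ℝ) (h : BdryIdx k ⊕ ι → RT k) :
    residual k t h Q = 0 ↔ sdCorrection k h = frCorrection k t Q := by
  rw [residual_eq, sub_eq_zero, frCorrection, Matrix.mul_assoc]
  constructor
  · intro hh
    rw [← hh, ← Matrix.mul_assoc, Matrix.nonsing_inv_mul _ hQ.isUnit_add, Matrix.one_mul]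
  · intro hh
    rw [hh, ← Matrix.mul_assoc, Matrix.mul_nonsing_inv _ hQ.isUnit_add, Matrix.one_mul]

/-- The residual is linear in the field, and the columns of `A` are the residuals of the boundary
basis functions. If they all vanished, so would the residual of the offending field, which these
functions span. In the applications the count in `hcard` is an equality: 15 for `k = 2` with six
interior degrees of freedom, 24 for `k = 3` with twelve. -/
theorem noStableSD_of_not_orthogonal {ι : Type} [Fintype ι] [DecidableEq ι] {k : ℕ}
    {S : FluxPoints ι} (hS : ¬ OrthogonalToGradients k S)
    (hcard : 2 * Fintype.card (Mode k) + (k + 1) ≤ 3 * (k + 1) + Fintype.card ι) :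
    NoStableSD k S := by
  intro t ht Q hQ
  obtain ⟨F, hF, hres⟩ := hQ.exists_fieldResidual_ne_zero hS ht
  refine ⟨fun h hh => ?_, F, hF, hres⟩
  have hne : residual k t h Q ≠ 0 := by
    intro h0
    apply hres
    have h1 : ∀ j, fieldResidualMap k t Q (h (Sum.inl j)) = 0 := by
      intro j
      ext m
      exact (hh.residual_apply Q j m).symm.trans (by rw [h0]; rfl)
    change fieldResidualMap k t Q F = 0
    rw [hh.eq_sum hcard hF, map_sum]
    exact Finset.sum_eq_zero fun j _ => by rw [map_smul, h1, smul_zero]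
  exact ⟨hne, fun h1 => hne ((hQ.residual_eq_zero_iff t h).mpr h1)⟩

theorem noStableSD_orbit3 (z : ℝ) : NoStableSD 2 (collocated (orbit3 z)) :=
  noStableSD_of_not_orthogonal (not_orthogonal_of_pt_eq_orbit3 fun s => ⟨s.1, rfl⟩) (by decide)

theorem noStableSD_two_orbit3_two (z : Fin 2 → ℝ) (n : Fin 2 × Fin 3 → Pt) :
    NoStableSD 2 ⟨fun s => orbit3 (z s.1) s.2, n⟩ :=
  noStableSD_of_not_orthogonal (not_orthogonal_two_orbit3_two z n) (by decide)

theorem noStableSD_orbit6_two (z₁ z₂ : ℝ) (n : Equiv.Perm (Fin 3) → Pt) :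
    NoStableSD 2 ⟨orbit6 z₁ z₂, n⟩ :=
  noStableSD_of_not_orthogonal (not_orthogonal_orbit6_two z₁ z₂ n) (by decide)

theorem noStableSD_two_orbit3_three (z : Fin 2 → ℝ) :
    NoStableSD 3 (collocated fun s : Fin 2 × Fin 3 => orbit3 (z s.1) s.2) :=
  noStableSD_of_not_orthogonal (not_orthogonal_two_orbit3 z) (by decide)

theorem noStableSD_orbit6_three (z₁ z₂ : ℝ) : NoStableSD 3 (collocated (orbit6 z₁ z₂)) :=
  noStableSD_of_not_orthogonal (not_orthogonal_orbit6_three z₁ z₂) (by decide)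

/-! ## Degree one: the admissible matrices -/

theorem dubiner_zero_zero : dubiner 0 0 = MvPolynomial.C (1 / (3 : ℝ) ^ (1 / 4 : ℝ)) := by
  have h1 : jacobiNorm 0 0 * jacobiNorm 1 0 = 1 / 2 := by
    have : ((2 : ℝ) * (0 : ℕ) + (0 : ℕ) + 1) / 2 ^ (0 + 1) = 1 / 2 := by norm_num
    have h : ((2 : ℝ) * (0 : ℕ) + (1 : ℕ) + 1) / 2 ^ (1 + 1) = 1 / 2 := by norm_num
    rw [jacobiNorm, jacobiNorm, this, h, Real.mul_self_sqrt (by norm_num)]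
  have hL : legendreHom 0 = 1 := by simp [legendreHom]
  have hJ : jacobi 1 0 = 1 := by simp [jacobi]
  rw [dubiner, hL, mul_zero, zero_add, hJ, map_one, mul_one, mul_one, mul_assoc, h1]
  congr 1
  ring

theorem dubiner_zero_one :
    dubiner 0 1 = MvPolynomial.C (√6 / (3 : ℝ) ^ (1 / 4 : ℝ)) * MvPolynomial.X 1 := by
  have h1 : jacobiNorm 0 0 = √(1 / 2) := by
    rw [jacobiNorm]; norm_num
  have h2 : jacobiNorm 1 1 = 1 := by
    rw [jacobiNorm]; norm_num
  have hL : legendreHom 0 = 1 := by simp [legendreHom]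
  have hJ : jacobi 1 1 = Polynomial.C (3 / 2) * Polynomial.X + Polynomial.C (1 / 2) := by
    refine Polynomial.funext fun x => ?_
    simp [jacobi, Finset.sum_range_succ]
    ring
  have h6 : √6 = 2 * √(1 / 2) * √3 := by
    rw [show (2 : ℝ) = √4 by rw [show (4 : ℝ) = 2 ^ 2 by norm_num, Real.sqrt_sq (by norm_num)],
      ← Real.sqrt_mul (by norm_num), ← Real.sqrt_mul (by norm_num)]
    norm_num
  have hb : Polynomial.aeval collapsedB (jacobi 1 1) =
      MvPolynomial.C √3 * MvPolynomial.X 1 := by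
    rw [hJ, map_add, map_mul, Polynomial.aeval_C, Polynomial.aeval_X, Polynomial.aeval_C,
      MvPolynomial.algebraMap_eq, collapsedB, mul_sub, ← mul_assoc, ← map_mul, ← map_mul,
      show (3 / 2 : ℝ) * (2 * √3 / 3) = √3 by ring, show (3 / 2 : ℝ) * (1 / 3) = 1 / 2 by norm_num]
    ring
  rw [dubiner, hL, mul_zero, zero_add, hb, one_mul, h1, h2, h6, ← mul_assoc, ← map_mul]
  congr 2
  ring

theorem dubiner_one_zero :
    dubiner 1 0 = MvPolynomial.C (√6 / (3 : ℝ) ^ (1 / 4 : ℝ)) * MvPolynomial.X 0 := by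
  have h1 : jacobiNorm 0 1 = √6 / 2 := by
    have : ((2 : ℝ) * (1 : ℕ) + (0 : ℕ) + 1) / 2 ^ (0 + 1) = 6 / 2 ^ 2 := by norm_num
    rw [jacobiNorm, this, Real.sqrt_div (by norm_num), Real.sqrt_sq (by norm_num)]
  have h2 : jacobiNorm 3 0 = 1 / 2 := by
    have : ((2 : ℝ) * (0 : ℕ) + (3 : ℕ) + 1) / 2 ^ (3 + 1) = (1 / 2) ^ 2 := by norm_num
    rw [jacobiNorm, this, Real.sqrt_sq (by norm_num)]
  have hL : legendreHom 1 = MvPolynomial.C 2 * MvPolynomial.X 0 := by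
    simp [legendreHom, Finset.sum_range_succ, map_ofNat MvPolynomial.C]
    ring
  have hJ : jacobi 3 0 = 1 := by simp [jacobi]
  rw [dubiner, hL, mul_one, show 2 + 1 = 3 from rfl, hJ, map_one, mul_one, h1, h2, ← mul_assoc,
    ← map_mul]
  congr 2
  ring

/-- The constant mode of degree one. -/
def constMode : Mode 1 := ⟨(0, 0), by decide⟩

/-- The mode of degree one proportional to `x_i`. -/
def linearMode (i : Fin 2) : Mode 1 := if i = 0 then ⟨(1, 0), by decide⟩ else ⟨(0, 1), by decide⟩

theorem mode_one_cases (m : Mode 1) : m = constMode ∨ ∃ i, m = linearMode i := by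
  revert m
  decide

theorem sum_mode_one {A : Type*} [AddCommMonoid A] (f : Mode 1 → A) :
    ∑ m, f m = f constMode + f (linearMode 0) + f (linearMode 1) := by
  rw [show (Finset.univ : Finset (Mode 1)) = {constMode, linearMode 0, linearMode 1} by decide,
    Finset.sum_insert (by decide), Finset.sum_insert (by decide), Finset.sum_singleton, add_assoc]

theorem constMode_ne_linearMode (i : Fin 2) : constMode ≠ linearMode i := by
  revert i
  decide

theorem linearMode_injective : Function.Injective linearMode := by decide

/-- The normalising factor of the constant mode. -/
noncomputable def constFactor : ℝ := 1 / (3 : ℝ) ^ (1 / 4 : ℝ)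

/-- The normalising factor of the linear modes. -/
noncomputable def linearFactor : ℝ := √6 / (3 : ℝ) ^ (1 / 4 : ℝ)

theorem constFactor_pos : 0 < constFactor := by unfold constFactor; positivity

theorem linearFactor_pos : 0 < linearFactor := by unfold linearFactor; positivity

theorem quarter_rpow_sq : ((3 : ℝ) ^ (1 / 4 : ℝ)) ^ 2 = √3 := by
  rw [← Real.rpow_natCast, ← Real.rpow_mul (by norm_num), Real.sqrt_eq_rpow]
  norm_num

theorem constFactor_sq : constFactor ^ 2 * √3 = 1 := by
  have := sqrt_three_pos
  rw [constFactor, div_pow, quarter_rpow_sq]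
  field_simp

theorem linearFactor_sq : linearFactor ^ 2 * (√3 / 6) = 1 := by
  have := sqrt_three_pos
  rw [linearFactor, div_pow, quarter_rpow_sq, Real.sq_sqrt (by norm_num)]
  field_simp

theorem dubinerBasis_constMode :
    (dubinerBasis 1 constMode : BiPoly) = MvPolynomial.C constFactor := by
  rw [dubinerBasis_apply]
  exact dubiner_zero_zero

theorem dubinerBasis_linearMode (i : Fin 2) :
    (dubinerBasis 1 (linearMode i) : BiPoly) = linearFactor • MvPolynomial.X i := by
  rw [dubinerBasis_apply, MvPolynomial.smul_eq_C_mul]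
  fin_cases i
  · exact dubiner_one_zero
  · exact dubiner_zero_one

theorem triInt_one : triInt 1 = √3 := by
  have h : (1 : BiPoly) = scaledMonomial 0 0 := by simp [scaledMonomial]
  rw [h, triInt_scaledMonomial_00]

theorem X_zero_eq_scaledMonomial : (MvPolynomial.X 0 : BiPoly) = scaledMonomial 1 0 := by
  simp [scaledMonomial]

theorem X_one_eq_scaledMonomial : (MvPolynomial.X 1 : BiPoly) = (√3 / 3) • scaledMonomial 0 1 := by
  rw [← zero_add 1, ← X_one_mul_scaledMonomial]
  simp [scaledMonomial]

theorem triInt_X (i : Fin 2) : triInt (MvPolynomial.X i) = 0 := by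
  fin_cases i
  · simp [X_zero_eq_scaledMonomial, triInt_scaledMonomial_10]
  · simp [X_one_eq_scaledMonomial, triInt_scaledMonomial_01]

theorem triInt_X_mul_X (i j : Fin 2) :
    triInt (MvPolynomial.X i * MvPolynomial.X j) = if i = j then √3 / 6 else 0 := by
  have h00 : triInt (MvPolynomial.X 0 * MvPolynomial.X 0) = √3 / 6 := by
    have e : (MvPolynomial.X 0 * MvPolynomial.X 0 : BiPoly) = scaledMonomial 2 0 := by
      simp only [scaledMonomial]
      ring
    rw [e, triInt_scaledMonomial_20]
    ring
  have h01 : triInt (MvPolynomial.X 0 * MvPolynomial.X 1) = 0 := by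
    rw [X_one_eq_scaledMonomial, mul_smul_comm, X_zero_mul_scaledMonomial, map_smul,
      triInt_scaledMonomial_11, smul_zero]
  have h11 : triInt (MvPolynomial.X 1 * MvPolynomial.X 1) = √3 / 6 := by
    have e : (MvPolynomial.X 1 * MvPolynomial.X 1 : BiPoly) =
        (√3 / 3 * (√3 / 3)) • scaledMonomial 0 2 := by
      conv_lhs => rw [X_one_eq_scaledMonomial, mul_smul_comm, smul_mul_assoc]
      rw [smul_smul]
      congr 1
      simp only [scaledMonomial]
      ring
    rw [e, map_smul, triInt_scaledMonomial_02, smul_eq_mul]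
    linear_combination √3 / 18 * sqrt_three_mul_self
  fin_cases i <;> fin_cases j
  · simpa using h00
  · simpa using h01
  · simpa [mul_comm] using h01
  · simpa using h11

theorem massMatrix_one : massMatrix 1 = 1 := by
  have h0 := constFactor_sq
  have h1 := linearFactor_sq
  ext m n
  rw [massMatrix_apply]
  rcases mode_one_cases m with rfl | ⟨i, rfl⟩ <;> rcases mode_one_cases n with rfl | ⟨j, rfl⟩
  · rw [dubinerBasis_constMode, ← MvPolynomial.smul_eq_C_mul, map_smul, ← mul_one (MvPolynomial.C _),
      ← MvPolynomial.smul_eq_C_mul, map_smul, triInt_one, Matrix.one_apply_eq]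
    simp only [smul_eq_mul]
    linear_combination h0
  · rw [dubinerBasis_constMode, dubinerBasis_linearMode, ← MvPolynomial.smul_eq_C_mul, map_smul,
      map_smul, triInt_X, Matrix.one_apply_ne (constMode_ne_linearMode j)]
    simp
  · rw [dubinerBasis_constMode, dubinerBasis_linearMode, mul_comm, ← MvPolynomial.smul_eq_C_mul,
      map_smul, map_smul, triInt_X, Matrix.one_apply_ne (constMode_ne_linearMode i).symm]
    simp
  · rw [dubinerBasis_linearMode, dubinerBasis_linearMode, smul_mul_smul_comm, map_smul,
      triInt_X_mul_X, Matrix.one_apply]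
    simp only [linearMode_injective.eq_iff, smul_eq_mul]
    split_ifs
    · linear_combination h1
    · simp

theorem linearQ_eq (q₀ : ℝ) :
    TriFR.linearQ q₀ = Matrix.diagonal fun m => if m = constMode then 0 else q₀ := by
  unfold TriFR.linearQ
  congr 1
  funext m
  have h : ((m.1.1 : ℕ) + (m.1.2 : ℕ) = 0) ↔ m = constMode := by
    revert m
    decide
  simp only [h]

theorem substMatrix_one_constMode (R : Matrix (Fin 2) (Fin 2) ℝ) (m : Mode 1) :
    substMatrix 1 R m constMode = if m = constMode then 1 else 0 := by
  have h : substMap 1 R (dubinerBasis 1 constMode) = dubinerBasis 1 constMode := by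
    apply Subtype.ext
    change substHom R (dubinerBasis 1 constMode : BiPoly) = _
    rw [dubinerBasis_constMode]
    exact MvPolynomial.aeval_C _ _
  rw [substMatrix, LinearMap.toMatrix_apply, h, Module.Basis.repr_self, Finsupp.single_apply]
  simp only [eq_comm]

theorem substMap_one_linearMode (R : Matrix (Fin 2) (Fin 2) ℝ) (i : Fin 2) :
    substMap 1 R (dubinerBasis 1 (linearMode i)) =
      ∑ j, R i j • dubinerBasis 1 (linearMode j) := by
  apply Subtype.ext
  change substHom R (dubinerBasis 1 (linearMode i) : BiPoly) = _
  rw [dubinerBasis_linearMode, map_smul, Submodule.coe_sum]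
  simp only [Submodule.coe_smul, dubinerBasis_linearMode, substHom, MvPolynomial.aeval_X]
  rw [Finset.smul_sum]
  refine Finset.sum_congr rfl fun j _ => ?_
  rw [smul_comm, MvPolynomial.smul_eq_C_mul (MvPolynomial.X j) (R i j)]

theorem substMatrix_one_constMode_linearMode (R : Matrix (Fin 2) (Fin 2) ℝ) (i : Fin 2) :
    substMatrix 1 R constMode (linearMode i) = 0 := by
  rw [substMatrix, LinearMap.toMatrix_apply, substMap_one_linearMode]
  simp [(constMode_ne_linearMode _).symm]

theorem substMatrix_one_linearMode (R : Matrix (Fin 2) (Fin 2) ℝ) (i j : Fin 2) :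
    substMatrix 1 R (linearMode j) (linearMode i) = R i j := by
  rw [substMatrix, LinearMap.toMatrix_apply, substMap_one_linearMode]
  simp [Finsupp.single_apply, linearMode_injective.eq_iff]
  fin_cases j <;> simp

/-- Derivatives in degree one are constants. Since `diag(0, q₀, q₀)` kills the constant mode, its
product with a differentiation matrix is zero and skewness becomes trivial. -/
theorem diffMatrix_one_linearMode (i j : Fin 2) (m : Mode 1) :
    diffMatrix 1 i (linearMode j) m = 0 := by
  have hc : ∃ c : ℝ, derivMap 1 i (dubinerBasis 1 m) = c • dubinerBasis 1 constMode := by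
    have h0 := constFactor_pos.ne'
    rcases mode_one_cases m with rfl | ⟨l, rfl⟩
    · refine ⟨0, Subtype.ext ?_⟩
      rw [coe_derivMap, dubinerBasis_constMode]
      simp
    · refine ⟨(linearFactor * if l = i then 1 else 0) / constFactor, Subtype.ext ?_⟩
      rw [coe_derivMap, dubinerBasis_linearMode, Derivation.map_smul, Submodule.coe_smul,
        dubinerBasis_constMode, MvPolynomial.smul_eq_C_mul, MvPolynomial.smul_eq_C_mul, ← map_mul,
        div_mul_cancel₀ _ h0, map_mul]
      congr 1
      rw [MvPolynomial.pderiv_X, Pi.single_apply]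
      split_ifs <;> simp
  obtain ⟨c, hc⟩ := hc
  rw [diffMatrix, LinearMap.toMatrix_apply, hc, map_smul, Module.Basis.repr_self]
  simp [constMode_ne_linearMode]

theorem extendedRange_linearQ {q₀ : ℝ} (hq : -1 < q₀) : ExtendedRange 1 (TriFR.linearQ q₀) := by
  have hskew : ∀ i, TriFR.linearQ q₀ * diffMatrix 1 i = 0 := by
    intro i
    ext m n
    rw [linearQ_eq, Matrix.diagonal_mul]
    rcases mode_one_cases m with rfl | ⟨j, rfl⟩
    · simp
    · simp [diffMatrix_one_linearMode]
  have hcomm : ∀ R, substMatrix 1 R * TriFR.linearQ q₀ = TriFR.linearQ q₀ * substMatrix 1 R := by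
    intro R
    ext m n
    rw [linearQ_eq, Matrix.diagonal_mul, Matrix.mul_diagonal]
    rcases mode_one_cases m with rfl | ⟨i, rfl⟩ <;> rcases mode_one_cases n with rfl | ⟨j, rfl⟩
    · simp
    · simp [substMatrix_one_constMode_linearMode]
    · simp [substMatrix_one_constMode, (constMode_ne_linearMode _).symm]
    · simp [(constMode_ne_linearMode _).symm, mul_comm]
  refine ⟨?_, fun i => ?_, fun c hc => ?_, hcomm _, hcomm _⟩
  · rw [linearQ_eq, Matrix.diagonal_transpose, sub_self]
  · rw [← Matrix.transpose_mul, hskew, Matrix.transpose_zero, add_zero]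
  · rw [massMatrix_one, linearQ_eq, ← Matrix.diagonal_one, Matrix.diagonal_add]
    simp only [dotProduct, Matrix.mulVec_diagonal]
    obtain ⟨m, hm⟩ := Function.ne_iff.mp hc
    refine Finset.sum_pos' (fun m _ => ?_) ⟨m, Finset.mem_univ _, ?_⟩
    · have : 0 ≤ 1 + if m = constMode then 0 else q₀ := by split_ifs <;> linarith
      nlinarith [mul_nonneg this (mul_self_nonneg (c m))]
    · have h1 : 0 < 1 + if m = constMode then 0 else q₀ := by split_ifs <;> linarith
      have h2 : 0 < c m * c m := mul_self_pos.mpr hm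
      nlinarith [mul_pos h1 h2]

theorem modalForm_dubinerBasis {k : ℕ} (Q : Matrix (Mode k) (Mode k) ℝ) (m n : Mode k) :
    modalForm k Q (dubinerBasis k m) (dubinerBasis k n) = Q m n := by
  rw [modalForm_apply, Module.Basis.repr_self, Module.Basis.repr_self,
    Finsupp.single_eq_pi_single, Finsupp.single_eq_pi_single]
  simp

/-- The form annihilates constants. On linear polynomials the symmetry group of the triangle acts
irreducibly, so only a scalar remains, and positivity of `1 + q₀` is the last condition. -/
theorem extendedRange_one_iff (Q : Matrix (Mode 1) (Mode 1) ℝ) :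
    ExtendedRange 1 Q ↔ ∃ q₀ : ℝ, -1 < q₀ ∧ Q = TriFR.linearQ q₀ := by
  constructor
  · intro hQ
    have hsym : ∀ m n, Q m n = Q n m := by
      intro m n
      rw [← modalForm_dubinerBasis Q, hQ.form_symm, modalForm_dubinerBasis]
    have h0 : ∀ n, Q constMode n = 0 := by
      intro n
      rw [← modalForm_dubinerBasis Q]
      refine hQ.form_eq_zero ?_ _
      rw [dubinerBasis_constMode, MvPolynomial.totalDegree_C]
      exact one_pos
    -- One entry of each commutation relation suffices: the reflection kills the off-diagonal entry,
    -- and the rotation then equates the diagonal ones.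
    have hrefl := congrFun (congrFun hQ.reflection (linearMode 0)) (linearMode 1)
    have hrot := congrFun (congrFun hQ.rotation (linearMode 0)) (linearMode 1)
    simp only [Matrix.mul_apply, sum_mode_one, substMatrix_one_constMode_linearMode,
      substMatrix_one_linearMode, h0, hsym _ constMode, axisReflection, faceRotation] at hrefl hrot
    simp at hrefl hrot
    have h01 : Q (linearMode 0) (linearMode 1) = 0 := by linarith
    have h3 := sqrt_three_pos
    rw [h01] at hrot
    have h11 : Q (linearMode 1) (linearMode 1) = Q (linearMode 0) (linearMode 0) := by
      refine eq_of_mul_sub_eq_zero h3.ne' ?_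
      linarith
    refine ⟨Q (linearMode 0) (linearMode 0), ?_, ?_⟩
    · have hpos := hQ.pos (Pi.single (linearMode 0) 1) (by simp)
      rw [massMatrix_one] at hpos
      simp at hpos
      linarith
    · ext m n
      rw [linearQ_eq]
      rcases mode_one_cases m with rfl | ⟨i, rfl⟩ <;> rcases mode_one_cases n with rfl | ⟨j, rfl⟩
      · simp [h0]
      · simp [h0, constMode_ne_linearMode]
      · simp [h0, hsym _ constMode, (constMode_ne_linearMode _).symm]
      · fin_cases i <;> fin_cases j <;>
          simp [linearMode_injective.eq_iff,
            (constMode_ne_linearMode _).symm, h01, h11, hsym (linearMode 1) (linearMode 0)]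
  · rintro ⟨q₀, hq, rfl⟩
    exact extendedRange_linearQ hq

/-! ## Degree one: the spectral difference scheme -/

theorem centroid_eq : centroid () = 0 := by
  funext i
  fin_cases i <;> simp [centroid, baryPoint, vertex, Fin.sum_univ_three]
  ring

theorem exists_eq_of_mem_one {p : BiPoly} (hp : p ∈ PolySpace 1) :
    ∃ a : ℝ, ∃ b : Fin 2 → ℝ, p = MvPolynomial.C a + ∑ i, b i • MvPolynomial.X i := by
  have h := coe_eq_sum_repr (⟨p, hp⟩ : PolySpace 1)
  set r := (dubinerBasis 1).repr ⟨p, hp⟩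
  rw [sum_mode_one, dubinerBasis_constMode, dubinerBasis_linearMode, dubinerBasis_linearMode] at h
  refine ⟨r constMode * constFactor, fun i => r (linearMode i) * linearFactor, ?_⟩
  change p = _ at h
  rw [h, Fin.sum_univ_two, map_mul, MvPolynomial.smul_eq_C_mul, smul_smul, smul_smul]
  ring

/-- A field of `RT_1` vanishing at the centroid is a linear part plus the position vector times a
linear form `ℓ`. The linear part contributes nothing to either side, since the coordinates have mean
zero; the quadratic part has divergence `3 ℓ`. -/
theorem triInt_X_mul_divMap {F : Fin 2 → BiPoly} (hF : F ∈ RT 1)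
    (h0 : ∀ i, MvPolynomial.eval 0 (F i) = 0) (i : Fin 2) :
    triInt (MvPolynomial.X i * divMap F) = 3 * triInt (F i) := by
  obtain ⟨q, r, rfl⟩ := hF
  choose a b hq using fun i => exists_eq_of_mem_one (q i).2
  obtain ⟨c, d, hr⟩ := exists_eq_of_mem_one r.2
  have ha : ∀ i, a i = 0 := by
    intro i
    simpa [hq, MvPolynomial.smul_eval] using h0 i
  have hF : ∀ i, (q i : BiPoly) + MvPolynomial.X i * (r : BiPoly) =
      b i 0 • MvPolynomial.X 0 + b i 1 • MvPolynomial.X 1 + c • MvPolynomial.X i +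
        d 0 • (MvPolynomial.X i * MvPolynomial.X 0) +
        d 1 • (MvPolynomial.X i * MvPolynomial.X 1) := by
    intro i
    rw [hq, hr, ha]
    simp only [Fin.sum_univ_two, MvPolynomial.smul_eq_C_mul, map_zero]
    ring
  have hdiv : divMap (fun i => (q i : BiPoly) + MvPolynomial.X i * (r : BiPoly)) =
      (b 0 0 + b 1 1 + 2 * c) • (1 : BiPoly) + (3 * d 0) • MvPolynomial.X 0 +
        (3 * d 1) • MvPolynomial.X 1 := by
    simp only [hF]
    simp [divMap, Fin.sum_univ_two, Derivation.leibniz, MvPolynomial.pderiv_X,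
      MvPolynomial.smul_eq_C_mul, map_ofNat MvPolynomial.C]
    ring
  beta_reduce
  rw [hdiv, hF]
  simp only [mul_add, mul_smul_comm, mul_one, map_add, map_smul, triInt_X, triInt_X_mul_X,
    smul_eq_mul]
  fin_cases i <;> simp <;> ring

theorem fieldResidual_constMode {t : Fin 2 → ℝ} (ht : Function.Injective t) (q₀ : ℝ) (F : RT 1) :
    fieldResidual 1 t F (TriFR.linearQ q₀) constMode = 0 := by
  have h := dotProduct_fieldResidual ht (TriFR.linearQ q₀) F (dubinerBasis 1 constMode)
  rw [dubinerBasis_constMode, modalForm_apply, Module.Basis.repr_self,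
    Finsupp.single_eq_pi_single, single_dotProduct, single_dotProduct, linearQ_eq,
    Matrix.mulVec_diagonal] at h
  rw [linearQ_eq]
  simpa using h

theorem repr_linearMode (u : PolySpace 1) (i : Fin 2) :
    (dubinerBasis 1).repr u (linearMode i) =
      linearFactor * triInt (MvPolynomial.X i * (u : BiPoly)) := by
  have h := dotProduct_massMatrix_mulVec (dubinerBasis 1 (linearMode i)) u
  rw [massMatrix_one, Matrix.one_mulVec, Module.Basis.repr_self, Finsupp.single_eq_pi_single,
    single_dotProduct, dubinerBasis_linearMode, smul_mul_assoc, map_smul] at h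
  simpa using h

/-- The `Q` term gives `q₀ ∫ x_i div F = 3 q₀ ∫ F_i`, and the gradient term subtracts `∫ F_i`; this
is the origin of `1/3`. -/
theorem fieldResidual_linearMode {t : Fin 2 → ℝ} (ht : Function.Injective t) (q₀ : ℝ) {F : RT 1}
    (h0 : ∀ i, MvPolynomial.eval 0 ((F : Fin 2 → BiPoly) i) = 0) (i : Fin 2) :
    fieldResidual 1 t F (TriFR.linearQ q₀) (linearMode i) =
      linearFactor * (3 * q₀ - 1) * triInt ((F : Fin 2 → BiPoly) i) := by
  have h := dotProduct_fieldResidual ht (TriFR.linearQ q₀) F (dubinerBasis 1 (linearMode i))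
  have hd : ((divRT 1 F : PolySpace 1) : BiPoly) = divMap F := rfl
  have hs : ∑ j, triInt (MvPolynomial.pderiv j (linearFactor • MvPolynomial.X i : BiPoly) *
      (F : Fin 2 → BiPoly) j) = linearFactor * triInt ((F : Fin 2 → BiPoly) i) := by
    rw [Finset.sum_eq_single i]
    · simp
    · intro j _ hj
      simp [MvPolynomial.pderiv_X_of_ne hj.symm]
    · simp
  rw [dubinerBasis_linearMode, modalForm_apply, Module.Basis.repr_self,
    Finsupp.single_eq_pi_single, single_dotProduct, single_dotProduct, hs, linearQ_eq,
    Matrix.mulVec_diagonal, repr_linearMode, hd, triInt_X_mul_divMap F.2 h0,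
    if_neg (constMode_ne_linearMode i).symm] at h
  rw [linearQ_eq]
  linear_combination h

/-! ### Construction of the Lagrange basis in degree one -/

/-- The field `p (x - v)` with `v` the vertex opposite to the edge `e`; its normal component
vanishes on the other two edges. -/
noncomputable def vertexField (e : Fin 3) : PolySpace 1 →ₗ[ℝ] RT 1 where
  toFun p := ⟨fun i => (p : BiPoly) * (MvPolynomial.X i - MvPolynomial.C (vertex (e + 2) i)),
    fun i => -vertex (e + 2) i • p, p, by
      funext i
      simp [MvPolynomial.smul_eq_C_mul]
      ring⟩
  map_add' p q := Subtype.ext <| by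
    funext i
    simp [add_mul]
  map_smul' c p := Subtype.ext <| by
    funext i
    simp

theorem sum_edgeNormal_mul_vertex (e e' : Fin 3) :
    ∑ i, edgeNormal e' i * vertex (e + 2) i = if e' = e then -(2 * √3 / 3) else √3 / 3 := by
  have h := sqrt_three_inv
  rw [Fin.sum_univ_two]
  fin_cases e <;> fin_cases e' <;>
    simp [edgeNormal_zero, edgeNormal_one, edgeNormal_two, vertex, div_eq_mul_inv, h] <;> ring

theorem fluxDof_vertexField (t : Fin 2 → ℝ) (e : Fin 3) (p : PolySpace 1) (j : BdryIdx 1) :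
    fluxDof (bdryFluxPoints 1 t) (vertexField e p) j =
      if j.1 = e then √3 * MvPolynomial.eval (edgePoint e (t j.2)) (p : BiPoly) else 0 := by
  have h1 := sum_edgeNormal_mul_edgePoint j.1 (t j.2)
  have h2 := sum_edgeNormal_mul_vertex e j.1
  have h : fluxDof (bdryFluxPoints 1 t) (vertexField e p) j =
      MvPolynomial.eval (edgePoint j.1 (t j.2)) (p : BiPoly) *
        (∑ i, edgeNormal j.1 i * edgePoint j.1 (t j.2) i -
          ∑ i, edgeNormal j.1 i * vertex (e + 2) i) := by
    rw [← Finset.sum_sub_distrib, Finset.mul_sum]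
    refine Finset.sum_congr rfl fun i _ => ?_
    simp [vertexField, bdryFluxPoints]
    ring
  rw [h, h1, h2]
  split_ifs with he
  · rw [he]; ring
  · ring

/-- The arc-length parameter of the edge `e`, extended to the plane. -/
noncomputable def edgeParam (e : Fin 3) : BiPoly :=
  ∑ i, ((vertex (e + 1) i - vertex e i) / 2) • MvPolynomial.X i

theorem eval_edgeParam (e : Fin 3) (s : ℝ) :
    MvPolynomial.eval (edgePoint e s) (edgeParam e) = s := by
  have h := sqrt_three_inv
  have h3 := sqrt_three_mul_self
  simp only [edgeParam, Fin.sum_univ_two]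
  fin_cases e
  · simp [edgePoint_zero, vertex]
  · simp [edgePoint_one, vertex, div_eq_mul_inv, h]
    linear_combination (1 / 12 + s / 4) * h3
  · simp [edgePoint_two, vertex, div_eq_mul_inv, h]
    linear_combination (-1 / 12 + s / 4) * h3

theorem totalDegree_sum_smul_X_le (b : Fin 2 → ℝ) :
    (∑ i, b i • MvPolynomial.X i : BiPoly).totalDegree ≤ 1 :=
  MvPolynomial.totalDegree_finsetSum_le fun _ _ =>
    (MvPolynomial.totalDegree_smul_le _ _).trans (by simp)

/-- The nodal polynomials of the edge `e`, extended to the plane. -/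
noncomputable def edgeLagrange {t : Fin 2 → ℝ} (ht : Function.Injective t) (j : BdryIdx 1) : PolySpace 1 :=
  ⟨Polynomial.aeval (edgeParam j.1) (Lagrange.basis Finset.univ t j.2), by
    rw [MvPolynomial.mem_restrictTotalDegree]
    refine totalDegree_aeval_le _ _ (totalDegree_sum_smul_X_le _) _ ?_
    rw [Lagrange.natDegree_basis (ht.injOn) (Finset.mem_univ _)]
    simp⟩

theorem eval_edgeLagrange {t : Fin 2 → ℝ} (ht : Function.Injective t) (j : BdryIdx 1) (i : Fin 2) :
    MvPolynomial.eval (edgePoint j.1 (t i)) (edgeLagrange ht j : BiPoly) =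
      if j.2 = i then 1 else 0 := by
  have h : MvPolynomial.eval (edgePoint j.1 (t i)) (edgeLagrange ht j : BiPoly) =
      (Lagrange.basis Finset.univ t j.2).eval (t i) := by
    conv_rhs => rw [← eval_edgeParam j.1 (t i), ← Polynomial.coe_aeval_eq_eval]
    simp only [← MvPolynomial.coe_aeval_eq_eval]
    exact (Polynomial.aeval_algHom_apply (MvPolynomial.aeval _) _ _).symm
  rw [h]
  split_ifs with hi
  · rw [hi, Lagrange.eval_basis_self ht.injOn (Finset.mem_univ _)]
  · exact Lagrange.eval_basis_of_ne hi (Finset.mem_univ _)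

/-- A boundary flux basis function, up to the interior degrees of freedom. -/
noncomputable def edgeField {t : Fin 2 → ℝ} (ht : Function.Injective t) (j : BdryIdx 1) : RT 1 :=
  (√3 / 3) • vertexField j.1 (edgeLagrange ht j)

theorem fluxDof_edgeField {t : Fin 2 → ℝ} (ht : Function.Injective t) (j j' : BdryIdx 1) :
    fluxDof (bdryFluxPoints 1 t) (edgeField ht j) j' = if j = j' then 1 else 0 := by
  rw [edgeField, Submodule.coe_smul, fluxDof_smul, Pi.smul_apply, fluxDof_vertexField,
    eval_edgeLagrange ht, smul_eq_mul]
  have h3 := sqrt_three_mul_self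
  by_cases h1 : j'.1 = j.1 <;> by_cases h2 : j.2 = j'.2 <;>
    simp [Prod.ext_iff, h1, h2, eq_comm (a := j.1)]
  linarith

/-- The barycentric coordinate that vanishes on the edge `e`. -/
noncomputable def edgeHat (e : Fin 3) : PolySpace 1 :=
  ⟨MvPolynomial.C (1 / 3) - ∑ i, (√3 / 3 * edgeNormal e i) • MvPolynomial.X i, by
    refine Submodule.sub_mem _ ?_ ?_
    · rw [MvPolynomial.mem_restrictTotalDegree]
      simp
    · rw [MvPolynomial.mem_restrictTotalDegree]
      exact totalDegree_sum_smul_X_le _⟩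

theorem eval_edgeHat (e : Fin 3) (s : ℝ) :
    MvPolynomial.eval (edgePoint e s) (edgeHat e : BiPoly) = 0 := by
  have h := sum_edgeNormal_mul_edgePoint e s
  have h3 := sqrt_three_mul_self
  rw [Fin.sum_univ_two] at h
  simp [edgeHat, MvPolynomial.smul_eval, Fin.sum_univ_two]
  linear_combination (-√3 / 3) * h - h3 / 9

/-- A field with vanishing normal components on all edges. -/
noncomputable def bubble (e : Fin 3) : RT 1 := vertexField e (edgeHat e)

theorem fluxDof_bubble (t : Fin 2 → ℝ) (e : Fin 3) :
    fluxDof (bdryFluxPoints 1 t) (bubble e) = 0 := by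
  funext j
  rw [bubble, fluxDof_vertexField, eval_edgeHat, mul_zero, ite_self]
  rfl

theorem eval_bubble (e : Fin 3) (i : Fin 2) :
    MvPolynomial.eval 0 ((bubble e : Fin 2 → BiPoly) i) = -(vertex (e + 2) i / 3) := by
  simp [bubble, vertexField, edgeHat]
  ring

/-- The interior flux basis functions. -/
noncomputable def interiorField : Fin 2 → RT 1 :=
  ![(3 / 2 : ℝ) • (bubble 1 - bubble 2), (-(3 * √3 / 2)) • bubble 0]

theorem fluxDof_interiorField (t : Fin 2 → ℝ) (i : Fin 2) :
    fluxDof (bdryFluxPoints 1 t) (interiorField i) = 0 := by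
  have h : ∀ e, fluxDofMap 1 (bdryFluxPoints 1 t) (bubble e) = 0 := fluxDof_bubble t
  change fluxDofMap 1 (bdryFluxPoints 1 t) (interiorField i) = 0
  fin_cases i <;> simp [interiorField, h]

/-- At the centroid `bubble e` equals minus one third of the vertex opposite to `e`. The difference
of two bubbles is thus horizontal and the remaining one vertical, which explains the coefficients of
`interiorField`. -/
theorem eval_interiorField (i j : Fin 2) :
    MvPolynomial.eval 0 ((interiorField i : Fin 2 → BiPoly) j) = if i = j then 1 else 0 := by
  have h := eval_bubble
  have h3 := sqrt_three_inv
  have h4 := sqrt_three_mul_self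
  fin_cases i <;> fin_cases j <;>
    simp [-MvPolynomial.eval_zero, interiorField, MvPolynomial.smul_eval, h, vertex, div_eq_mul_inv, h3]
  · norm_num
  · linear_combination h4 / 3

/-- The Lagrange basis of the collocated scheme with the centroid as interior point. -/
noncomputable def centroidBasis {t : Fin 2 → ℝ} (ht : Function.Injective t) : BdryIdx 1 ⊕ Unit × Fin 2 → RT 1
  | Sum.inl j => edgeField ht j -
      ∑ i, MvPolynomial.eval 0 ((edgeField ht j : Fin 2 → BiPoly) i) • interiorField i
  | Sum.inr s => interiorField s.2

theorem fluxDof_centroid (F : Fin 2 → BiPoly) (s : Unit × Fin 2) :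
    fluxDof (collocated centroid) F s = MvPolynomial.eval 0 (F s.2) := by
  rw [fluxDof_collocated, ← centroid_eq]

theorem isSDBasis_centroidBasis {t : Fin 2 → ℝ} (ht : Function.Injective t) :
    IsSDBasis 1 t (collocated centroid) (centroidBasis ht) := by
  refine ⟨fun s j' => ?_, fun s s' => ?_⟩
  · change fluxDofMap 1 (bdryFluxPoints 1 t) (centroidBasis ht s) j' = _
    have hi : ∀ i, fluxDofMap 1 (bdryFluxPoints 1 t) (interiorField i) = 0 :=
      fluxDof_interiorField t
    have he : ∀ j, fluxDofMap 1 (bdryFluxPoints 1 t) (edgeField ht j) j' = if j = j' then 1 else 0 :=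
      fun j => fluxDof_edgeField ht j j'
    rcases s with j | s
    · simp [centroidBasis, hi, he]
    · simp [centroidBasis, hi]
  · rw [fluxDof_centroid]
    rcases s with j | s
    · have hs : ∀ f : Fin 2 → ℝ, (∑ i, if i = s'.2 then f i else 0) = f s'.2 := fun f => by simp
      have he : (centroidBasis ht (Sum.inl j) : Fin 2 → BiPoly) s'.2 =
          (edgeField ht j : Fin 2 → BiPoly) s'.2 - ∑ i,
            MvPolynomial.eval 0 ((edgeField ht j : Fin 2 → BiPoly) i) •
              (interiorField i : Fin 2 → BiPoly) s'.2 := by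
        simp [centroidBasis]
      simp only [he, map_sub, map_sum, MvPolynomial.smul_eval, eval_interiorField, mul_ite, mul_one,
        mul_zero, hs, sub_self, reduceCtorEq, if_false]
    · simp [-MvPolynomial.eval_zero, centroidBasis, eval_interiorField, Prod.ext_iff]

/-- The boundary basis functions vanish at the centroid, so the formula for linear modes applies to
every column. For uniqueness of `q₀`, not all of these functions can have mean zero. -/
theorem residual_linearQ_eq_zero {t : Fin 2 → ℝ} (ht : Function.Injective t)
    {h : BdryIdx 1 ⊕ Unit × Fin 2 → RT 1} (hh : IsSDBasis 1 t (collocated centroid) h) {q₀ : ℝ} :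
    residual 1 t h (TriFR.linearQ q₀) = 0 ↔ q₀ = 1 / 3 := by
  have h0 : ∀ j i, MvPolynomial.eval 0 ((h (Sum.inl j) : Fin 2 → BiPoly) i) = 0 := by
    intro j i
    have := hh.2 (Sum.inl j) ((), i)
    rw [fluxDof_centroid] at this
    simpa using this
  constructor
  · intro hA
    by_contra hq
    have hz : ∀ j i, triInt ((h (Sum.inl j) : Fin 2 → BiPoly) i) = 0 := by
      intro j i
      have h1 := fieldResidual_linearMode ht q₀ (h0 j) i
      rw [← hh.residual_apply, hA, Matrix.zero_apply] at h1
      have h2 : linearFactor * (3 * q₀ - 1) ≠ 0 := by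
        refine mul_ne_zero linearFactor_pos.ne' fun h3 => hq ?_
        linarith
      exact (mul_eq_zero.mp h1.symm).resolve_left h2
    -- The combination whose normal trace interpolates `x`; both have degree at most one on each
    -- edge, so they agree on the whole boundary.
    set F : RT 1 := ∑ j : BdryIdx 1, edgePoint j.1 (t j.2) 0 • h (Sum.inl j) with hFdef
    have hF : ∀ i, (F : Fin 2 → BiPoly) i =
        ∑ j : BdryIdx 1, edgePoint j.1 (t j.2) 0 • (h (Sum.inl j) : Fin 2 → BiPoly) i := by
      intro i
      rw [hFdef, Submodule.coe_sum, Finset.sum_apply]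
      rfl
    have hF0 : ∀ i, MvPolynomial.eval 0 ((F : Fin 2 → BiPoly) i) = 0 := by
      intro i
      simp [-MvPolynomial.eval_zero, hF, MvPolynomial.smul_eval, h0]
    have hFz : triInt ((F : Fin 2 → BiPoly) 0) = 0 := by
      simp [hF, hz]
    have hdof : ∀ j : BdryIdx 1, fluxDof (bdryFluxPoints 1 t) F j = edgePoint j.1 (t j.2) 0 := by
      intro j
      change fluxDofMap 1 (bdryFluxPoints 1 t) F j = _
      have hb : ∀ j', fluxDofMap 1 (bdryFluxPoints 1 t) (h (Sum.inl j')) j =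
          if j' = j then 1 else 0 := by
        intro j'
        have h1 := hh.1 (Sum.inl j') j
        simp only [Sum.inl.injEq] at h1
        exact h1
      simp [hFdef, hb]
    have htrace : ∀ e s, MvPolynomial.eval (edgePoint e s) (normalTrace e F) = edgePoint e s 0 := by
      intro e s
      have hx : (edgePoly e (MvPolynomial.X 0)).natDegree ≤ 1 :=
        (natDegree_edgePoly_le _ _).trans (by simp)
      have h1 := eval_eq_sum_lagrange ht (natDegree_edgePoly_normalTrace_le e F.2) s
      have h2 := eval_eq_sum_lagrange ht hx s
      simp only [eval_edgePoly, MvPolynomial.eval_X] at h1 h2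
      rw [h1, h2]
      refine Finset.sum_congr rfl fun i _ => ?_
      rw [← hdof (e, i), eval_normalTrace]
      rfl
    have hedge : ∀ e, edgeInt e (MvPolynomial.X 0 * normalTrace e F) =
        edgeInt e (scaledMonomial 2 0) := by
      intro e
      simp only [edgeInt_apply, map_mul, htrace, MvPolynomial.eval_X, eval_scaledMonomial]
      simp [sq]
    -- The divergence theorem tested with `x` gives `∫ x²` over the boundary on one side and `4 ∫ F
    -- 0 = 0` on the other. By Euler's identity the boundary integral is a positive multiple of `∫
    -- x²` over the triangle, which is not zero.
    have h1 := sum_edgeInt_normalTrace (MvPolynomial.X 0) F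
    rw [triInt_X_mul_divMap F.2 hF0, hFz] at h1
    simp only [hedge] at h1
    have h2 := triInt_scaledMonomial_eq_edges 2 0
    rw [h1, triInt_scaledMonomial_20] at h2
    simp [Fin.sum_univ_two, hFz] at h2
  · rintro rfl
    ext m j
    rw [hh.residual_apply]
    rcases mode_one_cases m with rfl | ⟨i, rfl⟩
    · exact fieldResidual_constMode ht _ _
    · rw [fieldResidual_linearMode ht _ (h0 j)]
      norm_num

theorem centroid_scheme {t : Fin 2 → ℝ} (ht : Function.Injective t) :
    (∃ h, IsSDBasis 1 t (collocated centroid) h) ∧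
      ∀ h, IsSDBasis 1 t (collocated centroid) h →
        sdCorrection 1 h = frCorrection 1 t (TriFR.linearQ (1 / 3)) ∧
        ∀ q₀ : ℝ, residual 1 t h (TriFR.linearQ q₀) = 0 ↔ q₀ = 1 / 3 := by
  refine ⟨⟨_, isSDBasis_centroidBasis ht⟩, fun h hh => ⟨?_, fun q₀ => residual_linearQ_eq_zero ht hh⟩⟩
  exact ((extendedRange_linearQ (by norm_num)).residual_eq_zero_iff t h).mp
    ((residual_linearQ_eq_zero ht hh).mpr rfl)

end TriFR

theorem mainTheorem4 :
    -- `k = 1`: the admissible `Q` are exactly `diag(0, q₀, q₀)` with `q₀ > -1`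
    (∀ Q : Matrix (TriFR.Mode 1) (TriFR.Mode 1) ℝ,
      TriFR.ExtendedRange 1 Q ↔ ∃ q₀ : ℝ, -1 < q₀ ∧ Q = TriFR.linearQ q₀) ∧
    -- `k = 1`: the SD scheme exists and is recovered at `q₀ = 1/3`, and only there
    (∀ t, TriFR.IsEdgeNodes 1 t →
      (∃ h, TriFR.IsSDBasis 1 t (TriFR.collocated TriFR.centroid) h) ∧
      ∀ h, TriFR.IsSDBasis 1 t (TriFR.collocated TriFR.centroid) h →
        TriFR.sdCorrection 1 h = TriFR.frCorrection 1 t (TriFR.linearQ (1 / 3)) ∧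
        ∀ q₀ : ℝ, TriFR.residual 1 t h (TriFR.linearQ q₀) = 0 ↔ q₀ = 1 / 3) ∧
    -- `k = 2`: three collocated interior points
    (∀ z₁ ∈ Set.Icc (0 : ℝ) (1 / 2),
      TriFR.NoStableSD 2 (TriFR.collocated (TriFR.orbit3 z₁))) ∧
    -- `k = 2`: six interior points, as two three-point orbits or one six-point orbit, with
    -- arbitrary normals
    (∀ z : Fin 2 → ℝ, (∀ o, z o ∈ Set.Icc (0 : ℝ) (1 / 2)) →
      ∀ n : Fin 2 × Fin 3 → TriFR.Pt,
        TriFR.NoStableSD 2 ⟨fun s => TriFR.orbit3 (z s.1) s.2, n⟩) ∧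
    (∀ z₁ z₂ : ℝ, 0 ≤ z₁ → 0 ≤ z₂ → z₁ + z₂ ≤ 1 →
      ∀ n : Equiv.Perm (Fin 3) → TriFR.Pt,
        TriFR.NoStableSD 2 ⟨TriFR.orbit6 z₁ z₂, n⟩) ∧
    -- `k = 3`: orbits `(0,2,0)` and `(0,0,1)`, collocated
    (∀ z : Fin 2 → ℝ, (∀ o, z o ∈ Set.Icc (0 : ℝ) (1 / 2)) →
      TriFR.NoStableSD 3
        (TriFR.collocated fun s : Fin 2 × Fin 3 => TriFR.orbit3 (z s.1) s.2)) ∧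
    (∀ z₁ z₂ : ℝ, 0 ≤ z₁ → 0 ≤ z₂ → z₁ + z₂ ≤ 1 →
      TriFR.NoStableSD 3 (TriFR.collocated (TriFR.orbit6 z₁ z₂))) :=
  ⟨TriFR.extendedRange_one_iff, fun _ ht => TriFR.centroid_scheme ht.1,
    fun z _ => TriFR.noStableSD_orbit3 z, fun z _ n => TriFR.noStableSD_two_orbit3_two z n,
    fun z₁ z₂ _ _ _ n => TriFR.noStableSD_orbit6_two z₁ z₂ n,
    fun z _ => TriFR.noStableSD_two_orbit3_three z,
    fun z₁ z₂ _ _ _ => TriFR.noStableSD_orbit6_three z₁ z₂⟩
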